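/- **Setting.** Let $X$ be a Banach space, $U$ a reflexive Banach space, $T>0$, $0<\nu<1$, and let $\mathcal A$ be the infinitesimal generator of a uniformly bounded $C_0$-semigroup $\{\mathcal T(t)\}_{t\ge 0}$ on $X$ with $\mathcal T(t)$ compact for every $t>0$ and $0\in\varrho(\mathcal A)$. For $0<\mu<1$ put $$\mathcal A^{-\mu}=\frac{\sin \pi\mu}{\pi}\int_0^\infty \lambda^{-\mu}(\lambda-\mathcal A)^{-1}\,d\lambda ,$$ let $\mathcal A^{\mu}$ be the inverse of $\mathcal A^{-\mu}$, with domain the range of $\mathcal A^{-\mu}$, and $\mathcal A^{1}=-\mathcal A$ (so these are the powers of $-\mathcal A$). Only in these powers does the symbol stand for $-\mathcal A$; elsewhere $\mathcal A$ is the generator. Assume that for every $\mu\in(0,1]$ there is $\mathbb L_\mu>0$ such that $\mathcal T(t)X\subseteq D(\mathcal A^\mu)$ and $|\mathcal A^\mu \mathcal T(t)|\le \mathbb L_\mu t^{-\mu}$ for $0<t\le T$. Let $\mathcal B\in\mathcal L(U,X)$ and $x_0,x_d\in X$. Let $\mathcal C=C([0,T];X)$ with the supremum norm. For $x\in\mathcal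 C$ and $t\in[0,T]$ let $x_t\in\mathcal C$ be the history of $x$ up to time $t$, $x_t(s)=x(\min(s,t))$. Let $h:[0,T]\times\mathcal C\to X$ be continuous, and let $\varsigma\in(0,1)$ and $H,H_1>0$ be such that for all $t\in[0,T]$, $z,y\in\mathcal C$: $h(t,z)\in D(\mathcal A^\varsigma)$, the function $\mathcal A^\varsigma h(\cdot,z)$ is strongly measurable, $$|\mathcal A^\varsigma h(t,z)-\mathcal A^\varsigma h(t,y)|\le H\|z-y\|,\qquad |\mathcal A^\varsigma h(t,z)|\le H_1(\|z\|+1).$$ Assume that either $\nu>\tfrac12$, or $h$ has no memory, that is, $h(t,z)$ depends only on $t$ and $z(t)$, so that $h(t,x_t)$ is a function of $t$ and $x(t)$ (and then $\nu\in(0,1)$ is arbitrary). For $\theta>0$ let $$\psi_\nu(\theta)=\frac1\pi\sum_{n=1}^\infty(-1)^{n-1}\theta^{-\nu n-1}\frac{\Gamma(n\nu+1)}{n!}\sin(n\pi\nu),\qquad \phi_\nu(\theta)=\frac1\nu\,\theta^{-1-1/\nu}\,\psi_\nu(\theta^{-1/\nu}),$$ $$S_\nu(t)y=\int_0^\infty\phi_\nu(\theta)\mathcal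 T(t^\nu\theta)y\,d\theta,\qquad K_\nu(t)y=\nu\int_0^\infty\theta\,\phi_\nu(\theta)\mathcal T(t^\nu\theta)y\,d\theta .$$ A mild solution for $u\in L^2(0,T;U)$ of ${}^CD^\nu_t[x(t)-h(t,x_t)]=\mathcal Ax(t)+\mathcal Bu(t)$, $x(0)=x_0$, is an $x\in\mathcal C$ with $x(0)=x_0$ such that, for all $t\in[0,T]$, the integrals below are meaningful and converge absolutely and $$x(t)=S_\nu(t)[x_0-h(0,x_0)]+h(t,x_t)+\int_0^t(t-s)^{\nu-1}\mathcal AK_\nu(t-s)h(s,x_s)\,ds+\int_0^t(t-s)^{\nu-1}K_\nu(t-s)\mathcal Bu(s)\,ds,$$ where in $h(0,x_0)$ the vector $x_0$ stands for the constant function $x_0$. Let $\mathcal U_{ad}$ be the set of all $u\in L^2(0,T;U)$ that have a mild solution $x_u$ with $x_u(T)=x_d$. **Theorem.** Suppose that $1-H|\mathcal A^{-\varsigma}|>0$. Let $\mathcal U_{ad}$ be nonempty, closed in $L^2(0,T;U)$ and convex, let $\theta\ge 0$ and $\varepsilon>0$, and put $$J(u)=\frac{\theta}{2}\int_0^T|x_u(t)-x_d|^2\,dt+\frac{\varepsilon}{2}\int_0^T|u(t)|^2\,dt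 .$$ Then every $u\in L^2(0,T;U)$ has at most one mild solution $x_u$, so that $J$ is well defined on $\mathcal U_{ad}$, and there is $u^\star\in\mathcal U_{ad}$ with $J(u^\star)\le J(u)$ for all $u\in\mathcal U_{ad}$. -/

import Mathlib

open Set Filter Topology MeasureTheory
open scoped ENNReal

noncomputable section

/-- A strongly continuous one-parameter semigroup of bounded operators on `X`;
only the values at times `t ≥ 0` are relevant. -/
structure C0Semigroup (X : Type*) [NormedAddCommGroup X] [NormedSpace ℝ X] where
  toFun : ℝ → X →L[ℝ] X
  at_zero : toFun 0 = ContinuousLinearMap.id ℝ X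
  add_time : ∀ s t : ℝ, 0 ≤ s → 0 ≤ t → toFun (s + t) = (toFun s).comp (toFun t)
  strongly_continuous : ∀ x : X, Tendsto (fun t => toFun t x) (𝓝[>] 0) (𝓝 x)

namespace C0Semigroup

variable {X : Type*} [NormedAddCommGroup X] [NormedSpace ℝ X]

/-- The graph of the infinitesimal generator: the pairs `(x, y)` such that
`(S(t) x - x) / t → y` as `t → 0+`. -/
def generatorGraph (S : C0Semigroup X) : Submodule ℝ (X × X) where
  carrier := {p | Tendsto (fun t : ℝ => t⁻¹ • (S.toFun t p.1 - p.1)) (𝓝[>] 0) (𝓝 p.2)}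
  zero_mem' := by simp
  add_mem' := by
    intro a b ha hb
    have h := Tendsto.add (show Tendsto _ _ _ from ha) (show Tendsto _ _ _ from hb)
    refine Tendsto.congr (fun t => ?_) h
    simp only [Prod.fst_add, map_add]
    rw [← smul_add]
    congr 1
    abel
  smul_mem' := by
    intro c a ha
    have h := Tendsto.const_smul (show Tendsto _ _ _ from ha) c
    refine Tendsto.congr (fun t => ?_) h
    simp only [Prod.smul_fst, map_smul]
    rw [← smul_sub, smul_comm]

/-- The graph above is the graph of a function, so that the generator defined next
is really the infinitesimal generator. -/
theorem generatorGraph_single_valued (S : C0Semigroup X) :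
    ∀ p ∈ S.generatorGraph, p.1 = 0 → p.2 = 0 := by
  intro p hp h0
  have h : Tendsto (fun t : ℝ => t⁻¹ • (S.toFun t p.1 - p.1)) (𝓝[>] 0) (𝓝 p.2) := hp
  simp only [h0, map_zero, sub_zero, smul_zero] at h
  exact tendsto_nhds_unique h tendsto_const_nhds

/-- The infinitesimal generator, as an unbounded operator with its natural domain. -/
def generator (S : C0Semigroup X) : X →ₗ.[ℝ] X := S.generatorGraph.toLinearPMap

theorem generator_graph (S : C0Semigroup X) : S.generator.graph = S.generatorGraph :=
  Submodule.toLinearPMap_graph_eq _ S.generatorGraph_single_valued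

/-- `sup_{t ≥ 0} ‖S(t)‖ < ∞`. -/
def UniformlyBounded (S : C0Semigroup X) : Prop :=
  ∃ M : ℝ, ∀ t : ℝ, 0 ≤ t → ‖S.toFun t‖ ≤ M

/-- `S(t)` is a compact operator for every `t > 0`. -/
def IsCompactSemigroup (S : C0Semigroup X) : Prop :=
  ∀ t : ℝ, 0 < t → IsCompactOperator (S.toFun t)

end C0Semigroup

section UnboundedOperators

variable {X : Type*} [NormedAddCommGroup X] [NormedSpace ℝ X]

open Classical in
/-- The value of an unbounded operator at `x`; it is used only at points of the domain
(the value `0` outside the domain is a convention). -/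
def unboundedApply (A : X →ₗ.[ℝ] X) (x : X) : X :=
  if hx : x ∈ A.domain then A ⟨x, hx⟩ else 0

/-- `R` is a bounded two-sided inverse of `c - A : D(A) → X`. -/
def IsResolventAt (A : X →ₗ.[ℝ] X) (c : ℝ) (R : X →L[ℝ] X) : Prop :=
  (∀ x : X, ∃ hx : R x ∈ A.domain, c • R x - A ⟨R x, hx⟩ = x) ∧
    ∀ x : A.domain, R (c • (x : X) - A x) = x

/-- `c` belongs to the resolvent set of `A`. -/
def InResolventSet (A : X →ₗ.[ℝ] X) (c : ℝ) : Prop := ∃ R, IsResolventAt A c R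

open Classical in
/-- The resolvent operator `(c - A)⁻¹`, for `c` in the resolvent set. -/
def resolventOp (A : X →ₗ.[ℝ] X) (c : ℝ) : X →L[ℝ] X :=
  if h : InResolventSet A c then h.choose else 0

/-- The bounded operator `(-A)^{-μ}`, `0 < μ < 1`, by Balakrishnan's formula
`(sin (π μ) / π) ∫_0^∞ c^{-μ} (c - A)⁻¹ dc`. -/
def fracPowNeg (A : X →ₗ.[ℝ] X) (μ : ℝ) : X →L[ℝ] X :=
  (Real.sin (Real.pi * μ) / Real.pi) • ∫ c in Ioi (0 : ℝ), c ^ (-μ) • resolventOp A c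

open Classical in
/-- The unbounded operator `(-A)^μ`, `0 < μ ≤ 1`: it is `-A` for `μ = 1`, and for `0 < μ < 1`
the inverse of `(-A)^{-μ}`, with domain the range of `(-A)^{-μ}`. -/
def fracPow (A : X →ₗ.[ℝ] X) (μ : ℝ) : X →ₗ.[ℝ] X :=
  if μ = 1 then -A
  else (LinearMap.toPMap (fracPowNeg A μ : X →ₗ[ℝ] X) ⊤).inverse

/-- The smoothing estimates on `(0, T]`: for every `μ ∈ (0, 1]` there is `L > 0` such that
`S(t)` maps into `D((-A)^μ)` and `‖(-A)^μ S(t)‖ ≤ L / t^μ` for `0 < t ≤ T`,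
where `A` is the generator of `S`. -/
def C0Semigroup.SmoothingEstimates (S : C0Semigroup X) (T : ℝ) : Prop :=
  ∀ μ : ℝ, 0 < μ → μ ≤ 1 → ∃ L : ℝ, 0 < L ∧ ∀ t : ℝ, 0 < t → t ≤ T → ∀ x : X,
    ∃ hx : S.toFun t x ∈ (fracPow S.generator μ).domain,
      ‖fracPow S.generator μ ⟨S.toFun t x, hx⟩‖ ≤ L / t ^ μ * ‖x‖

end UnboundedOperators

/-- A real normed space is reflexive if its canonical embedding into the bidual is onto. -/
def IsReflexiveSpace (U : Type*) [NormedAddCommGroup U] [NormedSpace ℝ U] : Prop :=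
  Function.Surjective (NormedSpace.inclusionInDoubleDual ℝ U)

/-- `ψ_ν(θ) = (1/π) ∑_{n ≥ 1} (-1)^{n-1} θ^{-νn-1} Γ(nν+1)/n! sin(nπν)`
(the sum is indexed by `n - 1`). -/
def stableDensity (ν θ : ℝ) : ℝ :=
  (1 / Real.pi) * ∑' n : ℕ, (-1 : ℝ) ^ n * θ ^ (-(ν * ((n : ℝ) + 1)) - 1) *
    (Real.Gamma (((n : ℝ) + 1) * ν + 1) / ((n + 1).factorial : ℝ)) *
    Real.sin (((n : ℝ) + 1) * Real.pi * ν)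

/-- `φ_ν(θ) = (1/ν) θ^{-1-1/ν} ψ_ν(θ^{-1/ν})`. -/
def probDensity (ν θ : ℝ) : ℝ :=
  (1 / ν) * θ ^ (-1 - 1 / ν) * stableDensity ν (θ ^ (-(1 / ν)))

/-- The data of the control system `D^ν [x(t) - h(t, x_t)] = A x(t) + B u(t)` on `(0, T]`,
`x(0) = x₀`, where `D^ν` is the Caputo derivative, `0 < ν < 1`, and `A` is the generator of
the semigroup. Only the values `h t` for `t ∈ [0, T]` are relevant. -/
structure NeutralSystem (X U : Type*) [NormedAddCommGroup X] [NormedSpace ℝ X]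
    [NormedAddCommGroup U] [NormedSpace ℝ U] where
  T : ℝ
  T_pos : 0 < T
  ν : ℝ
  ν_pos : 0 < ν
  ν_lt_one : ν < 1
  semigroup : C0Semigroup X
  B : U →L[ℝ] X
  h : ℝ → C(Icc (0 : ℝ) T, X) → X
  x₀ : X

namespace NeutralSystem

variable {X U : Type*} [NormedAddCommGroup X] [NormedSpace ℝ X]
  [NormedAddCommGroup U] [NormedSpace ℝ U]

/-- The generator of the semigroup. -/
abbrev A (P : NeutralSystem X U) : X →ₗ.[ℝ] X := P.semigroup.generator

/-- The state space `C(0, T; X)`, with the supremum norm. -/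
abbrev Path (P : NeutralSystem X U) : Type _ := C(Icc (0 : ℝ) P.T, X)

/-- The control space `L²(0, T; U)`. -/
abbrev Control (P : NeutralSystem X U) : Type _ :=
  Lp U 2 (volume.restrict (Ioc (0 : ℝ) P.T))

/-- The value of a path at a real time (constant extension outside `[0, T]`). -/
def eval (P : NeutralSystem X U) (x : P.Path) (t : ℝ) : X :=
  x (projIcc 0 P.T P.T_pos.le t)

/-- The history `x_t` of `x` up to time `t`, as an element of `C(0, T; X)`:
`x_t(s) = x(min s t)`. -/
def history (P : NeutralSystem X U) (x : P.Path) (t : ℝ) : P.Path where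
  toFun s := P.eval x (min (s : ℝ) t)
  continuous_toFun := by
    unfold eval
    exact x.continuous.comp (continuous_projIcc.comp
      (continuous_subtype_val.min continuous_const))

/-- `S_ν(t) y = ∫_0^∞ φ_ν(θ) S(t^ν θ) y dθ`. -/
def solS (P : NeutralSystem X U) (t : ℝ) (y : X) : X :=
  ∫ θ in Ioi (0 : ℝ), probDensity P.ν θ • P.semigroup.toFun (t ^ P.ν * θ) y

/-- `K_ν(t) y = ν ∫_0^∞ θ φ_ν(θ) S(t^ν θ) y dθ`. -/
def solK (P : NeutralSystem X U) (t : ℝ) (y : X) : X :=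
  P.ν • ∫ θ in Ioi (0 : ℝ), (θ * probDensity P.ν θ) • P.semigroup.toFun (t ^ P.ν * θ) y

/-- The integrand `(t-s)^{ν-1} A K_ν(t-s) h(s, x_s)`. -/
def neutralIntegrand (P : NeutralSystem X U) (x : P.Path) (t s : ℝ) : X :=
  (t - s) ^ (P.ν - 1) •
    unboundedApply P.A (P.solK (t - s) (P.h s (P.history x s)))

/-- The integrand `(t-s)^{ν-1} K_ν(t-s) B u(s)`. -/
def controlIntegrand (P : NeutralSystem X U) (u : P.Control) (t s : ℝ) : X :=
  (t - s) ^ (P.ν - 1) • P.solK (t - s) (P.B ((u : ℝ → U) s))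

/-- `x` is a mild solution for the control `u`: all terms of the integral equation are
meaningful and it holds at every `t ∈ [0, T]`. The history at time `0` is the constant
path `x₀`. -/
structure IsMildSolution (P : NeutralSystem X U) (u : P.Control) (x : P.Path) : Prop where
  initial : P.eval x 0 = P.x₀
  mem_domain : ∀ t ∈ Icc (0 : ℝ) P.T, ∀ s ∈ Ioo (0 : ℝ) t,
    P.solK (t - s) (P.h s (P.history x s)) ∈ P.A.domain
  neutral_integrable : ∀ t ∈ Icc (0 : ℝ) P.T,
    IntegrableOn (P.neutralIntegrand x t) (Ioc 0 t)
  control_integrable : ∀ t ∈ Icc (0 : ℝ) P.T,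
    IntegrableOn (P.controlIntegrand u t) (Ioc 0 t)
  equation : ∀ t ∈ Icc (0 : ℝ) P.T,
    P.eval x t =
      P.solS t (P.x₀ - P.h 0 (ContinuousMap.const _ P.x₀)) + P.h t (P.history x t)
        + (∫ s in (0 : ℝ)..t, P.neutralIntegrand x t s)
        + ∫ s in (0 : ℝ)..t, P.controlIntegrand u t s

open Classical in
/-- The mild solution `x_u` (meaningful when `u` has exactly one mild solution). -/
def state (P : NeutralSystem X U) (u : P.Control) : P.Path :=
  if h : ∃ x, P.IsMildSolution u x then h.choose else 0

/-- The admissible controls: those with a mild solution that reaches `xd` at time `T`. -/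
def admissible (P : NeutralSystem X U) (xd : X) : Set P.Control :=
  {u | ∃ x, P.IsMildSolution u x ∧ P.eval x P.T = xd}

/-- The cost `J(u) = (θ/2) ∫_0^T ‖x_u(t) - xd‖² dt + (ε/2) ∫_0^T ‖u(t)‖² dt`. -/
def cost (P : NeutralSystem X U) (xd : X) (θ ε : ℝ) (u : P.Control) : ℝ :=
  θ / 2 * (∫ t in (0 : ℝ)..P.T, ‖P.eval (P.state u) t - xd‖ ^ 2)
    + ε / 2 * ∫ t in (0 : ℝ)..P.T, ‖(u : ℝ → U) t‖ ^ 2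

/-- The conditions on the neutral term `h`, with exponent `ς`, Lipschitz constant `H` and
growth constant `H₁`. Here `(-A)^ς h(t, z)` is `unboundedApply (fracPow A ς) (h t z)`. -/
structure NeutralTermCondition (P : NeutralSystem X U) (ς H H₁ : ℝ) : Prop where
  continuous : ContinuousOn (fun p : ℝ × P.Path => P.h p.1 p.2)
    (Icc (0 : ℝ) P.T ×ˢ univ)
  mem_domain : ∀ t ∈ Icc (0 : ℝ) P.T, ∀ z : P.Path, P.h t z ∈ (fracPow P.A ς).domain
  measurable : ∀ z : P.Path, StronglyMeasurable
    (fun t : Icc (0 : ℝ) P.T => unboundedApply (fracPow P.A ς) (P.h t z))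
  lipschitz : ∀ t ∈ Icc (0 : ℝ) P.T, ∀ z y : P.Path,
    ‖unboundedApply (fracPow P.A ς) (P.h t z) - unboundedApply (fracPow P.A ς) (P.h t y)‖
      ≤ H * ‖z - y‖
  growth : ∀ t ∈ Icc (0 : ℝ) P.T, ∀ z : P.Path,
    ‖unboundedApply (fracPow P.A ς) (P.h t z)‖ ≤ H₁ * (‖z‖ + 1)

/-- `h(t, z)` depends on `z` only through the current value `z(t)`, that is,
`h(t, x_t)` is a function of `t` and `x(t)`. -/
def Memoryless (P : NeutralSystem X U) : Prop :=
  ∀ t ∈ Icc (0 : ℝ) P.T, ∀ z y : P.Path, P.eval z t = P.eval y t → P.h t z = P.h t y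

end NeutralSystem

end

section WeakSequences

/-- A bounded sequence in a Hilbert space has forward convex combinations which converge in norm. -/
theorem exists_convexHull_tail_tendsto_of_bounded {H : Type*} [NormedAddCommGroup H]
    [InnerProductSpace ℝ H] [CompleteSpace H] (g : ℕ → H) (C : ℝ) (hg : ∀ n, ‖g n‖ ≤ C) :
    ∃ (y : H) (z : ℕ → H), (∀ n, z n ∈ convexHull ℝ (g '' Ici n)) ∧ Tendsto z atTop (𝓝 y) := by
  set K : ℕ → Set H := fun n => closure (convexHull ℝ (g '' Ici n)) with hK
  have hmem : ∀ n, g n ∈ K n := fun n =>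
    subset_closure (subset_convexHull ℝ _ ⟨n, mem_Ici.2 le_rfl, rfl⟩)
  have hanti : ∀ n k, n ≤ k → K k ⊆ K n := fun n k h =>
    closure_mono (convexHull_mono (image_mono (Ici_subset_Ici.2 h)))
  have hconv : ∀ n, Convex ℝ (K n) := fun n => (convex_convexHull ℝ _).closure
  have hex : ∀ n, ∃ v ∈ K n, ∀ w ∈ K n, ‖v‖ ≤ ‖w‖ := by
    intro n
    obtain ⟨v, hv, hv'⟩ := exists_norm_eq_iInf_of_complete_convex (K := K n) ⟨g n, hmem n⟩
      isClosed_closure.isComplete (hconv n) 0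
    refine ⟨v, hv, fun w hw => ?_⟩
    rw [zero_sub, norm_neg] at hv'
    rw [hv']
    have := ciInf_le (f := fun w : K n => ‖(0 : H) - w‖)
      ⟨0, by rintro _ ⟨x, rfl⟩; exact norm_nonneg _⟩ ⟨w, hw⟩
    simpa using this
  choose m hm hmin using hex
  have hmono : Monotone fun n => ‖m n‖ := fun n k h => hmin n _ (hanti n k h (hm k))
  have hbd : BddAbove (range fun n => ‖m n‖) :=
    ⟨C, by rintro _ ⟨n, rfl⟩; exact (hmin n _ (hmem n)).trans (hg n)⟩
  set L := ⨆ n, ‖m n‖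
  have hlim : Tendsto (fun n => ‖m n‖) atTop (𝓝 L) := tendsto_atTop_ciSup hmono hbd
  have hle : ∀ n, ‖m n‖ ≤ L := fun n => le_ciSup hbd n
  have hL : 0 ≤ L := (norm_nonneg _).trans (hle 0)
  have hdist : ∀ n k, n ≤ k → dist (m n) (m k) ≤ √(2 * (L ^ 2 - ‖m n‖ ^ 2)) := by
    intro n k h
    rw [dist_eq_norm]
    apply Real.le_sqrt_of_sq_le
    have hmid : (1 / 2 : ℝ) • m n + (1 / 2 : ℝ) • m k ∈ K n :=
      hconv n (hm n) (hanti n k h (hm k)) (by norm_num) (by norm_num) (by norm_num)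
    have h1 := hmin n _ hmid
    rw [← smul_add, norm_smul] at h1
    norm_num at h1
    have h2 := parallelogram_law_with_norm ℝ (m n) (m k)
    have h3 := hle k
    have h4 := norm_nonneg (m n)
    have h5 := norm_nonneg (m k)
    nlinarith
  have hcauchy : CauchySeq m := by
    refine cauchySeq_of_le_tendsto_0' _ hdist ?_
    have : Tendsto (fun n => √(2 * (L ^ 2 - ‖m n‖ ^ 2))) atTop (𝓝 (√(2 * (L ^ 2 - L ^ 2)))) :=
      (Real.continuous_sqrt.tendsto _).comp ((tendsto_const_nhds.sub (hlim.pow 2)).const_mul 2)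
    simpa using this
  obtain ⟨y, hy⟩ := cauchySeq_tendsto_of_complete hcauchy
  have hz : ∀ n, ∃ z ∈ convexHull ℝ (g '' Ici n), dist (m n) z < 1 / ((n : ℝ) + 1) := fun n =>
    Metric.mem_closure_iff.1 (hm n) _ (by positivity)
  choose z hz hzd using hz
  refine ⟨y, z, hz, ?_⟩
  refine tendsto_of_tendsto_of_dist hy ?_
  exact squeeze_zero (fun _ => dist_nonneg) (fun n => (hzd n).le)
    tendsto_one_div_add_atTop_nhds_zero_nat

theorem exists_convexHull_tail_tendsto_map {E H : Type*} [AddCommGroup E] [Module ℝ E]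
    [NormedAddCommGroup H] [InnerProductSpace ℝ H] [CompleteSpace H] (L : E →ₗ[ℝ] H)
    (u : ℕ → E) (C : ℝ) (hu : ∀ n, ‖L (u n)‖ ≤ C) :
    ∃ (y : H) (z : ℕ → E), (∀ n, z n ∈ convexHull ℝ (u '' Ici n)) ∧
      Tendsto (fun n => L (z n)) atTop (𝓝 y) := by
  obtain ⟨y, z, hz, hzy⟩ := exists_convexHull_tail_tendsto_of_bounded (fun n => L (u n)) C hu
  have : ∀ n, ∃ x ∈ convexHull ℝ (u '' Ici n), L x = z n := by
    intro n
    have h := hz n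
    rw [show (fun n => L (u n)) '' Ici n = L '' (u '' Ici n) by rw [image_image],
      ← L.image_convexHull] at h
    exact h
  choose x hx hxz using this
  exact ⟨y, x, hx, by simpa only [hxz] using hzy⟩

/-- A sequence in a separable set is detected by a countable norming family of functionals. -/
theorem exists_norming_sequence {E : Type*} [NormedAddCommGroup E] [NormedSpace ℝ E]
    {s : Set E} (hs : TopologicalSpace.IsSeparable s) :
    ∃ f : ℕ → StrongDual ℝ E, (∀ j, ‖f j‖ ≤ 1) ∧
      ∀ x ∈ s, ∀ ε > 0, ∃ j, ‖x‖ - ε < f j x := by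
  obtain ⟨d, hd, hds⟩ := hs
  obtain rfl | ⟨e, he⟩ : s = ∅ ∨ s.Nonempty := s.eq_empty_or_nonempty
  · exact ⟨fun _ => 0, by simp, by simp⟩
  have hdne : d.Nonempty := closure_nonempty_iff.1 ⟨e, hds he⟩
  obtain ⟨v, rfl⟩ := hd.exists_eq_range hdne
  choose f hf hfv using fun j => exists_dual_vector'' ℝ (v j)
  refine ⟨f, hf, fun x hx ε hε => ?_⟩
  obtain ⟨_, ⟨j, rfl⟩, hj⟩ := Metric.mem_closure_iff.1 (hds hx) (ε / 2) (by positivity)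
  refine ⟨j, ?_⟩
  rw [dist_eq_norm] at hj
  have h1 : f j (v j) - f j x ≤ ‖x - v j‖ := by
    rw [← map_sub, norm_sub_rev]
    exact (le_abs_self _).trans ((f j).le_of_opNorm_le (hf j) _ |>.trans (by simp))
  have h2 : ‖x‖ - ‖v j‖ ≤ ‖x - v j‖ := norm_sub_norm_le _ _
  have h3 : f j (v j) = ‖v j‖ := by simpa using hfv j
  linarith

theorem eq_of_norming {E : Type*} [NormedAddCommGroup E] [NormedSpace ℝ E]
    {V : Submodule ℝ E} {f : ℕ → StrongDual ℝ E}
    (hf : ∀ x ∈ V, ∀ ε > 0, ∃ j, ‖x‖ - ε < f j x) {x y : E} (hx : x ∈ V) (hy : y ∈ V)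
    (h : ∀ j, f j x = f j y) : x = y := by
  by_contra hne
  have hpos : 0 < ‖x - y‖ := norm_pos_iff.2 (sub_ne_zero.2 hne)
  obtain ⟨j, hj⟩ := hf (x - y) (V.sub_mem hx hy) ‖x - y‖ hpos
  rw [map_sub, h j] at hj
  linarith

theorem mem_closed_submodule_of_dual {E : Type*} [NormedAddCommGroup E] [NormedSpace ℝ E]
    {V : Submodule ℝ E} (hV : IsClosed (V : Set E)) {x : E}
    (h : ∀ f : StrongDual ℝ E, (∀ v ∈ V, f v = 0) → f x = 0) : x ∈ V := by
  by_contra hx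
  obtain ⟨f, u, hfu, hu⟩ := geometric_hahn_banach_point_closed V.convex hV hx
  have h0 : ∀ v ∈ V, f v = 0 := by
    intro v hv
    by_contra hne
    have := hu (((u - 1) / f v) • v) (V.smul_mem _ hv)
    rw [map_smul, smul_eq_mul, div_mul_cancel₀ _ hne] at this
    linarith
  have h1 := hu 0 V.zero_mem
  rw [map_zero] at h1
  rw [h f h0] at hfu
  linarith

/-- In a reflexive space a bounded sequence converges weakly along every ultrafilter. -/
theorem IsReflexiveSpace.exists_ultrafilter_weak_limit {U : Type*} [NormedAddCommGroup U]
    [NormedSpace ℝ U] (hU : IsReflexiveSpace U) {v : ℕ → U} {C : ℝ} (hv : ∀ n, ‖v n‖ ≤ C)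
    (F : Ultrafilter ℕ) :
    ∃ x : U, ∀ f : StrongDual ℝ U, Tendsto (fun k => f (v k)) F (𝓝 (f x)) := by
  have hb : ∀ (f : StrongDual ℝ U) n, ‖f (v n)‖ ≤ ‖f‖ * C := fun f n =>
    (f.le_opNorm _).trans (mul_le_mul_of_nonneg_left (hv n) (norm_nonneg _))
  have hex : ∀ f : StrongDual ℝ U, ∃ a : ℝ, ‖a‖ ≤ ‖f‖ * C ∧
      Tendsto (fun k => f (v k)) F (𝓝 a) := by
    intro f
    obtain ⟨a, ha, hFa⟩ := (isCompact_closedBall (0 : ℝ) (‖f‖ * C)).ultrafilter_le_nhds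
      (F.map fun k => f (v k))
      (by
        rw [Ultrafilter.coe_map, le_principal_iff, mem_map]
        exact Filter.univ_mem' fun n => mem_closedBall_zero_iff.2 (hb f n))
    exact ⟨a, mem_closedBall_zero_iff.1 ha, hFa⟩
  choose a ha hlim using hex
  let Φ : StrongDual ℝ U →ₗ[ℝ] ℝ :=
    { toFun := a
      map_add' := fun f g => tendsto_nhds_unique (hlim (f + g)) ((hlim f).add (hlim g))
      map_smul' := fun c f => tendsto_nhds_unique (hlim (c • f)) ((hlim f).const_smul c) }
  obtain ⟨x, hx⟩ := hU (Φ.mkContinuous C fun f => by rw [mul_comm]; exact ha f)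
  refine ⟨x, fun f => ?_⟩
  have : f x = a f := by
    have := congrArg (fun G => G f) hx
    exact (by simpa using this : f x = Φ f)
  rw [this]
  exact hlim f

/-- In a reflexive space, a bounded sequence of a closed subspace `V` converges weakly as soon as
it converges against a countable family that is norming on `V`. -/
theorem IsReflexiveSpace.exists_weak_limit_of_norming {U : Type*} [NormedAddCommGroup U]
    [NormedSpace ℝ U] (hU : IsReflexiveSpace U) {V : Submodule ℝ U} (hV : IsClosed (V : Set U))
    {f : ℕ → StrongDual ℝ U} (hf : ∀ x ∈ V, ∀ ε > 0, ∃ j, ‖x‖ - ε < f j x)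
    {v : ℕ → U} {C : ℝ} (hv : ∀ n, ‖v n‖ ≤ C) (hvV : ∀ n, v n ∈ V)
    {a : ℕ → ℝ} (ha : ∀ j, Tendsto (fun k => f j (v k)) atTop (𝓝 (a j))) :
    ∃ x ∈ V, ∀ g : StrongDual ℝ U, Tendsto (fun k => g (v k)) atTop (𝓝 (g x)) := by
  have key : ∀ F : Ultrafilter ℕ, (F : Filter ℕ) ≤ atTop → ∃ x ∈ V, (∀ j, f j x = a j) ∧
      ∀ g : StrongDual ℝ U, Tendsto (fun k => g (v k)) F (𝓝 (g x)) := by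
    intro F hF
    obtain ⟨x, hx⟩ := hU.exists_ultrafilter_weak_limit hv F
    refine ⟨x, mem_closed_submodule_of_dual hV fun g hg => ?_, fun j => ?_, hx⟩
    · refine tendsto_nhds_unique (hx g) ?_
      simp only [hg _ (hvV _)]
      exact tendsto_const_nhds
    · exact tendsto_nhds_unique (hx (f j)) ((ha j).mono_left hF)
  obtain ⟨x, hxV, hxa, -⟩ := key (Ultrafilter.of atTop) (Ultrafilter.of_le _)
  refine ⟨x, hxV, fun g => (tendsto_iff_ultrafilter _ _ _).2 fun F hF => ?_⟩
  obtain ⟨x', hxV', hxa', hg⟩ := key F hF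
  rw [eq_of_norming hf hxV hxV' fun j => (hxa j).trans (hxa' j).symm]
  exact hg g

/-- If bounded sequences have weakly convergent forward convex combinations, then they have weakly
convergent subsequences. -/
theorem exists_weakly_convergent_subseq_of_convexHull_tail {E : Type*} [NormedAddCommGroup E]
    [NormedSpace ℝ E]
    (hE : ∀ (u : ℕ → E) (C : ℝ), (∀ n, ‖u n‖ ≤ C) → ∃ (x : E) (z : ℕ → E),
      (∀ n, z n ∈ convexHull ℝ (u '' Ici n)) ∧
        ∀ g : StrongDual ℝ E, Tendsto (fun n => g (z n)) atTop (𝓝 (g x)))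
    (u : ℕ → E) (C : ℝ) (hu : ∀ n, ‖u n‖ ≤ C) :
    ∃ (x : E) (φ : ℕ → ℕ), StrictMono φ ∧
      ∀ g : StrongDual ℝ E, Tendsto (fun n => g (u (φ n))) atTop (𝓝 (g x)) := by
  set V : Submodule ℝ E := (Submodule.span ℝ (range u)).topologicalClosure with hVdef
  have hV : IsClosed (V : Set E) := Submodule.isClosed_topologicalClosure _
  have huV : ∀ n, u n ∈ V := fun n =>
    Submodule.le_topologicalClosure _ (Submodule.subset_span ⟨n, rfl⟩)
  have hsep : TopologicalSpace.IsSeparable (V : Set E) :=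
    ((countable_range u).isSeparable.span (R := ℝ)).closure
  obtain ⟨f, hf1, hf⟩ := exists_norming_sequence hsep
  obtain ⟨a, -, φ, hφ, hφa⟩ := (isCompact_univ_pi fun _ : ℕ =>
      isCompact_closedBall (0 : ℝ) C).tendsto_subseq (x := fun n j => f j (u n)) (fun n j _ => by
    rw [mem_closedBall_zero_iff]
    refine ((f j).le_of_opNorm_le (hf1 j) _).trans ?_
    rw [one_mul]; exact hu n)
  rw [tendsto_pi_nhds] at hφa
  have tail : ∀ (ψ : ℕ → ℕ) (g : StrongDual ℝ E) (c : ℝ) (z : ℕ → E),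
      (∀ n, z n ∈ convexHull ℝ ((fun k => u (ψ k)) '' Ici n)) →
      Tendsto (fun k => g (u (ψ k))) atTop (𝓝 c) → Tendsto (fun n => g (z n)) atTop (𝓝 c) := by
    intro ψ g c z hz hc
    rw [Metric.tendsto_atTop] at hc ⊢
    intro ε hε
    obtain ⟨N, hN⟩ := hc ε hε
    refine ⟨N, fun n hn => ?_⟩
    have hsub : convexHull ℝ ((fun k => u (ψ k)) '' Ici n) ⊆ g ⁻¹' Metric.ball c ε := by
      refine convexHull_min ?_ ((convex_ball c ε).is_linear_preimage g.isLinear)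
      rintro _ ⟨k, hk, rfl⟩
      exact hN k (hn.trans hk)
    exact hsub (hz n)
  have key : ∀ ψ : ℕ → ℕ, Tendsto ψ atTop atTop → ∃ x ∈ V, (∀ j, f j x = a j) ∧
      ∀ (g : StrongDual ℝ E) (c : ℝ), (∀ k, c ≤ g (u (φ (ψ k)))) → c ≤ g x := by
    intro ψ hψ
    obtain ⟨x, z, hz, hzx⟩ := hE (fun k => u (φ (ψ k))) C fun n => hu _
    have hzV : ∀ n, z n ∈ V := fun n => by
      refine (convexHull_min ?_ V.convex) (hz n)
      rintro _ ⟨k, -, rfl⟩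
      exact huV _
    refine ⟨x, mem_closed_submodule_of_dual hV fun g hg => ?_, fun j => ?_, fun g c hc => ?_⟩
    · refine tendsto_nhds_unique (hzx g) ?_
      simp only [hg _ (hzV _)]
      exact tendsto_const_nhds
    · exact tendsto_nhds_unique (hzx (f j)) (tail _ _ _ _ hz ((hφa j).comp hψ))
    · refine ge_of_tendsto' (hzx g) fun n => ?_
      refine (convexHull_min ?_ ((convex_Ici c).is_linear_preimage g.isLinear)) (hz n)
      rintro _ ⟨k, -, rfl⟩
      exact hc k
  obtain ⟨x, hxV, hxa, -⟩ := key id tendsto_id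
  refine ⟨x, φ, hφ, ?_⟩
  have lower : ∀ (g : StrongDual ℝ E) (b : ℝ), b < g x → ∀ᶠ n in atTop, b < g (u (φ n)) := by
    intro g b hb
    by_contra hcon
    have hfr : ∃ᶠ n in atTop, -b ≤ (-g) (u (φ n)) := by
      refine (not_eventually.1 hcon).mono fun n hn => ?_
      simpa using hn
    obtain ⟨ψ, hψ, hψb⟩ := extraction_of_frequently_atTop hfr
    obtain ⟨x', hxV', hxa', h'⟩ := key ψ hψ.tendsto_atTop
    have := h' (-g) (-b) hψb
    rw [eq_of_norming hf hxV' hxV fun j => (hxa' j).trans (hxa j).symm] at this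
    simp only [neg_apply] at this
    linarith
  intro g
  refine tendsto_order.2 ⟨fun b hb => lower g b hb, fun b hb => ?_⟩
  refine (lower (-g) (-b) (by simpa using hb)).mono fun n hn => ?_
  simpa using hn

end WeakSequences

section LpTools

variable {α : Type*} {mα : MeasurableSpace α} {μ : Measure α}
variable {E F : Type*} [NormedAddCommGroup E] [NormedAddCommGroup F]

theorem eLpNorm_two_sq_eq_lintegral (f : α → E) :
    eLpNorm f 2 μ ^ 2 = ∫⁻ t, ‖f t‖ₑ ^ 2 ∂μ := by
  have := eLpNorm_nnreal_pow_eq_lintegral (f := f) (μ := μ) (p := 2) (by norm_num)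
  simpa using this

theorem lintegral_enorm_sq_Lp (f : Lp E 2 μ) : ∫⁻ t, ‖f t‖ₑ ^ 2 ∂μ = ‖f‖ₑ ^ 2 := by
  rw [← eLpNorm_two_sq_eq_lintegral, Lp.enorm_def]

/-- A subsequence of an `L²`-convergent sequence converges almost everywhere, with an `L²`
bound of prescribed size for the differences. -/
theorem exists_subseq_ae_tendsto_dominated {f : ℕ → Lp E 2 μ} {y : Lp E 2 μ}
    (hf : Tendsto f atTop (𝓝 y)) {η : ℝ} (hη : 0 < η) :
    ∃ φ : ℕ → ℕ, StrictMono φ ∧ ∃ D : α → ℝ, MemLp D 2 μ ∧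
      eLpNorm D 2 μ ≤ ENNReal.ofReal η ∧ (∀ᵐ t ∂μ, ∀ k, ‖f (φ k) t - y t‖ ≤ D t) ∧
      ∀ᵐ t ∂μ, Tendsto (fun k => f (φ k) t) atTop (𝓝 (y t)) := by
  have hev : ∀ k : ℕ, ∀ᶠ n in atTop, ‖f n - y‖ₑ ^ 2 ≤ ENNReal.ofReal (η ^ 2) * 2⁻¹ ^ (k + 1) := by
    intro k
    have h0 : Tendsto (fun n => ‖f n - y‖ₑ ^ 2) atTop (𝓝 0) := by
      have h1 := ENNReal.tendsto_ofReal ((tendsto_iff_norm_sub_tendsto_zero.1 hf).pow 2)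
      simpa [ENNReal.ofReal_pow, norm_nonneg] using h1
    refine h0.eventually_le_const ?_
    refine pos_iff_ne_zero.2 (mul_ne_zero ?_ (pow_ne_zero _ (by simp)))
    simpa using sq_pos_of_pos hη |>.ne'
  obtain ⟨φ, hφ, hφb⟩ := extraction_forall_of_eventually hev
  have hmeas : ∀ k, AEMeasurable (fun t => ‖f (φ k) t - y t‖ₑ ^ 2) μ := fun k =>
    (((Lp.aestronglyMeasurable _).sub (Lp.aestronglyMeasurable _)).enorm).pow_const 2
  set S : α → ℝ≥0∞ := fun t => ∑' k, ‖f (φ k) t - y t‖ₑ ^ 2 with hS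
  have hSm : AEMeasurable S μ := AEMeasurable.tsum hmeas
  have hSint : ∫⁻ t, S t ∂μ ≤ ENNReal.ofReal (η ^ 2) := by
    rw [lintegral_tsum hmeas]
    calc ∑' k, ∫⁻ t, ‖f (φ k) t - y t‖ₑ ^ 2 ∂μ
        = ∑' k, ‖f (φ k) - y‖ₑ ^ 2 := by
          congr 1; ext k
          rw [← lintegral_enorm_sq_Lp]
          refine lintegral_congr_ae ?_
          filter_upwards [Lp.coeFn_sub (f (φ k)) y] with t ht
          rw [ht, Pi.sub_apply]
      _ ≤ ∑' k : ℕ, ENNReal.ofReal (η ^ 2) * 2⁻¹ ^ (k + 1) := ENNReal.tsum_le_tsum hφb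
      _ = ENNReal.ofReal (η ^ 2) := by
          rw [ENNReal.tsum_mul_left, ENNReal.tsum_geometric_add_one]
          simp [ENNReal.inv_mul_cancel]
  have hSfin : ∀ᵐ t ∂μ, S t < ∞ :=
    ae_lt_top' hSm (hSint.trans_lt ENNReal.ofReal_lt_top).ne
  set D : α → ℝ := fun t => √(S t).toReal with hD
  have hDm : AEStronglyMeasurable D μ := hSm.ennreal_toReal.sqrt.aestronglyMeasurable
  have hDS : ∀ᵐ t ∂μ, ‖D t‖ₑ ^ 2 = S t := by
    filter_upwards [hSfin] with t ht
    rw [Real.enorm_eq_ofReal (Real.sqrt_nonneg _), ← ENNReal.ofReal_pow (Real.sqrt_nonneg _),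
      Real.sq_sqrt ENNReal.toReal_nonneg, ENNReal.ofReal_toReal ht.ne]
  have hDn : eLpNorm D 2 μ ≤ ENNReal.ofReal η := by
    have : eLpNorm D 2 μ ^ 2 ≤ ENNReal.ofReal η ^ 2 := by
      rw [eLpNorm_two_sq_eq_lintegral, lintegral_congr_ae hDS, ← ENNReal.ofReal_pow hη.le]
      exact hSint
    exact (ENNReal.pow_le_pow_left_iff (n := 2) (by norm_num)).1 this
  refine ⟨φ, hφ, D, ⟨hDm, hDn.trans_lt ENNReal.ofReal_lt_top⟩, hDn, ?_, ?_⟩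
  · filter_upwards [hSfin] with t ht k
    apply Real.le_sqrt_of_sq_le
    have h1 : ‖f (φ k) t - y t‖ₑ ^ 2 ≤ S t := ENNReal.le_tsum k
    have h2 := ENNReal.toReal_mono ht.ne h1
    simpa using h2
  · filter_upwards [hSfin] with t ht
    have h1 := ENNReal.tendsto_atTop_zero_of_tsum_ne_top ht.ne
    rw [tendsto_iff_norm_sub_tendsto_zero]
    have h2 := (ENNReal.tendsto_toReal ENNReal.zero_ne_top).comp h1
    have h3 : Tendsto (fun k => ‖f (φ k) t - y t‖ ^ 2) atTop (𝓝 0) := by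
      refine (h2.congr fun k => ?_)
      simp
    have h4 := (Real.continuous_sqrt.tendsto 0).comp h3
    simpa [Function.comp_def, Real.sqrt_sq (norm_nonneg _)] using h4

variable [NormedSpace ℝ E] [NormedSpace ℝ F]

/-- A bounded measurable family of operators acts on `L²` pointwise. -/
theorem exists_Lp_pointwise_clm {A : α → E →L[ℝ] F} (hA : AEStronglyMeasurable A μ) {C : ℝ}
    (hAC : ∀ᵐ t ∂μ, ‖A t‖ ≤ C) :
    ∃ M : Lp E 2 μ →L[ℝ] Lp F 2 μ, (∀ f, ‖M f‖ ≤ C * ‖f‖) ∧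
      ∀ f, M f =ᵐ[μ] fun t => A t (f t) := by
  have hbd : ∀ f : Lp E 2 μ, ∀ᵐ t ∂μ, ‖A t (f t)‖ ≤ C * ‖f t‖ := fun f => by
    filter_upwards [hAC] with t ht
    exact (A t).le_of_opNorm_le ht _
  have hmem : ∀ f : Lp E 2 μ, MemLp (fun t => A t (f t)) 2 μ := fun f =>
    MemLp.of_le_mul (Lp.memLp f)
      ((ContinuousLinearMap.apply ℝ F : E →L[ℝ] _).aestronglyMeasurable_comp₂
        (Lp.aestronglyMeasurable f) hA) (hbd f)
  let M₀ : Lp E 2 μ →ₗ[ℝ] Lp F 2 μ :=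
    { toFun := fun f => (hmem f).toLp
      map_add' := fun f g => by
        rw [← MemLp.toLp_add]
        refine MemLp.toLp_congr _ _ ?_
        filter_upwards [Lp.coeFn_add f g] with t ht
        rw [ht, Pi.add_apply, map_add, Pi.add_apply]
      map_smul' := fun c f => by
        rw [RingHom.id_apply, ← MemLp.toLp_const_smul]
        refine MemLp.toLp_congr _ _ ?_
        filter_upwards [Lp.coeFn_smul c f] with t ht
        rw [ht, Pi.smul_apply, map_smul, Pi.smul_apply] }
  have hM₀ : ∀ f, M₀ f =ᵐ[μ] fun t => A t (f t) := fun f => (hmem f).coeFn_toLp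
  have hn : ∀ f, ‖M₀ f‖ ≤ C * ‖f‖ := fun f => by
    refine Lp.norm_le_mul_norm_of_ae_le_mul ?_
    filter_upwards [hM₀ f, hbd f] with t h1 h2
    rw [h1]; exact h2
  exact ⟨M₀.mkContinuous C hn, hn, hM₀⟩

theorem convex_setOf_ae_mem {C : α → Set E} (hC : ∀ t, Convex ℝ (C t)) :
    Convex ℝ {f : Lp E 2 μ | ∀ᵐ t ∂μ, f t ∈ C t} := by
  intro f hf g hg a b ha hb hab
  filter_upwards [hf, hg, Lp.coeFn_add (a • f) (b • g), Lp.coeFn_smul a f, Lp.coeFn_smul b g]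
    with t h1 h2 h3 h4 h5
  rw [h3, Pi.add_apply, h4, h5]
  exact hC t h1 h2 ha hb hab

/-- Pettis: scalar measurability against a norming family implies strong measurability. -/
theorem stronglyMeasurable_of_norming {V : Submodule ℝ E}
    (hV : TopologicalSpace.IsSeparable (V : Set E)) {f : ℕ → StrongDual ℝ E}
    (hf1 : ∀ j, ‖f j‖ ≤ 1) (hf : ∀ x ∈ V, ∀ ε > 0, ∃ j, ‖x‖ - ε < f j x)
    {x : α → E} (hxV : ∀ t, x t ∈ V) (hx : ∀ j, Measurable fun t => f j (x t)) :
    StronglyMeasurable x := by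
  borelize E
  rw [stronglyMeasurable_iff_measurable_separable]
  refine ⟨?_, hV.mono (by rintro _ ⟨t, rfl⟩; exact hxV t)⟩
  have hball : ∀ v ∈ V, ∀ c : ℝ, MeasurableSet {t | ‖x t - v‖ ≤ c} := by
    intro v hv c
    have : {t | ‖x t - v‖ ≤ c} = ⋂ j, {t | f j (x t) - f j v ≤ c} := by
      ext t
      simp only [mem_ofPred_eq, mem_iInter]
      constructor
      · intro h j
        rw [← map_sub]
        exact ((le_abs_self _).trans (((f j).le_of_opNorm_le (hf1 j) _).trans (by simp))).trans h
      · intro h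
        refine le_of_forall_pos_le_add fun ε hε => ?_
        obtain ⟨j, hj⟩ := hf (x t - v) (V.sub_mem (hxV t) hv) ε hε
        have := h j
        rw [map_sub] at hj
        linarith
    rw [this]
    exact MeasurableSet.iInter fun j => measurableSet_le ((hx j).sub_const _) measurable_const
  have : TopologicalSpace.SeparableSpace V := hV.separableSpace
  let d := TopologicalSpace.denseSeq V
  refine measurable_of_isOpen fun O hO => ?_
  have : x ⁻¹' O = ⋃ p ∈ {p : ℕ × ℕ | Metric.closedBall (d p.1 : E) (1 / ((p.2 : ℝ) + 1)) ⊆ O},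
      {t | ‖x t - d p.1‖ ≤ 1 / ((p.2 : ℝ) + 1)} := by
    ext t
    simp only [mem_preimage, mem_ofPred_eq, mem_iUnion, exists_prop, Prod.exists]
    constructor
    · intro ht
      obtain ⟨ε, hε, hεO⟩ := Metric.isOpen_iff.1 hO _ ht
      obtain ⟨n, hn⟩ := exists_nat_one_div_lt (half_pos hε)
      obtain ⟨i, hi⟩ := (TopologicalSpace.denseRange_denseSeq V).exists_dist_lt
        (⟨x t, hxV t⟩ : V) (Nat.one_div_pos_of_nat (α := ℝ) (n := n))
      have hi' : dist (x t) (d i : E) < 1 / ((n : ℝ) + 1) := hi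
      refine ⟨i, n, fun z hz => hεO ?_, ?_⟩
      · rw [Metric.mem_closedBall] at hz
        rw [Metric.mem_ball]
        have := dist_triangle z (d i : E) (x t)
        rw [dist_comm (d i : E)] at this
        linarith
      · rw [← dist_eq_norm]; exact hi'.le
    · rintro ⟨i, n, hsub, ht⟩
      exact hsub (by rwa [Metric.mem_closedBall, dist_eq_norm])
  rw [this]
  exact MeasurableSet.biUnion (to_countable _) fun p _ => hball _ (d p.1).2 _

end LpTools

section Mazur

/-- Elements of the convex hull of a sequence are finite convex combinations of initial terms. -/
theorem exists_stdSimplex_of_mem_convexHull_range {E : Type*} [AddCommGroup E] [Module ℝ E]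
    {z : ℕ → E} {p : E} (hp : p ∈ convexHull ℝ (range z)) :
    ∃ (n : ℕ) (d : Fin (n + 1) → ℝ), d ∈ stdSimplex ℝ (Fin (n + 1)) ∧
      ∑ l, d l • z l = p := by
  classical
  obtain ⟨ι, _, w, y, hw, hw1, hy, rfl⟩ := mem_convexHull_iff_exists_fintype.1 hp
  choose k hk using hy
  obtain ⟨n, hn⟩ : ∃ n, ∀ i, k i ≤ n := ⟨Finset.univ.sup k, fun i => Finset.le_sup (Finset.mem_univ i)⟩
  let κ : ι → Fin (n + 1) := fun i => ⟨k i, Nat.lt_succ_of_le (hn i)⟩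
  refine ⟨n, fun l => ∑ i with κ i = l, w i, ⟨fun l => Finset.sum_nonneg fun i _ => hw i, ?_⟩, ?_⟩
  · rw [Finset.sum_fiberwise, hw1]
  · rw [← Finset.sum_fiberwise (s := Finset.univ) (g := κ) (f := fun i => w i • y i)]
    refine Finset.sum_congr rfl fun l _ => ?_
    rw [Finset.sum_smul]
    refine Finset.sum_congr rfl fun i hi => ?_
    rw [← (Finset.mem_filter.1 hi).2, ← hk i]

variable {α : Type*} {mα : MeasurableSpace α} {μ : Measure α}
variable {U : Type*} [NormedAddCommGroup U] [NormedSpace ℝ U]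

theorem zero_mem_closure_convexHull_of_weak_tendsto {v : ℕ → U}
    (hv : ∀ g : StrongDual ℝ U, Tendsto (fun n => g (v n)) atTop (𝓝 0)) :
    (0 : U) ∈ closure (convexHull ℝ (range v)) := by
  by_contra h
  obtain ⟨g, u, hgu, hu⟩ := geometric_hahn_banach_point_closed
    (convex_convexHull ℝ (range v)).closure isClosed_closure h
  rw [map_zero] at hgu
  have : u ≤ 0 := ge_of_tendsto' (hv g) fun n =>
    (hu _ (subset_closure (subset_convexHull ℝ _ ⟨n, rfl⟩))).le
  linarith

omit [NormedSpace ℝ U] in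
/-- Dominated convergence in `L²`. -/
theorem tendsto_zero_Lp_of_dominated {v : ℕ → Lp U 2 μ} {b : α → ℝ} (hb : MemLp b 2 μ)
    (hvb : ∀ n, ∀ᵐ t ∂μ, ‖v n t‖ ≤ b t)
    (hv : ∀ᵐ t ∂μ, Tendsto (fun n => v n t) atTop (𝓝 0)) : Tendsto v atTop (𝓝 0) := by
  have h1 : Tendsto (fun n => ∫⁻ t, ‖v n t‖ₑ ^ 2 ∂μ) atTop (𝓝 (∫⁻ _, 0 ∂μ)) := by
    refine tendsto_lintegral_of_dominated_convergence' (fun t => ‖b t‖ₑ ^ 2)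
      (fun n => (Lp.aestronglyMeasurable (v n)).enorm.pow_const 2) (fun n => ?_) ?_ ?_
    · filter_upwards [hvb n] with t ht
      gcongr
      rw [← ofReal_norm, ← ofReal_norm]
      exact ENNReal.ofReal_le_ofReal (ht.trans (le_abs_self _))
    · rw [← eLpNorm_two_sq_eq_lintegral]
      exact ENNReal.pow_ne_top hb.2.ne
    · filter_upwards [hv] with t ht
      have := ENNReal.tendsto_ofReal (ht.norm.pow 2)
      simpa [ENNReal.ofReal_pow, norm_nonneg] using this
  simp only [lintegral_enorm_sq_Lp, lintegral_zero] at h1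
  have h2 := (ENNReal.tendsto_toReal ENNReal.zero_ne_top).comp h1
  have h3 : Tendsto (fun n => ‖v n‖ ^ 2) atTop (𝓝 0) := by
    simpa [Function.comp_def] using h2
  rw [tendsto_zero_iff_norm_tendsto_zero]
  have h4 := (Real.continuous_sqrt.tendsto 0).comp h3
  simpa [Function.comp_def, Real.sqrt_sq (norm_nonneg _)] using h4

theorem exists_Lp_indicator_clm (μ : Measure α) (U : Type*) [NormedAddCommGroup U]
    [NormedSpace ℝ U] (s : Set α) (hs : MeasurableSet s) :
    ∃ M : Lp U 2 μ →L[ℝ] Lp U 2 μ, ∀ f, M f =ᵐ[μ] s.indicator f := by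
  classical
  obtain ⟨M, -, hM⟩ := exists_Lp_pointwise_clm (μ := μ) (E := U) (F := U)
    (A := s.indicator fun _ => ContinuousLinearMap.id ℝ U) (C := 1)
    (aestronglyMeasurable_const.indicator hs) (ae_of_all _ fun t => by
      by_cases ht : t ∈ s
      · simpa [ht] using ContinuousLinearMap.norm_id_le
      · simp [ht])
  refine ⟨M, fun f => (hM f).trans (ae_of_all _ fun t => ?_)⟩
  by_cases ht : t ∈ s <;> simp [ht]

/-- Countably many convex combinations of a pointwise weakly null sequence come arbitrarily
close to zero at almost every point. -/
theorem exists_countable_convex_combinations {W : Type*} [AddCommGroup W] [Module ℝ W]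
    (L : W →ₗ[ℝ] Lp U 2 μ) {q : ℕ → W}
    (hq : ∀ᵐ t ∂μ, ∀ g : StrongDual ℝ U, Tendsto (fun n => g (L (q n) t)) atTop (𝓝 0)) :
    ∃ c : ℕ → W, (∀ i, c i ∈ convexHull ℝ (range q)) ∧
      ∀ᵐ t ∂μ, ∀ ε > 0, ∃ i, ‖L (c i) t‖ < ε := by
  let d : ∀ n : ℕ, ℕ → stdSimplex ℝ (Fin (n + 1)) := fun n =>
    TopologicalSpace.denseSeq (stdSimplex ℝ (Fin (n + 1)))
  let c : ℕ → W := fun i => ∑ l, (d i.unpair.1 i.unpair.2 : Fin (i.unpair.1 + 1) → ℝ) l • q l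
  refine ⟨c, fun i => ?_, ?_⟩
  · exact (convex_convexHull ℝ _).sum_mem (fun l _ => (d _ _).2.1 l) (d _ _).2.2
      fun l _ => subset_convexHull ℝ _ ⟨l, rfl⟩
  have hval : ∀ᵐ t ∂μ, ∀ i, L (c i) t =
      ∑ l, (d i.unpair.1 i.unpair.2 : Fin (i.unpair.1 + 1) → ℝ) l • L (q l) t := by
    rw [ae_all_iff]
    intro i
    have h1 : L (c i) = ∑ l, (d i.unpair.1 i.unpair.2 : Fin (i.unpair.1 + 1) → ℝ) l • L (q l) := by
      simp only [c, map_sum, map_smul]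
    rw [h1]
    have h2 : ∀ᵐ t ∂μ, ∀ l : Fin (i.unpair.1 + 1),
        ((d i.unpair.1 i.unpair.2 : Fin (i.unpair.1 + 1) → ℝ) l • L (q l) : Lp U 2 μ) t =
          (d i.unpair.1 i.unpair.2 : Fin (i.unpair.1 + 1) → ℝ) l • L (q l) t := by
      rw [ae_all_iff]
      intro l
      exact Lp.coeFn_smul _ _
    filter_upwards [h2, Lp.coeFn_finsetSum (Finset.univ) (fun l : Fin (i.unpair.1 + 1) =>
      (d i.unpair.1 i.unpair.2 : Fin (i.unpair.1 + 1) → ℝ) l • L (q l))] with t ht1 ht2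
    rw [ht2, Finset.sum_apply]
    exact Finset.sum_congr rfl fun l _ => ht1 l
  filter_upwards [hq, hval] with t ht hvt ε hε
  obtain ⟨p, hp, hp0⟩ := Metric.mem_closure_iff.1
    (zero_mem_closure_convexHull_of_weak_tendsto ht) ε hε
  obtain ⟨n, e, he, rfl⟩ := exists_stdSimplex_of_mem_convexHull_range hp
  have hcont : Continuous fun w : stdSimplex ℝ (Fin (n + 1)) =>
      ‖∑ l, (w : Fin (n + 1) → ℝ) l • L (q l) t‖ := by
    refine (continuous_finsetSum _ fun l _ => Continuous.smul ?_ continuous_const).norm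
    exact (continuous_apply l).comp continuous_subtype_val
  obtain ⟨m, hm⟩ := (TopologicalSpace.denseRange_denseSeq (stdSimplex ℝ (Fin (n + 1)))).exists_mem_open
    (isOpen_Iio.preimage hcont) (⟨⟨e, he⟩, by rw [dist_zero_left] at hp0; exact hp0⟩ : Set.Nonempty _)
  refine ⟨Nat.pair n m, ?_⟩
  rw [hvt, Nat.unpair_pair]
  exact hm

end Mazur

section WeakL2

variable {α : Type*} {mα : MeasurableSpace α} {μ : Measure α}
variable {U : Type*} [NormedAddCommGroup U] [NormedSpace ℝ U]

/-- Multiplication by the indicator of a measurable set on `L²`. -/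
noncomputable def indicatorLp (μ : Measure α) (U : Type*) [NormedAddCommGroup U]
    [NormedSpace ℝ U] (s : {s : Set α // MeasurableSet s}) : Lp U 2 μ →L[ℝ] Lp U 2 μ :=
  (exists_Lp_indicator_clm μ U s.1 s.2).choose

theorem indicatorLp_ae (s : {s : Set α // MeasurableSet s}) (f : Lp U 2 μ) :
    indicatorLp μ U s f =ᵐ[μ] s.1.indicator f :=
  (exists_Lp_indicator_clm μ U s.1 s.2).choose_spec f

theorem indicatorLp_indicatorLp (s s' : {s : Set α // MeasurableSet s}) (v : Lp U 2 μ) :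
    indicatorLp μ U s (indicatorLp μ U s' v) =
      indicatorLp μ U ⟨s'.1 ∩ s.1, s'.2.inter s.2⟩ v := by
  classical
  refine Lp.ext ?_
  filter_upwards [indicatorLp_ae s (indicatorLp μ U s' v), indicatorLp_ae s' v,
    indicatorLp_ae ⟨s'.1 ∩ s.1, s'.2.inter s.2⟩ v] with t h1 h2 h3
  rw [h1, h3]
  by_cases hs : t ∈ s.1 <;> by_cases hs' : t ∈ s'.1 <;> simp [hs, hs', h2]

theorem inner_indicatorLp (s s' : {s : Set α // MeasurableSet s}) (v ρ : Lp ℝ 2 μ) :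
    inner ℝ (indicatorLp μ ℝ s' v) (indicatorLp μ ℝ s ρ) =
      inner ℝ v (indicatorLp μ ℝ ⟨s'.1 ∩ s.1, s'.2.inter s.2⟩ ρ) := by
  classical
  rw [L2.inner_def, L2.inner_def]
  refine integral_congr_ae ?_
  filter_upwards [indicatorLp_ae s' v, indicatorLp_ae s ρ,
    indicatorLp_ae ⟨s'.1 ∩ s.1, s'.2.inter s.2⟩ ρ] with t h1 h2 h3
  rw [h1, h2, h3]
  by_cases hs : t ∈ s.1 <;> by_cases hs' : t ∈ s'.1 <;> simp [hs, hs']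

theorem indicatorLp_univ (v : Lp U 2 μ) : indicatorLp μ U ⟨univ, MeasurableSet.univ⟩ v = v :=
  Lp.ext ((indicatorLp_ae ⟨univ, MeasurableSet.univ⟩ v).trans (by simp))

/-- The pairs `(v, g)` such that `g` is the density of `E ↦ ℓ (1_E v)` with respect to the
measure with density `ρ`. -/
noncomputable def densityPairs (ℓ : StrongDual ℝ (Lp U 2 μ)) (ρ : Lp ℝ 2 μ) :
    Submodule ℝ (Lp U 2 μ × Lp ℝ 2 μ) where
  carrier := {p | ∀ s, ℓ (indicatorLp μ U s p.1) = inner ℝ p.2 (indicatorLp μ ℝ s ρ)}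
  zero_mem' := by intro s; simp
  add_mem' := by
    intro p p' hp hp' s
    simp only [Prod.fst_add, Prod.snd_add, map_add, inner_add_left]
    rw [hp s, hp' s]
  smul_mem' := by
    intro c p hp s
    simp only [Prod.smul_fst, Prod.smul_snd, map_smul, inner_smul_left, smul_eq_mul]
    rw [hp s]; simp

theorem dual_eq_inner_of_mem_densityPairs {ℓ : StrongDual ℝ (Lp U 2 μ)} {ρ : Lp ℝ 2 μ}
    {p : Lp U 2 μ × Lp ℝ 2 μ} (hp : p ∈ densityPairs ℓ ρ) : ℓ p.1 = inner ℝ p.2 ρ := by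
  have := hp ⟨univ, MeasurableSet.univ⟩
  rwa [indicatorLp_univ, indicatorLp_univ] at this

theorem exists_density_of_dominated {r : α → ℝ} {ρ : Lp ℝ 2 μ}
    (hρ : ∀ᵐ t ∂μ, ρ t = 1 + |r t|) (hρm : AEStronglyMeasurable (fun t => 1 + |r t|) μ)
    (ℓ : StrongDual ℝ (Lp U 2 μ)) {w : Lp U 2 μ} (hw : ∀ᵐ t ∂μ, ‖w t‖ ≤ r t) :
    ∃ g : Lp ℝ 2 μ, ‖g‖ ≤ ‖ℓ‖ ∧ (w, g) ∈ densityPairs ℓ ρ := by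
  classical
  set b : α → U := fun t => (1 + |r t|)⁻¹ • w t
  have hb1 : ∀ᵐ t ∂μ, ‖b t‖ ≤ 1 := by
    filter_upwards [hw] with t ht
    have h1 : ‖w t‖ ≤ 1 + |r t| := by linarith [le_abs_self (r t)]
    have h2 : 0 < 1 + |r t| := by positivity
    rw [norm_smul, norm_inv, Real.norm_of_nonneg h2.le, inv_mul_le_iff₀ h2, mul_one]
    exact h1
  have hbm : AEStronglyMeasurable b μ :=
    (hρm.aemeasurable.inv.aestronglyMeasurable).smul
      (Lp.aestronglyMeasurable w)
  obtain ⟨M, hM1, hM⟩ := exists_Lp_pointwise_clm (μ := μ) (E := ℝ) (F := U)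
    (A := fun t => ContinuousLinearMap.toSpanSingleton ℝ (b t)) (C := 1)
    ((ContinuousLinearMap.toSpanSingletonCLE (𝕜 := ℝ) (E := U)).continuous.comp_aestronglyMeasurable hbm) (by
      filter_upwards [hb1] with t ht
      exact (ContinuousLinearMap.norm_toSpanSingleton (𝕜 := ℝ) (b t)).trans_le ht)
  refine ⟨(InnerProductSpace.toDual ℝ (Lp ℝ 2 μ)).symm (ℓ.comp M), ?_, fun s => ?_⟩
  · rw [LinearIsometryEquiv.norm_map]
    refine (ℓ.opNorm_comp_le M).trans ?_
    have : ‖M‖ ≤ 1 := M.opNorm_le_bound zero_le_one hM1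
    nlinarith [norm_nonneg ℓ]
  · rw [InnerProductSpace.toDual_symm_apply, ContinuousLinearMap.comp_apply]
    congr 1
    refine Lp.ext ?_
    filter_upwards [indicatorLp_ae s w, hM (indicatorLp μ ℝ s ρ),
      indicatorLp_ae s ρ, hρ] with t h1 h2 h3 h4
    rw [h1, h2, h3]
    have h5 : (1 + |r t|) ≠ 0 := by positivity
    by_cases hts : t ∈ s.1
    · simp [hts, h4, b, smul_smul, mul_inv_cancel₀ h5]
    · simp [hts]

/-- Finitely many density pairs are patched together according to which one is smallest. -/
theorem exists_densityPairs_norm_le_of_le {ℓ : StrongDual ℝ (Lp U 2 μ)} {ρ y : Lp ℝ 2 μ}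
    {D : α → ℝ} {c : ℕ → Lp U 2 μ × Lp ℝ 2 μ} (hcR : ∀ i, c i ∈ densityPairs ℓ ρ)
    (hcD : ∀ i, ∀ᵐ t ∂μ, ‖(c i).2 t - y t‖ ≤ D t) (N : ℕ) :
    ∃ p ∈ densityPairs ℓ ρ, (∀ᵐ t ∂μ, ‖p.2 t - y t‖ ≤ D t) ∧
      ∀ᵐ t ∂μ, ∀ i ≤ N, ‖p.1 t‖ ≤ ‖(c i).1 t‖ := by
  classical
  induction N with
  | zero =>
    refine ⟨c 0, hcR 0, hcD 0, ae_of_all _ fun t i hi => ?_⟩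
    rw [Nat.le_zero.1 hi]
  | succ N ih =>
    obtain ⟨p, hpR, hpD, hp⟩ := ih
    let s : {s : Set α // MeasurableSet s} := ⟨{t | ‖p.1 t‖ ≤ ‖(c (N + 1)).1 t‖},
      measurableSet_le (Lp.stronglyMeasurable _).norm.measurable
        (Lp.stronglyMeasurable _).norm.measurable⟩
    let s' : {s : Set α // MeasurableSet s} := ⟨s.1ᶜ, s.2.compl⟩
    refine ⟨(indicatorLp μ U s p.1 + indicatorLp μ U s' (c (N + 1)).1,
      indicatorLp μ ℝ s p.2 + indicatorLp μ ℝ s' (c (N + 1)).2), fun e => ?_, ?_, ?_⟩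
    · simp only [map_add, inner_add_left]
      rw [indicatorLp_indicatorLp, indicatorLp_indicatorLp, inner_indicatorLp, inner_indicatorLp,
        hpR, hcR]
    · filter_upwards [hpD, hcD (N + 1),
        Lp.coeFn_add (indicatorLp μ ℝ s p.2) (indicatorLp μ ℝ s' (c (N + 1)).2),
        indicatorLp_ae s p.2, indicatorLp_ae s' (c (N + 1)).2] with t h1 h2 h3 h4 h5
      rw [h3, Pi.add_apply, h4, h5]
      by_cases hs : t ∈ s.1
      · have hs' : t ∉ s'.1 := fun h => h hs
        rw [indicator_of_mem hs, indicator_of_notMem hs', add_zero]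
        exact h1
      · rw [indicator_of_notMem hs, indicator_of_mem (show t ∈ s'.1 from hs), zero_add]
        exact h2
    · filter_upwards [hp, Lp.coeFn_add (indicatorLp μ U s p.1) (indicatorLp μ U s' (c (N + 1)).1),
        indicatorLp_ae s p.1, indicatorLp_ae s' (c (N + 1)).1] with t h1 h3 h4 h5 i hi
      rw [h3, Pi.add_apply, h4, h5]
      by_cases hs : t ∈ s.1
      · have hs1 : ‖p.1 t‖ ≤ ‖(c (N + 1)).1 t‖ := hs
        have hs' : t ∉ s'.1 := fun h => h hs
        rw [indicator_of_mem hs, indicator_of_notMem hs', add_zero]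
        rcases Nat.le_succ_iff.1 hi with h | rfl
        · exact h1 i h
        · exact hs1
      · have hs1 : ‖(c (N + 1)).1 t‖ ≤ ‖p.1 t‖ := (not_le.1 hs).le
        rw [indicator_of_notMem hs, indicator_of_mem (show t ∈ s'.1 from hs), zero_add]
        rcases Nat.le_succ_iff.1 hi with h | rfl
        · exact hs1.trans (h1 i h)
        · exact le_rfl

theorem not_forall_le_dual_of_ae_weak_tendsto [IsFiniteMeasure μ] {w : ℕ → Lp U 2 μ} {r : α → ℝ}
    (hr : MemLp r 2 μ) (hw : ∀ᵐ t ∂μ, ∀ n, ‖w n t‖ ≤ r t)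
    (hw0 : ∀ᵐ t ∂μ, ∀ g : StrongDual ℝ U, Tendsto (fun n => g (w n t)) atTop (𝓝 0))
    (ℓ : StrongDual ℝ (Lp U 2 μ)) {δ : ℝ} (hδ : 0 < δ) (hℓ : ∀ n, δ ≤ ℓ (w n)) : False := by
  have hρm : MemLp (fun t => 1 + |r t|) 2 μ :=
    MemLp.add (f := fun _ => (1 : ℝ)) (g := fun t => ‖r t‖) (memLp_const 1) hr.norm
  obtain ⟨ρ, hρ⟩ : ∃ ρ : Lp ℝ 2 μ, ∀ᵐ t ∂μ, ρ t = 1 + |r t| := ⟨hρm.toLp, hρm.coeFn_toLp⟩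
  have hG : ∀ n, ∃ g : Lp ℝ 2 μ, ‖g‖ ≤ ‖ℓ‖ ∧ (w n, g) ∈ densityPairs ℓ ρ := fun n =>
    exists_density_of_dominated hρ hρm.1 ℓ (ae_all_iff.1 hw n)
  choose g hgn hg using hG
  obtain ⟨y, q, hq, hqy⟩ := exists_convexHull_tail_tendsto_map
    (LinearMap.snd ℝ (Lp U 2 μ) (Lp ℝ 2 μ)) (fun n => (w n, g n)) ‖ℓ‖ (fun n => hgn n)
  have hη : 0 < δ / (2 * (‖ρ‖ + 1)) := by positivity
  obtain ⟨φ, hφ, D, hD, hDη, hqD, -⟩ := exists_subseq_ae_tendsto_dominated hqy hη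
  have hqR : ∀ n, q n ∈ densityPairs ℓ ρ := fun n => (convexHull_min (by
    rintro _ ⟨k, -, rfl⟩
    exact hg k) (densityPairs ℓ ρ).convex) (hq n)
  have hqℓ : ∀ n, δ ≤ ℓ (q n).1 := fun n => (convexHull_min (t := {p : Lp U 2 μ × Lp ℝ 2 μ | δ ≤ ℓ p.1}) (by
    rintro _ ⟨k, -, rfl⟩
    exact hℓ k) ((convex_Ici δ).is_linear_preimage
      (f := fun p : Lp U 2 μ × Lp ℝ 2 μ => ℓ p.1)
      (ℓ.toLinearMap.comp (LinearMap.fst ℝ _ _)).isLinear)) (hq n)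
  have hqt : ∀ᵐ t ∂μ, ∀ n, (q n).1 t ∈ convexHull ℝ ((fun k => w k t) '' Ici n) := by
    rw [ae_all_iff]
    intro n
    refine (convexHull_min (t := (fun p : Lp U 2 μ × Lp ℝ 2 μ => p.1) ⁻¹'
      {f : Lp U 2 μ | ∀ᵐ t ∂μ, f t ∈ convexHull ℝ ((fun k => w k t) '' Ici n)}) ?_ ?_) (hq n)
    · rintro _ ⟨k, hk, rfl⟩
      exact ae_of_all _ fun t => subset_convexHull ℝ _ ⟨k, hk, rfl⟩
    · exact (convex_setOf_ae_mem fun t => convex_convexHull ℝ _).is_linear_preimage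
        (LinearMap.fst ℝ (Lp U 2 μ) (Lp ℝ 2 μ)).isLinear
  have hq0 : ∀ᵐ t ∂μ, ∀ f : StrongDual ℝ U, Tendsto (fun n => f ((q (φ n)).1 t)) atTop (𝓝 0) := by
    filter_upwards [hw0, hqt] with t h0 ht f
    rw [Metric.tendsto_atTop]
    intro ε hε
    obtain ⟨N, hN⟩ := Metric.tendsto_atTop.1 (h0 f) ε hε
    refine ⟨N, fun n hn => ?_⟩
    refine (convexHull_min (t := f ⁻¹' Metric.ball 0 ε) ?_
      ((convex_ball _ _).is_linear_preimage f.isLinear)) (ht (φ n))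
    rintro _ ⟨k, hk, rfl⟩
    exact hN k (hn.trans ((hφ.id_le n).trans hk))
  have hyρ : δ ≤ inner ℝ y ρ := by
    refine ge_of_tendsto' (hqy.inner tendsto_const_nhds) fun n => ?_
    exact (hqℓ n).trans_eq (dual_eq_inner_of_mem_densityPairs (hqR n))
  obtain ⟨c, hc, hc0⟩ := exists_countable_convex_combinations
    (LinearMap.fst ℝ (Lp U 2 μ) (Lp ℝ 2 μ)) (q := fun n => q (φ n)) hq0
  have hcR : ∀ i, c i ∈ densityPairs ℓ ρ := fun i => (convexHull_min (by
    rintro _ ⟨k, rfl⟩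
    exact hqR _) (densityPairs ℓ ρ).convex) (hc i)
  have hcD : ∀ i, ∀ᵐ t ∂μ, ‖(c i).2 t - y t‖ ≤ D t := fun i => by
    have : ∀ᵐ t ∂μ, (c i).2 t ∈ Metric.closedBall (y t) (D t) := by
      refine (convexHull_min (t := (fun p : Lp U 2 μ × Lp ℝ 2 μ => p.2) ⁻¹'
        {f : Lp ℝ 2 μ | ∀ᵐ t ∂μ, f t ∈ Metric.closedBall (y t) (D t)}) ?_ ?_) (hc i)
      · rintro _ ⟨k, rfl⟩
        filter_upwards [hqD] with t ht
        rw [Metric.mem_closedBall, dist_eq_norm]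
        exact ht k
      · exact (convex_setOf_ae_mem fun t => convex_closedBall _ _).is_linear_preimage
          (LinearMap.snd ℝ (Lp U 2 μ) (Lp ℝ 2 μ)).isLinear
    filter_upwards [this] with t ht
    rwa [Metric.mem_closedBall, dist_eq_norm] at ht
  choose p hpR hpD hp using exists_densityPairs_norm_le_of_le hcR hcD
  have hlim : Tendsto (fun N => (p N).1) atTop (𝓝 0) := by
    refine tendsto_zero_Lp_of_dominated (Lp.memLp (c 0).1).norm (fun N => ?_) ?_
    · filter_upwards [hp N] with t ht
      exact ht 0 (Nat.zero_le _)
    · filter_upwards [hc0, ae_all_iff.2 hp] with t h0 ht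
      rw [Metric.tendsto_atTop]
      intro ε hε
      obtain ⟨i, hi⟩ := h0 ε hε
      exact ⟨i, fun N hN => by rw [dist_zero_right]; exact (ht N i hN).trans_lt hi⟩
  have hlow : ∀ N, δ / 2 ≤ ℓ (p N).1 := by
    intro N
    have h1 : ‖(p N).2 - y‖ ≤ δ / (2 * (‖ρ‖ + 1)) := by
      rw [Lp.norm_def]
      refine ENNReal.toReal_le_of_le_ofReal hη.le ((eLpNorm_mono_ae_real ?_).trans hDη)
      filter_upwards [hpD N, Lp.coeFn_sub (p N).2 y] with t h2 h3
      rw [h3]; exact h2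
    have h2 : |inner ℝ ((p N).2 - y) ρ| ≤ δ / 2 := by
      refine (abs_real_inner_le_norm _ _).trans ?_
      calc ‖(p N).2 - y‖ * ‖ρ‖ ≤ δ / (2 * (‖ρ‖ + 1)) * (‖ρ‖ + 1) := by gcongr; linarith
        _ = δ / 2 := by field_simp
    rw [dual_eq_inner_of_mem_densityPairs (hpR N)]
    have h3 : (inner ℝ (p N).2 ρ : ℝ) = inner ℝ y ρ + inner ℝ ((p N).2 - y) ρ := by
      rw [← inner_add_left]; congr 1; abel
    rw [h3]
    linarith [(abs_le.1 h2).1]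
  have h0 : δ / 2 ≤ ℓ 0 := ge_of_tendsto' ((ℓ.continuous.tendsto 0).comp hlim) hlow
  rw [map_zero] at h0
  linarith

/-- A dominated sequence of `L²(μ; U)` that is weakly null at almost every point is weakly null. -/
theorem tendsto_dual_of_ae_weak_tendsto [IsFiniteMeasure μ] {w : ℕ → Lp U 2 μ} {r : α → ℝ}
    (hr : MemLp r 2 μ) (hw : ∀ᵐ t ∂μ, ∀ n, ‖w n t‖ ≤ r t)
    (hw0 : ∀ᵐ t ∂μ, ∀ g : StrongDual ℝ U, Tendsto (fun n => g (w n t)) atTop (𝓝 0))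
    (ℓ : StrongDual ℝ (Lp U 2 μ)) : Tendsto (fun n => ℓ (w n)) atTop (𝓝 0) := by
  have upper : ∀ (ℓ : StrongDual ℝ (Lp U 2 μ)) (δ : ℝ), 0 < δ → ∀ᶠ n in atTop, ℓ (w n) < δ := by
    intro ℓ δ hδ
    by_contra hcon
    obtain ⟨ψ, hψ, hψδ⟩ := extraction_of_frequently_atTop (not_eventually.1 hcon)
    exact not_forall_le_dual_of_ae_weak_tendsto (w := fun n => w (ψ n)) hr
      (hw.mono fun t ht n => ht _)
      (hw0.mono fun t ht g => (ht g).comp hψ.tendsto_atTop) ℓ hδ fun n => not_lt.1 (hψδ n)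
  refine tendsto_order.2 ⟨fun b hb => ?_, fun b hb => upper ℓ b hb⟩
  refine (upper (-ℓ) (-b) (by linarith)).mono fun n hn => ?_
  simpa using hn

end WeakL2

section ReflexiveL2

/-- A bounded sequence of functionals, with geometric weights, as a map into `ℓ²`. -/
theorem exists_clm_lp_of_norm_le_one {E : Type*} [NormedAddCommGroup E] [NormedSpace ℝ E]
    {f : ℕ → StrongDual ℝ E} (hf : ∀ j, ‖f j‖ ≤ 1) :
    ∃ G : E →L[ℝ] lp (fun _ : ℕ => ℝ) 2, ∀ x j, G x j = (1 / 2) ^ j * f j x := by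
  have hle : ∀ x j, ‖(1 / 2 : ℝ) ^ j * f j x‖ ^ (2 : ℝ) ≤ (1 / 4) ^ j * ‖x‖ ^ 2 := by
    intro x j
    rw [Real.rpow_two, norm_mul, mul_pow, norm_pow, ← pow_mul, mul_comm j 2, pow_mul]
    gcongr
    · norm_num
    · exact ((f j).le_of_opNorm_le (hf j) x).trans (by simp)
  have hs : ∀ x : E, Summable fun j : ℕ => (1 / 4 : ℝ) ^ j * ‖x‖ ^ 2 := fun x =>
    (summable_geometric_of_lt_one (by norm_num) (by norm_num)).mul_right _
  have hmem : ∀ x, Memℓp (E := fun _ : ℕ => ℝ) (fun j => (1 / 2 : ℝ) ^ j * f j x) 2 := fun x =>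
    memℓp_gen (Summable.of_nonneg_of_le (fun j => by positivity)
      (fun j => by simpa using hle x j) (hs x))
  let G₀ : E →ₗ[ℝ] lp (fun _ : ℕ => ℝ) 2 :=
    { toFun := fun x => ⟨_, hmem x⟩
      map_add' := fun x y => by
        ext j
        exact (by rw [map_add, mul_add] :
          (1 / 2 : ℝ) ^ j * f j (x + y) = (1 / 2) ^ j * f j x + (1 / 2) ^ j * f j y)
      map_smul' := fun c x => by
        ext j
        simp
        ring }
  refine ⟨G₀.mkContinuous 2 fun x => ?_, fun x j => rfl⟩
  refine lp.norm_le_of_forall_sum_le (by simp) (by positivity) fun s => ?_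
  calc ∑ i ∈ s, ‖G₀ x i‖ ^ (2 : ℝ≥0∞).toReal
      ≤ ∑ i ∈ s, (1 / 4 : ℝ) ^ i * ‖x‖ ^ 2 :=
        Finset.sum_le_sum fun i _ => by
          rw [ENNReal.toReal_ofNat]
          exact hle x i
    _ ≤ ∑' i : ℕ, (1 / 4 : ℝ) ^ i * ‖x‖ ^ 2 :=
        (hs x).sum_le_tsum _ fun i _ => by positivity
    _ = (1 - 1 / 4)⁻¹ * ‖x‖ ^ 2 := by
        rw [tsum_mul_right, tsum_geometric_of_lt_one (by norm_num) (by norm_num)]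
    _ ≤ (2 * ‖x‖) ^ (2 : ℝ≥0∞).toReal := by
        simp only [ENNReal.toReal_ofNat, Real.rpow_two]
        nlinarith [sq_nonneg ‖x‖]

variable {α : Type*} {mα : MeasurableSpace α} {μ : Measure α}
variable {U : Type*} [NormedAddCommGroup U] [NormedSpace ℝ U]

/-- An almost everywhere defined weak limit of `L²` functions with a separable closed range space
is strongly measurable. -/
theorem aestronglyMeasurable_of_norming {V : Submodule ℝ U}
    (hV : TopologicalSpace.IsSeparable (V : Set U)) {f : ℕ → StrongDual ℝ U}
    (hf1 : ∀ j, ‖f j‖ ≤ 1) (hf : ∀ x ∈ V, ∀ ε > 0, ∃ j, ‖x‖ - ε < f j x)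
    {x : α → U} (hxV : ∀ t, x t ∈ V) {g : ℕ → α → ℝ} (hg : ∀ j, Measurable (g j))
    (hx : ∀ᵐ t ∂μ, ∀ j, f j (x t) = g j t) : AEStronglyMeasurable x μ := by
  classical
  obtain ⟨s, hsub, hs, hs0⟩ := exists_measurable_superset_of_null (ae_iff.1 hx)
  have hs' : ∀ t ∉ s, ∀ j, f j (x t) = g j t := fun t ht => by
    by_contra h
    exact ht (hsub h)
  refine ⟨sᶜ.indicator x, ?_, ?_⟩
  · refine stronglyMeasurable_of_norming hV hf1 hf (fun t => ?_) fun j => ?_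
    · by_cases ht : t ∈ s
      · simp [ht]
      · simpa [ht] using hxV t
    · have : (fun t => f j (sᶜ.indicator x t)) = sᶜ.indicator (g j) := by
        ext t
        by_cases ht : t ∈ s
        · simp [ht]
        · simp [ht, hs' t ht j]
      rw [this]
      exact (hg j).indicator hs.compl
  · have : ∀ᵐ t ∂μ, t ∉ s := by rw [ae_iff]; simpa using hs0
    filter_upwards [this] with t ht
    simp [ht]

theorem IsReflexiveSpace.exists_convexHull_tail_weak_tendsto_L2 (hU : IsReflexiveSpace U)
    [IsFiniteMeasure μ] (u : ℕ → Lp U 2 μ) (C : ℝ) (hu : ∀ n, ‖u n‖ ≤ C) :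
    ∃ (x : Lp U 2 μ) (z : ℕ → Lp U 2 μ), (∀ n, z n ∈ convexHull ℝ (u '' Ici n)) ∧
      ∀ ℓ : StrongDual ℝ (Lp U 2 μ), Tendsto (fun n => ℓ (z n)) atTop (𝓝 (ℓ x)) := by
  classical
  -- a separable subspace containing all values, and a norming family for it
  set V : Submodule ℝ U := (Submodule.span ℝ (⋃ n, range (u n))).topologicalClosure with hVdef
  have hVc : IsClosed (V : Set U) := Submodule.isClosed_topologicalClosure _
  have huV : ∀ n t, u n t ∈ V := fun n t =>
    Submodule.le_topologicalClosure _ (Submodule.subset_span (mem_iUnion.2 ⟨n, t, rfl⟩))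
  have hVs : TopologicalSpace.IsSeparable (V : Set U) :=
    ((TopologicalSpace.IsSeparable.iUnion fun n =>
      (Lp.stronglyMeasurable (u n)).isSeparable_range).span (R := ℝ)).closure
  obtain ⟨f, hf1, hf⟩ := exists_norming_sequence hVs
  -- the functionals on `U × ℝ`
  let f' : ℕ → StrongDual ℝ (U × ℝ) := fun j => Nat.casesOn j (ContinuousLinearMap.snd ℝ U ℝ)
    fun i => (f i).comp (ContinuousLinearMap.fst ℝ U ℝ)
  have hf1' : ∀ j, ‖f' j‖ ≤ 1 := by
    rintro (_ | i)
    · exact ContinuousLinearMap.norm_snd_le ℝ U ℝ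
    · refine ((f i).opNorm_comp_le _).trans ?_
      have h1 := ContinuousLinearMap.norm_fst_le ℝ U ℝ
      nlinarith [hf1 i, norm_nonneg (f i), norm_nonneg (ContinuousLinearMap.fst ℝ U ℝ)]
  obtain ⟨G, hG⟩ := exists_clm_lp_of_norm_le_one hf1'
  have hpm : ∀ n, MemLp (fun t => (u n t, ‖u n t‖)) 2 μ := fun n =>
    MemLp.of_le (Lp.memLp (u n)) ((Lp.aestronglyMeasurable _).prodMk (Lp.aestronglyMeasurable _).norm)
      (ae_of_all _ fun t => by simp [Prod.norm_def])
  let P : ℕ → Lp (U × ℝ) 2 μ := fun n => (hpm n).toLp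
  have hP : ∀ n, ∀ᵐ t ∂μ, P n t = (u n t, ‖u n t‖) := fun n => (hpm n).coeFn_toLp
  have hPn : ∀ n, ‖P n‖ ≤ C := fun n => by
    refine (Lp.norm_le_norm_of_ae_le ?_).trans (hu n)
    filter_upwards [hP n] with t ht
    simp [ht, Prod.norm_def]
  let L := ContinuousLinearMap.compLpL 2 μ G
  obtain ⟨y, q, hq, hqy⟩ := exists_convexHull_tail_tendsto_map L.toLinearMap P (‖L‖ * C)
    fun n => (L.le_opNorm _).trans (mul_le_mul_of_nonneg_left (hPn n) (norm_nonneg _))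
  obtain ⟨φ, hφ, D, hD, -, hqD, hqlim⟩ := exists_subseq_ae_tendsto_dominated hqy one_pos
  let K := ContinuousLinearMap.compLpL 2 μ (ContinuousLinearMap.fst ℝ U ℝ)
  have hK : ∀ n, ∀ᵐ t ∂μ, K (q n) t = (q n t).1 := fun n =>
    ContinuousLinearMap.coeFn_compLpL (ContinuousLinearMap.fst ℝ U ℝ) (q n)
  have hL : ∀ n, ∀ᵐ t ∂μ, L (q n) t = G (q n t) := fun n =>
    ContinuousLinearMap.coeFn_compLpL G (q n)
  have hz : ∀ n, K (q (φ n)) ∈ convexHull ℝ (u '' Ici n) := by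
    intro n
    have h1 : K.toLinearMap '' convexHull ℝ (P '' Ici (φ n)) = convexHull ℝ (u '' Ici (φ n)) := by
      rw [LinearMap.image_convexHull, image_image]
      congr 2
      ext k : 1
      refine Lp.ext ?_
      filter_upwards [ContinuousLinearMap.coeFn_compLpL (p := 2)
        (ContinuousLinearMap.fst ℝ U ℝ) (P k), hP k] with t h2 h3
      exact h2.trans (by rw [h3]; rfl)
    refine convexHull_mono (image_mono (Ici_subset_Ici.2 (hφ.id_le n))) ?_
    rw [← h1]
    exact ⟨_, hq _, rfl⟩
  have hqC : ∀ᵐ t ∂μ, ∀ n, q n t ∈ {p : U × ℝ | p.1 ∈ V ∧ ‖p.1‖ ≤ p.2} := by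
    rw [ae_all_iff]
    intro n
    have hconv : Convex ℝ {p : U × ℝ | p.1 ∈ V ∧ ‖p.1‖ ≤ p.2} := by
      rintro p ⟨hp1, hp2⟩ p' ⟨hp1', hp2'⟩ a b ha hb -
      refine ⟨V.add_mem (V.smul_mem _ hp1) (V.smul_mem _ hp1'), ?_⟩
      refine (norm_add_le _ _).trans ?_
      rw [Prod.smul_fst, Prod.smul_fst, norm_smul, norm_smul, Real.norm_of_nonneg ha,
        Real.norm_of_nonneg hb]
      exact add_le_add (mul_le_mul_of_nonneg_left hp2 ha) (mul_le_mul_of_nonneg_left hp2' hb)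
    have hsub : convexHull ℝ (P '' Ici n) ⊆
        {p : Lp (U × ℝ) 2 μ | ∀ᵐ t ∂μ, p t ∈ {p : U × ℝ | p.1 ∈ V ∧ ‖p.1‖ ≤ p.2}} := by
      refine convexHull_min ?_ (convex_setOf_ae_mem fun t => hconv)
      rintro _ ⟨k, -, rfl⟩
      filter_upwards [hP k] with t ht
      rw [ht]
      exact ⟨huV k t, le_rfl⟩
    exact hsub (hq n)
  set r : α → ℝ := fun t => D t + ‖y t‖ with hr_def
  have hr : MemLp r 2 μ := hD.add (Lp.memLp y).norm
  have hle : ∀ᵐ t ∂μ, ∀ n, ‖(q (φ n) t).1‖ ≤ r t := by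
    filter_upwards [hqC, hqD, ae_all_iff.2 hL] with t h1 h2 h3 n
    refine (h1 (φ n)).2.trans ?_
    have h4 : (q (φ n) t).2 = G (q (φ n) t) 0 := by rw [hG]; simp [f']
    have h5 := lp.norm_apply_le_norm (p := 2) (by norm_num) (G (q (φ n) t)) 0
    have h6 : L (q (φ n)) t = G (q (φ n) t) := h3 (φ n)
    have h7 : ‖G (q (φ n) t) - y t‖ ≤ D t := by rw [← h6]; exact h2 n
    have h8 := norm_le_norm_sub_add (G (q (φ n) t)) (y t)
    rw [h4]
    exact (le_abs_self _).trans (h5.trans (h8.trans (by simpa [r] using h7)))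
  have hcoord : ∀ᵐ t ∂μ, ∀ j, Tendsto (fun n => f j (q (φ n) t).1) atTop
      (𝓝 (2 ^ (j + 1) * y t (j + 1))) := by
    filter_upwards [hqlim, ae_all_iff.2 hL] with t h1 h3 j
    have h4 : Tendsto (fun n => G (q (φ n) t)) atTop (𝓝 (y t)) := by
      refine h1.congr fun n => ?_
      exact h3 (φ n)
    have h5 : Tendsto (fun n => G (q (φ n) t) (j + 1)) atTop (𝓝 (y t (j + 1))) := by
      rw [tendsto_iff_norm_sub_tendsto_zero] at h4 ⊢
      refine squeeze_zero (fun _ => norm_nonneg _) (fun n => ?_) h4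
      exact lp.norm_apply_le_norm (p := 2) (by norm_num) (G (q (φ n) t) - y t) (j + 1)
    refine (h5.const_mul (2 ^ (j + 1))).congr fun n => ?_
    rw [hG, ← mul_assoc, ← mul_pow]
    simp [f']
  have hweak : ∀ t, ∃ x ∈ V, ((∀ n, ‖(q (φ n) t).1‖ ≤ r t) → (∀ n, (q n t).1 ∈ V) →
      (∀ j, Tendsto (fun n => f j (q (φ n) t).1) atTop (𝓝 (2 ^ (j + 1) * y t (j + 1)))) →
      ∀ g : StrongDual ℝ U, Tendsto (fun n => g (q (φ n) t).1) atTop (𝓝 (g x))) := by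
    intro t
    by_cases h : (∀ n, ‖(q (φ n) t).1‖ ≤ r t) ∧ (∀ n, (q n t).1 ∈ V) ∧
      (∀ j, Tendsto (fun n => f j (q (φ n) t).1) atTop (𝓝 (2 ^ (j + 1) * y t (j + 1))))
    · obtain ⟨x, hxV, hx⟩ := hU.exists_weak_limit_of_norming hVc hf h.1 (fun n => h.2.1 (φ n)) h.2.2
      exact ⟨x, hxV, fun _ _ _ => hx⟩
    · exact ⟨0, V.zero_mem, fun h1 h2 h3 => (h ⟨h1, h2, h3⟩).elim⟩
  choose x hxV hx using hweak
  have hxlim : ∀ᵐ t ∂μ, ∀ g : StrongDual ℝ U,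
      Tendsto (fun n => g (q (φ n) t).1) atTop (𝓝 (g (x t))) := by
    filter_upwards [hle, hqC, hcoord] with t h1 h2 h3
    exact hx t h1 (fun n => (h2 n).1) h3
  have hxm : AEStronglyMeasurable x μ := by
    refine aestronglyMeasurable_of_norming hVs hf1 hf hxV
      (g := fun j t => 2 ^ (j + 1) * y t (j + 1)) (fun j => ?_) ?_
    · refine Measurable.const_mul ?_ _
      have hc : Continuous fun a : lp (fun _ : ℕ => ℝ) 2 => a (j + 1) := by
        refine LipschitzWith.continuous (K := 1) (LipschitzWith.of_dist_le_mul fun a b => ?_)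
        rw [dist_eq_norm, dist_eq_norm, NNReal.coe_one, one_mul]
        exact lp.norm_apply_le_norm (p := 2) (by norm_num) (a - b) (j + 1)
      exact (hc.comp_stronglyMeasurable (Lp.stronglyMeasurable y)).measurable
    · filter_upwards [hxlim, hcoord] with t h1 h2 j
      exact tendsto_nhds_unique (h1 (f j)) (h2 j)
  have hxr : ∀ᵐ t ∂μ, ‖x t‖ ≤ r t := by
    filter_upwards [hxlim, hle] with t h1 h2
    obtain ⟨g, hg1, hgx⟩ := exists_dual_vector'' ℝ (x t)
    have h3 : g (x t) = ‖x t‖ := by simpa using hgx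
    rw [← h3]
    refine le_of_tendsto' (h1 g) fun n => ?_
    exact (le_abs_self _).trans ((g.le_of_opNorm_le hg1 _).trans (by simpa using h2 n))
  have hxmem : MemLp x 2 μ := MemLp.of_le hr hxm (hxr.mono fun t ht => ht.trans (le_abs_self _))
  refine ⟨hxmem.toLp, fun n => K (q (φ n)), hz, fun ℓ => ?_⟩
  have key : ∀ᵐ t ∂μ, ∀ n, (K (q (φ n)) - hxmem.toLp : Lp U 2 μ) t = (q (φ n) t).1 - x t := by
    rw [ae_all_iff]
    intro n
    filter_upwards [Lp.coeFn_sub (K (q (φ n))) hxmem.toLp, hK (φ n), hxmem.coeFn_toLp]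
      with t h1 h2 h3
    rw [h1, Pi.sub_apply, h2, h3]
  have h0 := tendsto_dual_of_ae_weak_tendsto (w := fun n => K (q (φ n)) - hxmem.toLp)
    (r := fun t => r t + r t) (hr.add hr) (by
      filter_upwards [key, hle, hxr] with t h1 h2 h3 n
      rw [h1]
      exact (norm_sub_le _ _).trans (add_le_add (h2 n) h3)) (by
      filter_upwards [key, hxlim] with t h1 h2 g
      simp only [h1, map_sub]
      simpa using (h2 g).sub_const (g (x t))) ℓ
  simp only [map_sub] at h0
  simpa using h0.add_const (ℓ hxmem.toLp)

/-- Bounded sequences in `L²(μ; U)`, `U` reflexive, have weakly convergent subsequences. -/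
theorem IsReflexiveSpace.exists_weakly_convergent_subseq_L2 (hU : IsReflexiveSpace U)
    [IsFiniteMeasure μ] (u : ℕ → Lp U 2 μ) (C : ℝ) (hu : ∀ n, ‖u n‖ ≤ C) :
    ∃ (x : Lp U 2 μ) (φ : ℕ → ℕ), StrictMono φ ∧
      ∀ ℓ : StrongDual ℝ (Lp U 2 μ), Tendsto (fun n => ℓ (u (φ n))) atTop (𝓝 (ℓ x)) :=
  exists_weakly_convergent_subseq_of_convexHull_tail
    (fun v C hv => hU.exists_convexHull_tail_weak_tendsto_L2 v C hv) u C hu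

end ReflexiveL2

section CompactConvolution

variable {U X : Type*} [NormedAddCommGroup U] [NormedSpace ℝ U]
  [NormedAddCommGroup X] [NormedSpace ℝ X] {T : ℝ}

theorem IsCompactOperator.tendsto_zero_of_weak_tendsto {c : U →L[ℝ] X} (hc : IsCompactOperator c)
    {y : ℕ → U} {C : ℝ} (hy : ∀ n, ‖y n‖ ≤ C)
    (hy0 : ∀ f : StrongDual ℝ U, Tendsto (fun n => f (y n)) atTop (𝓝 0)) :
    Tendsto (fun n => c (y n)) atTop (𝓝 0) := by
  refine tendsto_of_subseq_tendsto fun ns hns => ?_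
  obtain ⟨z, -, ms, hms, hz⟩ := (IsCompactOperator.isCompact_closure_image_closedBall
    (f := (c : U →ₗ[ℝ] X)) hc C).tendsto_subseq (x := fun n => c (y (ns n)))
    fun n => subset_closure ⟨y (ns n), mem_closedBall_zero_iff.2 (hy _), rfl⟩
  refine ⟨ms, ?_⟩
  have : z = 0 := SeparatingDual.eq_zero_of_forall_dual_eq_zero (R := ℝ) fun f =>
    tendsto_nhds_unique ((f.continuous.tendsto z).comp hz)
      (((hy0 (f.comp c)).comp hns).comp hms.tendsto_atTop)
  rw [← this]
  exact hz

/-- Cauchy-Schwarz for a truncated operator-valued convolution. -/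
theorem lintegral_conv_le {A : ℝ → U →L[ℝ] X} (hA : AEStronglyMeasurable A volume)
    (w : Lp U 2 (volume.restrict (Ioc (0 : ℝ) T))) (t : ℝ) :
    ∫⁻ s in Ioc 0 T, ‖A (t - s)‖ₑ * ‖w s‖ₑ ≤ eLpNorm A 2 volume * ‖w‖ₑ := by
  have hmp := Measure.measurePreserving_sub_left (volume : Measure ℝ) t
  have hAt : AEStronglyMeasurable (fun s => A (t - s)) volume :=
    hA.comp_measurePreserving hmp
  refine (ENNReal.lintegral_mul_le_Lp_mul_Lq _ Real.HolderConjugate.two_two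
    hAt.restrict.enorm (Lp.aestronglyMeasurable w).enorm).trans ?_
  have h1 : (∫⁻ s in Ioc 0 T, ‖A (t - s)‖ₑ ^ (2 : ℝ)) ^ (1 / (2 : ℝ)) ≤ eLpNorm A 2 volume := by
    rw [← eLpNorm_comp_measurePreserving hA hmp,
      eLpNorm_eq_lintegral_rpow_enorm_toReal (by norm_num) (by norm_num)]
    simp only [ENNReal.toReal_ofNat, Function.comp_apply]
    gcongr
    exact Measure.restrict_le_self
  have h2 : (∫⁻ s in Ioc 0 T, ‖w s‖ₑ ^ (2 : ℝ)) ^ (1 / (2 : ℝ)) = ‖w‖ₑ := by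
    rw [Lp.enorm_def, eLpNorm_eq_lintegral_rpow_enorm_toReal (by norm_num) (by norm_num)]
    simp
  rw [h2]
  gcongr

theorem integrable_conv {A : ℝ → U →L[ℝ] X} (hA : MemLp A 2 volume)
    (w : Lp U 2 (volume.restrict (Ioc (0 : ℝ) T))) (t : ℝ) :
    IntegrableOn (fun s => A (t - s) (w s)) (Ioc 0 T) := by
  have hAt : AEStronglyMeasurable (fun s => A (t - s)) volume :=
    hA.1.comp_measurePreserving (Measure.measurePreserving_sub_left (volume : Measure ℝ) t)
  refine ⟨(ContinuousLinearMap.apply ℝ X : U →L[ℝ] _).aestronglyMeasurable_comp₂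
    (Lp.aestronglyMeasurable w) hAt.restrict, ?_⟩
  calc ∫⁻ s in Ioc 0 T, ‖A (t - s) (w s)‖ₑ ≤ ∫⁻ s in Ioc 0 T, ‖A (t - s)‖ₑ * ‖w s‖ₑ :=
        lintegral_mono fun s => ContinuousLinearMap.le_opENorm _ _
    _ ≤ eLpNorm A 2 volume * ‖w‖ₑ := lintegral_conv_le hA.1 w t
    _ < ∞ := ENNReal.mul_lt_top hA.2 enorm_lt_top

theorem norm_conv_le {A : ℝ → U →L[ℝ] X} (hA : MemLp A 2 volume)
    (w : Lp U 2 (volume.restrict (Ioc (0 : ℝ) T))) (t : ℝ) :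
    ‖∫ s in Ioc 0 T, A (t - s) (w s)‖ ≤ (eLpNorm A 2 volume).toReal * ‖w‖ := by
  have h1 : ‖∫ s in Ioc 0 T, A (t - s) (w s)‖ₑ ≤ eLpNorm A 2 volume * ‖w‖ₑ :=
    (enorm_integral_le_lintegral_enorm _).trans
      ((lintegral_mono fun s => ContinuousLinearMap.le_opENorm _ _).trans
        (lintegral_conv_le hA.1 w t))
  have h2 := ENNReal.toReal_mono (ENNReal.mul_lt_top hA.2 enorm_lt_top).ne h1
  simpa using h2

theorem exists_conv_clm {A : ℝ → U →L[ℝ] X} (hA : MemLp A 2 volume) (T t : ℝ) :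
    ∃ Λ : Lp U 2 (volume.restrict (Ioc (0 : ℝ) T)) →L[ℝ] X,
      ∀ w, Λ w = ∫ s in Ioc 0 T, A (t - s) (w s) := by
  let Λ₀ : Lp U 2 (volume.restrict (Ioc (0 : ℝ) T)) →ₗ[ℝ] X :=
    { toFun := fun w => ∫ s in Ioc 0 T, A (t - s) (w s)
      map_add' := fun v w => by
        rw [← integral_add (integrable_conv hA v t) (integrable_conv hA w t)]
        refine integral_congr_ae ?_
        filter_upwards [Lp.coeFn_add v w] with s hs
        rw [hs, Pi.add_apply, map_add]
      map_smul' := fun c w => by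
        rw [← integral_smul]
        refine integral_congr_ae ?_
        filter_upwards [Lp.coeFn_smul c w] with s hs
        rw [hs, Pi.smul_apply, map_smul]; rfl }
  exact ⟨Λ₀.mkContinuous _ fun w => norm_conv_le hA w t, fun w => rfl⟩

omit [NormedSpace ℝ U] in
theorem integral_norm_le_sqrt_mul (w : Lp U 2 (volume.restrict (Ioc (0 : ℝ) T))) :
    Integrable (fun s => ‖w s‖) (volume.restrict (Ioc (0 : ℝ) T)) ∧
      ∫ s in Ioc 0 T, ‖w s‖ ≤ (ENNReal.ofReal T ^ (1 / 2 : ℝ)).toReal * ‖w‖ := by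
  have hint : Integrable (fun s => ‖w s‖) (volume.restrict (Ioc (0 : ℝ) T)) :=
    ((Lp.memLp w).integrable (by norm_num)).norm
  refine ⟨hint, ?_⟩
  rw [integral_norm_eq_lintegral_enorm (Lp.aestronglyMeasurable w), ← eLpNorm_one_eq_lintegral_enorm]
  have h := eLpNorm_le_eLpNorm_mul_rpow_measure_univ (p := 1) (q := 2) (by norm_num)
    (Lp.aestronglyMeasurable w)
  rw [Measure.restrict_apply_univ, Real.volume_Ioc, sub_zero, ← Lp.enorm_def] at h
  have h2 := ENNReal.toReal_mono (ENNReal.mul_lt_top enorm_lt_top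
    (ENNReal.rpow_lt_top_of_nonneg (by norm_num) ENNReal.ofReal_ne_top)).ne h
  rw [ENNReal.toReal_mul, toReal_enorm, mul_comm] at h2
  norm_num at h2 ⊢
  exact h2

/-- Convolution with a scalar continuous kernel times a compact operator is completely
continuous into the uniform norm. -/
theorem eventually_norm_conv_smul_le {ρ : ℝ → ℝ} (hρ : Continuous ρ) (hρc : HasCompactSupport ρ)
    {c : U →L[ℝ] X} (hc : IsCompactOperator c) [CompleteSpace U] [CompleteSpace X]
    {w : ℕ → Lp U 2 (volume.restrict (Ioc (0 : ℝ) T))} {C : ℝ} (hw : ∀ n, ‖w n‖ ≤ C)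
    (hw0 : ∀ ℓ : StrongDual ℝ (Lp U 2 (volume.restrict (Ioc (0 : ℝ) T))),
      Tendsto (fun n => ℓ (w n)) atTop (𝓝 0)) {ε : ℝ} (hε : 0 < ε) :
    ∀ᶠ n in atTop, ∀ t ∈ Icc 0 T, ‖∫ s in Ioc 0 T, (ρ (t - s) • c) (w n s)‖ ≤ ε := by
  have hρL : MemLp ρ 2 volume := hρ.memLp_of_hasCompactSupport hρc
  have hAm : MemLp (fun τ => ρ τ • ContinuousLinearMap.id ℝ U) 2 volume :=
    (hρ.smul continuous_const).memLp_of_hasCompactSupport hρc.smul_right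
  set y : ℕ → ℝ → U := fun n t => ∫ s in Ioc 0 T, ρ (t - s) • w n s with hy
  have hint : ∀ n t, IntegrableOn (fun s => ρ (t - s) • w n s) (Ioc 0 T) := fun n t =>
    integrable_conv hAm (w n) t
  have hcy : ∀ n t, ∫ s in Ioc 0 T, (ρ (t - s) • c) (w n s) = c (y n t) := by
    intro n t
    rw [hy, ← ContinuousLinearMap.integral_comp_comm c (hint n t)]
    simp
  have hyb : ∀ n t, ‖y n t‖ ≤
      (eLpNorm (fun τ => ρ τ • ContinuousLinearMap.id ℝ U) 2 volume).toReal * C := fun n t =>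
    (norm_conv_le hAm (w n) t).trans
      (mul_le_mul_of_nonneg_left (hw n) ENNReal.toReal_nonneg)
  have hptw : ∀ t, Tendsto (fun n => c (y n t)) atTop (𝓝 0) := by
    intro t
    refine hc.tendsto_zero_of_weak_tendsto (fun n => hyb n t) fun f => ?_
    obtain ⟨Λ, hΛ⟩ := exists_conv_clm hAm T t
    refine (hw0 (f.comp Λ)).congr fun n => ?_
    rw [ContinuousLinearMap.comp_apply, hΛ]
    rfl
  set K : ℝ := (ENNReal.ofReal T ^ (1 / 2 : ℝ)).toReal * C
  have hC : 0 ≤ C := (norm_nonneg _).trans (hw 0)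
  have hK : 0 ≤ K := mul_nonneg ENNReal.toReal_nonneg hC
  obtain ⟨δ, hδ, hδρ⟩ := Metric.uniformContinuous_iff.1
    (hρc.uniformContinuous_of_continuous hρ) (ε / (2 * (‖c‖ * K + 1))) (by positivity)
  have hequi : ∀ n t t', dist t t' < δ → ‖c (y n t)‖ ≤ ‖c (y n t')‖ + ε / 2 := by
    intro n t t' htt'
    have h1 : ‖y n t - y n t'‖ ≤ ε / (2 * (‖c‖ * K + 1)) * K := by
      rw [hy]
      simp only
      rw [← integral_sub (hint n t) (hint n t')]
      refine (norm_integral_le_of_norm_le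
        ((integral_norm_le_sqrt_mul (w n)).1.const_mul (ε / (2 * (‖c‖ * K + 1)))) ?_).trans ?_
      · refine ae_of_all _ fun s => ?_
        rw [← sub_smul, norm_smul]
        refine mul_le_mul_of_nonneg_right ?_ (norm_nonneg _)
        rw [← dist_eq_norm]
        refine (hδρ ?_).le
        rwa [Real.dist_eq, sub_sub_sub_cancel_right, ← Real.dist_eq]
      · rw [integral_const_mul]
        refine mul_le_mul_of_nonneg_left ?_ (by positivity)
        exact (integral_norm_le_sqrt_mul (w n)).2.trans
          (mul_le_mul_of_nonneg_left (hw n) ENNReal.toReal_nonneg)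
    have h2 : ‖c (y n t - y n t')‖ ≤ ε / 2 := by
      refine (c.le_opNorm_of_le h1).trans ?_
      calc ‖c‖ * (ε / (2 * (‖c‖ * K + 1)) * K) = ε / 2 * ((‖c‖ * K) / (‖c‖ * K + 1)) := by
            field_simp
        _ ≤ ε / 2 * 1 := by
            gcongr
            rw [div_le_one (by positivity)]
            linarith
        _ = ε / 2 := mul_one _
    rw [map_sub] at h2
    have h3 := norm_le_norm_sub_add (c (y n t)) (c (y n t'))
    linarith
  obtain ⟨F, -, hFfin, hF⟩ := (isCompact_Icc (a := (0 : ℝ)) (b := T)).finite_cover_balls hδ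
  have hev : ∀ᶠ n in atTop, ∀ t ∈ F, ‖c (y n t)‖ ≤ ε / 2 := by
    rw [hFfin.eventually_all]
    intro t _
    have := (hptw t).norm
    rw [norm_zero] at this
    exact this.eventually_le_const (by positivity)
  filter_upwards [hev] with n hn t ht
  obtain ⟨t', ht', htt'⟩ := mem_iUnion₂.1 (hF ht)
  rw [hcy]
  linarith [hequi n t t' htt', hn t' ht']

theorem memLp_clm_comp {E F : Type*} [NormedAddCommGroup E] [NormedSpace ℝ E]
    [NormedAddCommGroup F] [NormedSpace ℝ F] (ι : E →L[ℝ] F) {g : ℝ → E}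
    (hg : MemLp g 2 volume) : MemLp (fun τ => ι (g τ)) 2 volume :=
  ι.comp_memLp' hg

/-- The Banach space of compact operators. -/
def CompactOp (U X : Type*) [NormedAddCommGroup U] [NormedSpace ℝ U]
    [NormedAddCommGroup X] [NormedSpace ℝ X] : Type _ := compactOperator (RingHom.id ℝ) U X

noncomputable instance : NormedAddCommGroup (CompactOp U X) :=
  Submodule.normedAddCommGroup (compactOperator (RingHom.id ℝ) U X)

noncomputable instance : NormedSpace ℝ (CompactOp U X) :=
  Submodule.normedSpace (compactOperator (RingHom.id ℝ) U X)

instance [CompleteSpace X] : CompleteSpace (CompactOp U X) :=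
  (isClosed_setOfPred_isCompactOperator (σ₁₂ := RingHom.id ℝ) (M₁ := U) (M₂ := X)).completeSpace_coe

/-- The inclusion of the compact operators into the bounded operators. -/
noncomputable def compactOpIncl (U X : Type*) [NormedAddCommGroup U] [NormedSpace ℝ U]
    [NormedAddCommGroup X] [NormedSpace ℝ X] : CompactOp U X →L[ℝ] U →L[ℝ] X :=
  (compactOperator (RingHom.id ℝ) U X).subtypeₗᵢ.toContinuousLinearMap

/-- Kernels for which the convolution is completely continuous are dense in `L²`. -/
theorem exists_conv_approx [CompleteSpace U] [CompleteSpace X] {E : Type*}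
    [NormedAddCommGroup E] [NormedSpace ℝ E] (ι : E →L[ℝ] U →L[ℝ] X)
    (hE : ∀ c, IsCompactOperator (ι c)) {A : ℝ → E} (hA : MemLp A 2 volume)
    {w : ℕ → Lp U 2 (volume.restrict (Ioc (0 : ℝ) T))} {C : ℝ} (hw : ∀ n, ‖w n‖ ≤ C)
    (hw0 : ∀ ℓ : StrongDual ℝ (Lp U 2 (volume.restrict (Ioc (0 : ℝ) T))),
      Tendsto (fun n => ℓ (w n)) atTop (𝓝 0)) {η : ℝ≥0∞} (hη : η ≠ 0) :
    ∃ g : ℝ → E, eLpNorm (A - g) 2 volume ≤ η ∧ MemLp g 2 volume ∧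
      ∀ ε > (0 : ℝ), ∀ᶠ n in atTop, ∀ t ∈ Icc 0 T,
        ‖∫ s in Ioc 0 T, ι (g (t - s)) (w n s)‖ ≤ ε := by
  refine MemLp.induction_dense (μ := volume) (p := 2) (by norm_num)
    (fun g : ℝ → E => MemLp g 2 volume ∧ ∀ ε > (0 : ℝ), ∀ᶠ n in atTop, ∀ t ∈ Icc 0 T,
        ‖∫ s in Ioc 0 T, ι (g (t - s)) (w n s)‖ ≤ ε) ?_ ?_
    (fun g hg => hg.1.1) hA hη
  · intro c s hs hsfin ε' hε'
    have h1 : MemLp (s.indicator fun _ => (1 : ℝ)) 2 volume :=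
      memLp_indicator_const 2 hs 1 (Or.inr hsfin.ne)
    obtain ⟨ρ, hρc, hρ, hρcont, hρL⟩ := h1.exists_hasCompactSupport_eLpNorm_sub_le (by norm_num)
      (ε := ε' / (‖c‖ₑ + 1)) (ENNReal.div_pos hε' (by simp)).ne'
    refine ⟨fun τ => ρ τ • c, ?_, ?_, ?_⟩
    · have h2 : eLpNorm ((fun τ => ρ τ • c) - s.indicator fun _ => c) 2 volume ≤
          ENNReal.ofReal ‖c‖ * eLpNorm ((s.indicator fun _ => (1 : ℝ)) - ρ) 2 volume := by
        refine eLpNorm_le_mul_eLpNorm_of_ae_le_mul (ae_of_all _ fun τ => ?_) 2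
        have : ((fun τ => ρ τ • c) - s.indicator fun _ => c) τ =
            -(((s.indicator fun _ => (1 : ℝ)) - ρ) τ • c) := by
          by_cases hτ : τ ∈ s
          · simp [hτ, sub_smul]
          · simp [hτ]
        rw [this, norm_neg, norm_smul, mul_comm]
      refine h2.trans ?_
      rw [ofReal_norm]
      calc ‖c‖ₑ * eLpNorm ((s.indicator fun _ => (1 : ℝ)) - ρ) 2 volume
          ≤ (‖c‖ₑ + 1) * (ε' / (‖c‖ₑ + 1)) := by gcongr; simp
        _ ≤ ε' := ENNReal.mul_div_le
    · exact (hρcont.smul continuous_const).memLp_of_hasCompactSupport hρc.smul_right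
    · intro ε₁ hε₁
      simp only [map_smul]
      exact eventually_norm_conv_smul_le hρcont hρc (hE c) hw hw0 hε₁
  · rintro f g ⟨hf, hf'⟩ ⟨hg, hg'⟩
    refine ⟨hf.add hg, fun ε₁ hε₁ => ?_⟩
    filter_upwards [hf' (ε₁ / 2) (by positivity), hg' (ε₁ / 2) (by positivity)] with n h1 h2 t ht
    have h3 : ∫ s in Ioc 0 T, ι ((f + g) (t - s)) (w n s) =
        (∫ s in Ioc 0 T, ι (f (t - s)) (w n s)) +
          ∫ s in Ioc 0 T, ι (g (t - s)) (w n s) := by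
      rw [← integral_add (integrable_conv (memLp_clm_comp ι hf) (w n) t) (integrable_conv (memLp_clm_comp ι hg) (w n) t)]
      congr 1
      ext s
      simp
    rw [h3]
    refine (norm_add_le _ _).trans ?_
    linarith [h1 t ht, h2 t ht]

/-- Convolution with a square-integrable kernel of compact operators is completely continuous into
the uniform norm. -/
theorem eventually_norm_conv_le [CompleteSpace U] [CompleteSpace X] {A : ℝ → U →L[ℝ] X}
    (hA : MemLp A 2 volume) (hAc : ∀ τ, IsCompactOperator (A τ))
    {w : ℕ → Lp U 2 (volume.restrict (Ioc (0 : ℝ) T))} {C : ℝ} (hw : ∀ n, ‖w n‖ ≤ C)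
    (hw0 : ∀ ℓ : StrongDual ℝ (Lp U 2 (volume.restrict (Ioc (0 : ℝ) T))),
      Tendsto (fun n => ℓ (w n)) atTop (𝓝 0)) {ε : ℝ} (hε : 0 < ε) :
    ∀ᶠ n in atTop, ∀ t ∈ Icc 0 T, ‖∫ s in Ioc 0 T, A (t - s) (w n s)‖ ≤ ε := by
  classical
  let A' : ℝ → CompactOp U X := fun τ => ⟨A τ, hAc τ⟩
  have hA' : MemLp A' 2 volume := by
    refine ⟨?_, ?_⟩
    · exact (Topology.IsEmbedding.subtypeVal.aestronglyMeasurable_comp_iff).1 hA.1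
    · have : eLpNorm A' 2 volume = eLpNorm A 2 volume := eLpNorm_congr_norm_ae (ae_of_all _ fun τ => rfl)
      rw [this]; exact hA.2
  have hC : 0 ≤ C := (norm_nonneg _).trans (hw 0)
  obtain ⟨g, hgA, hg, hgP⟩ := exists_conv_approx (compactOpIncl U X)
    (fun c => c.2) hA' hw hw0 (η := ENNReal.ofReal (ε / (2 * (C + 1))))
    (by simpa using (by positivity : 0 < ε / (2 * (C + 1))))
  filter_upwards [hgP (ε / 2) (by positivity)] with n hn t ht
  have hsub : MemLp (fun τ => A τ - compactOpIncl U X (g τ)) 2 volume := hA.sub (memLp_clm_comp (compactOpIncl U X) hg)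
  have h1 : ∫ s in Ioc 0 T, A (t - s) (w n s) =
      (∫ s in Ioc 0 T, (A (t - s) - compactOpIncl U X (g (t - s))) (w n s)) +
        ∫ s in Ioc 0 T, compactOpIncl U X (g (t - s)) (w n s) := by
    rw [← integral_add (integrable_conv hsub (w n) t) (integrable_conv (memLp_clm_comp (compactOpIncl U X) hg) (w n) t)]
    congr 1
    ext s
    simp
  have h2 : (eLpNorm (fun τ => A τ - compactOpIncl U X (g τ)) 2 volume).toReal ≤ ε / (2 * (C + 1)) := by
    refine ENNReal.toReal_le_of_le_ofReal (by positivity) (le_of_eq_of_le ?_ hgA)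
    exact eLpNorm_congr_norm_ae (ae_of_all _ fun τ => rfl)
  rw [h1]
  refine (norm_add_le _ _).trans ?_
  have h3 := (norm_conv_le hsub (w n) t).trans (mul_le_mul h2 (hw n) (norm_nonneg _) (by positivity))
  have h4 : ε / (2 * (C + 1)) * C ≤ ε / 2 := by
    calc ε / (2 * (C + 1)) * C ≤ ε / (2 * (C + 1)) * (C + 1) := by gcongr; linarith
      _ = ε / 2 := by field_simp
  linarith [hn t ht]

end CompactConvolution

section StableDensity

theorem integral_rpow_mul_cexp_neg_mul_Ioi {q : ℝ} (hq : -1 < q) {ρ : ℂ} (hρ : 0 < ρ.re) :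
    ∫ s in Ioi (0 : ℝ), (s ^ q : ℝ) • Complex.exp (-(ρ * s)) =
      (1 / ρ) ^ ((q : ℂ) + 1) * Complex.Gamma (q + 1) := by
  set μ : Measure ℝ := (volume.restrict (Ioi (0 : ℝ))).withDensity
    (fun s => ENNReal.ofReal (s ^ q)) with hμ
  have hmeas : Measurable fun s : ℝ => ENNReal.ofReal (s ^ q) := by fun_prop
  have key : ∀ z : ℂ, ProbabilityTheory.complexMGF id μ z =
      ∫ s in Ioi (0 : ℝ), (s ^ q : ℝ) • Complex.exp (z * s) := by
    intro z
    rw [ProbabilityTheory.complexMGF, hμ, integral_withDensity_eq_integral_toReal_smul hmeas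
      (ae_of_all _ fun _ => ENNReal.ofReal_lt_top)]
    refine setIntegral_congr_fun measurableSet_Ioi fun s hs => ?_
    simp only [id]
    rw [ENNReal.toReal_ofReal (Real.rpow_nonneg (le_of_lt hs) _)]
  have hint : Iio (0 : ℝ) ⊆ ProbabilityTheory.integrableExpSet id μ := by
    intro r hr
    change Integrable (fun s : ℝ => Real.exp (r * s)) μ
    rw [hμ, integrable_withDensity_iff_integrable_smul' hmeas
      (ae_of_all _ fun _ => ENNReal.ofReal_lt_top)]
    have := integrableOn_rpow_mul_exp_neg_mul_rpow (s := q) (p := 1) (b := -r) hq one_pos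
      (neg_pos.2 hr)
    refine this.congr_fun (fun s hs => ?_) measurableSet_Ioi
    simp only [smul_eq_mul, Real.rpow_one, neg_neg]
    rw [ENNReal.toReal_ofReal (Real.rpow_nonneg (le_of_lt hs) _)]
  have hint' : Iio (0 : ℝ) ⊆ interior (ProbabilityTheory.integrableExpSet id μ) :=
    interior_maximal hint isOpen_Iio
  have hX : AnalyticOnNhd ℂ (ProbabilityTheory.complexMGF id μ) {z | z.re < 0} :=
    fun z hz => ProbabilityTheory.analyticAt_complexMGF (hint' hz)
  have hopen : IsOpen {z : ℂ | z.re < 0} := isOpen_lt Complex.continuous_re continuous_const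
  have hY : AnalyticOnNhd ℂ (fun z : ℂ => (1 / (-z)) ^ ((q : ℂ) + 1) * Complex.Gamma (q + 1))
      {z | z.re < 0} := by
    refine DifferentiableOn.analyticOnNhd (fun z hz => ?_) hopen
    have hz0 : -z ≠ 0 := by
      intro h
      have : z = 0 := by simpa using h
      simp [this] at hz
    have hsl : (1 / (-z)) ∈ Complex.slitPlane := by
      left
      rw [one_div, Complex.inv_re]
      have : 0 < (-z).re := by simpa using hz
      have h2 : 0 < Complex.normSq (-z) := Complex.normSq_pos.2 hz0
      positivity
    refine DifferentiableAt.differentiableWithinAt ?_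
    refine DifferentiableAt.mul_const ?_ _
    refine DifferentiableAt.cpow_const ?_ hsl
    exact (differentiableAt_const _).div differentiableAt_id.neg hz0
  have hreal : ∀ r : ℝ, 0 < r → ProbabilityTheory.complexMGF id μ ((-r : ℝ) : ℂ) =
      (1 / (-((-r : ℝ) : ℂ))) ^ ((q : ℂ) + 1) * Complex.Gamma (q + 1) := by
    intro r hr
    rw [key]
    have h := Complex.integral_cpow_mul_exp_neg_mul_Ioi (a := (q : ℂ) + 1) (r := r)
      (by simp; linarith) hr
    simp only [Complex.ofReal_neg, neg_neg]
    rw [← h]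
    refine setIntegral_congr_fun measurableSet_Ioi fun s hs => ?_
    simp only [add_sub_cancel_right, Complex.real_smul]
    rw [Complex.ofReal_cpow (le_of_lt hs), neg_mul]
  have heq := hX.eqOn_of_preconnected_of_frequently_eq hY
    (convex_halfSpace_re_lt 0).isPreconnected (z₀ := ((-1 : ℝ) : ℂ)) (by simp) ?_
  · have := heq (x := -ρ) (by simpa using hρ)
    rw [key] at this
    simpa only [neg_neg, neg_mul] using this
  · have hs : Tendsto (fun n : ℕ => ((-(1 + 1 / ((n : ℝ) + 1)) : ℝ) : ℂ)) atTop
        (𝓝[≠] ((-1 : ℝ) : ℂ)) := by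
      refine tendsto_nhdsWithin_of_tendsto_nhds_of_eventually_within _ ?_ ?_
      · refine (Complex.continuous_ofReal.tendsto _).comp ?_
        have := (tendsto_one_div_add_atTop_nhds_zero_nat (𝕜 := ℝ)).const_add 1
        simpa using this.neg
      · refine Eventually.of_forall fun n => ?_
        simp only [mem_compl_iff, mem_singleton_iff, Complex.ofReal_inj]
        have : (0 : ℝ) < 1 / ((n : ℝ) + 1) := by positivity
        linarith
    refine hs.frequently (Frequently.of_forall fun n => ?_)
    exact hreal _ (by positivity)

theorem integrableOn_exp_neg_mul_add_rpow {ν c θ : ℝ} (hν0 : 0 < ν) (hν1 : ν < 1) (hc : 0 < c) :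
    IntegrableOn (fun s : ℝ => Real.exp (-(c * s)) * Real.exp (θ * s ^ ν)) (Ioi 0) := by
  have h1 : Tendsto (fun s : ℝ => θ * s ^ (ν - 1)) atTop (𝓝 0) := by
    have := (tendsto_rpow_neg_atTop (y := 1 - ν) (by linarith)).const_mul θ
    simpa using this
  refine integrable_of_isBigO_exp_neg (b := c / 2) (by positivity) ?_ ?_
  · refine Continuous.continuousOn ?_
    have : Continuous fun s : ℝ => s ^ ν := Real.continuous_rpow_const hν0.le
    fun_prop
  · refine Asymptotics.IsBigO.of_bound 1 ?_
    filter_upwards [h1.eventually_le_const (u := c / 2) (by positivity), eventually_gt_atTop 0]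
      with s hs hs0
    rw [← Real.exp_add, Real.norm_eq_abs, Real.norm_eq_abs, Real.abs_exp, Real.abs_exp, one_mul]
    refine Real.exp_le_exp.2 ?_
    have h2 : s ^ ν = s ^ (ν - 1) * s := by
      rw [← Real.rpow_add_one hs0.ne']; simp
    rw [h2]
    nlinarith

theorem norm_cexp_neg_sub_one_le {z : ℂ} (hz : 0 ≤ z.re) : ‖Complex.exp (-z) - 1‖ ≤ ‖z‖ := by
  have := (convex_halfSpace_re_le 0).norm_image_sub_le_of_norm_hasDerivWithin_le
    (f := Complex.exp) (f' := Complex.exp) (C := 1) (x := 0) (y := -z)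
    (fun x _ => (Complex.hasDerivAt_exp x).hasDerivWithinAt)
    (fun x hx => by
      rw [Complex.norm_exp]
      exact Real.exp_le_one_iff.2 hx) (by simp) (by simpa using hz)
  simpa using this

/-- The integral representation, along a rotated ray, of the entire series defining
`probDensity`. -/
noncomputable def wrightIntegral (ν θ : ℝ) : ℂ :=
  ∫ s in Ioi (0 : ℝ), Complex.exp (-(Real.pi / 4 * (1 + ν)) * Complex.I) *
    Complex.exp (-(Complex.exp (-(Real.pi / 4 * (1 + ν)) * Complex.I) * s)) *
    Complex.exp (-(θ * Complex.exp ((Real.pi - Real.pi / 4 * (1 + ν)) * ν * Complex.I) *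
      (s ^ ν : ℝ)))

variable {ν : ℝ}

theorem re_cexp_rotation (ν : ℝ) :
    (Complex.exp (-(Real.pi / 4 * (1 + ν)) * Complex.I)).re = Real.cos (Real.pi / 4 * (1 + ν)) := by
  have := Complex.exp_ofReal_mul_I_re (-(Real.pi / 4 * (1 + ν)))
  rw [Real.cos_neg] at this
  rw [← this]
  push_cast
  rfl

theorem re_cexp_rotation' (ν : ℝ) :
    (Complex.exp ((Real.pi - Real.pi / 4 * (1 + ν)) * ν * Complex.I)).re =
      Real.cos ((Real.pi - Real.pi / 4 * (1 + ν)) * ν) := by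
  have := Complex.exp_ofReal_mul_I_re ((Real.pi - Real.pi / 4 * (1 + ν)) * ν)
  rw [← this]
  push_cast
  rfl

theorem norm_cexp_rotation (ν : ℝ) :
    ‖Complex.exp (-(Real.pi / 4 * (1 + ν)) * Complex.I)‖ = 1 := by
  have := Complex.norm_exp_ofReal_mul_I (-(Real.pi / 4 * (1 + ν)))
  rw [← this]
  push_cast
  rfl

theorem norm_cexp_rotation' (ν : ℝ) :
    ‖Complex.exp ((Real.pi - Real.pi / 4 * (1 + ν)) * ν * Complex.I)‖ = 1 := by
  have := Complex.norm_exp_ofReal_mul_I ((Real.pi - Real.pi / 4 * (1 + ν)) * ν)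
  rw [← this]
  push_cast
  rfl

theorem cos_rotation_pos (hν0 : 0 < ν) (hν1 : ν < 1) : 0 < Real.cos (Real.pi / 4 * (1 + ν)) := by
  refine Real.cos_pos_of_mem_Ioo ⟨?_, ?_⟩ <;> nlinarith [Real.pi_pos]

theorem cos_rotation_pos' (hν0 : 0 < ν) (hν1 : ν < 1) :
    0 < Real.cos ((Real.pi - Real.pi / 4 * (1 + ν)) * ν) := by
  have h1 : 0 < (1 - ν) * (2 - ν) := mul_pos (by linarith) (by linarith)
  refine Real.cos_pos_of_mem_Ioo ⟨?_, ?_⟩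
  · have : 0 ≤ (Real.pi - Real.pi / 4 * (1 + ν)) * ν := by
      refine mul_nonneg ?_ hν0.le
      nlinarith [Real.pi_pos]
    linarith [Real.pi_pos]
  · have : Real.pi / 2 - (Real.pi - Real.pi / 4 * (1 + ν)) * ν =
        Real.pi / 4 * ((1 - ν) * (2 - ν)) := by ring
    have h2 := mul_pos (by positivity : 0 < Real.pi / 4) h1
    linarith

theorem hasSum_wrightIntegral (hν0 : 0 < ν) (hν1 : ν < 1) {θ : ℝ} (hθ : 0 < θ) :
    HasSum (fun m : ℕ => ((-θ) ^ m / (m.factorial : ℝ) * Real.Gamma (m * ν + 1) : ℝ) •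
      Complex.exp ((m * Real.pi * ν : ℝ) * Complex.I)) (wrightIntegral ν θ) := by
  set ρ : ℂ := Complex.exp (-(Real.pi / 4 * (1 + ν)) * Complex.I) with hρ_def
  set ω : ℂ := Complex.exp ((Real.pi - Real.pi / 4 * (1 + ν)) * ν * Complex.I) with hω_def
  have hρ0 : 0 < ρ.re := by rw [re_cexp_rotation]; exact cos_rotation_pos hν0 hν1
  have hρn : ‖ρ‖ = 1 := norm_cexp_rotation ν
  have hωn : ‖ω‖ = 1 := norm_cexp_rotation' ν
  have hterm : ∀ m : ℕ, ∫ s in Ioi (0 : ℝ), ρ * Complex.exp (-(ρ * s)) *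
      ((-(θ * ω * (s ^ ν : ℝ))) ^ m / (m.factorial : ℂ)) =
      ((-θ) ^ m / (m.factorial : ℝ) * Real.Gamma (m * ν + 1) : ℝ) •
      Complex.exp ((m * Real.pi * ν : ℝ) * Complex.I) := by
    intro m
    have h1 := integral_rpow_mul_cexp_neg_mul_Ioi (q := m * ν) (ρ := ρ)
      (by have : 0 ≤ (m : ℝ) * ν := by positivity
          linarith) hρ0
    have h2 : ∫ s in Ioi (0 : ℝ), ρ * Complex.exp (-(ρ * s)) *
        ((-(θ * ω * (s ^ ν : ℝ))) ^ m / (m.factorial : ℂ)) =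
        (ρ * (-(θ * ω)) ^ m / (m.factorial : ℂ)) *
          ∫ s in Ioi (0 : ℝ), (s ^ (m * ν) : ℝ) • Complex.exp (-(ρ * s)) := by
      rw [← integral_const_mul]
      refine setIntegral_congr_fun measurableSet_Ioi fun s hs => ?_
      have : s ^ ((m : ℝ) * ν) = (s ^ ν) ^ m := by
        rw [mul_comm, Real.rpow_mul (le_of_lt hs), Real.rpow_natCast]
      simp only [Complex.real_smul]
      have h0 : -(θ * ω * (s ^ ν : ℝ)) = -(θ * ω) * ((s ^ ν : ℝ) : ℂ) := by ring
      rw [this, h0, mul_pow]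
      push_cast
      ring
    rw [h2, h1]
    have h3 : (1 / ρ : ℂ) = Complex.exp ((Real.pi / 4 * (1 + ν)) * Complex.I) := by
      rw [hρ_def, one_div, ← Complex.exp_neg]
      congr 1
      ring
    have h4 : (1 / ρ : ℂ) ^ (((m * ν : ℝ) : ℂ) + 1) =
        Complex.exp ((Real.pi / 4 * (1 + ν)) * Complex.I * (((m * ν : ℝ) : ℂ) + 1)) := by
      rw [h3, Complex.cpow_def_of_ne_zero (Complex.exp_ne_zero _), Complex.log_exp]
      · have : ((Real.pi / 4 * (1 + ν) : ℂ) * Complex.I).im = Real.pi / 4 * (1 + ν) := by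
          have h := Complex.re_ofReal_mul (Real.pi / 4 * (1 + ν)) 1
          simp at h
          simp [Complex.mul_im]
        rw [this]; nlinarith [Real.pi_pos]
      · have : ((Real.pi / 4 * (1 + ν) : ℂ) * Complex.I).im = Real.pi / 4 * (1 + ν) := by
          simp [Complex.mul_im]
        rw [this]; nlinarith [Real.pi_pos]
    have h5 : ρ * ω ^ m * Complex.exp ((Real.pi / 4 * (1 + ν)) * Complex.I *
        (((m * ν : ℝ) : ℂ) + 1)) = Complex.exp ((m * Real.pi * ν : ℝ) * Complex.I) := by
      rw [hρ_def, hω_def, ← Complex.exp_nat_mul, ← Complex.exp_add, ← Complex.exp_add]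
      congr 1
      push_cast
      ring
    have h6 : Complex.Gamma (((m * ν : ℝ) : ℂ) + 1) = (Real.Gamma (m * ν + 1) : ℂ) := by
      rw [← Complex.Gamma_ofReal]
      push_cast
      rfl
    have h7 : -((θ : ℂ) * ω) = -(θ : ℂ) * ω := by ring
    rw [h4, h6, ← h5, Complex.real_smul, h7, mul_pow]
    push_cast
    ring
  have hbn : ∀ (m : ℕ) (s : ℝ), 0 < s → ‖ρ * Complex.exp (-(ρ * s)) *
      ((-(θ * ω * (s ^ ν : ℝ))) ^ m / (m.factorial : ℂ))‖ =
      Real.exp (-(ρ.re * s)) * ((θ * s ^ ν) ^ m / (m.factorial : ℝ)) := by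
    intro m s hs
    have h0 : 0 ≤ s ^ ν := Real.rpow_nonneg hs.le _
    rw [norm_mul, norm_mul, hρn, Complex.norm_exp, norm_div, norm_pow, norm_neg, norm_mul,
      norm_mul, hωn, Complex.norm_real, Complex.norm_real, Real.norm_of_nonneg hθ.le,
      Real.norm_of_nonneg h0, Complex.norm_natCast]
    simp
  have hexp : ∀ y : ℝ, HasSum (fun m : ℕ => y ^ m / (m.factorial : ℝ)) (Real.exp y) := by
    intro y
    rw [Real.exp_eq_exp_ℝ]
    exact NormedSpace.expSeries_div_hasSum_exp y
  have hexpc : ∀ y : ℂ, HasSum (fun m : ℕ => y ^ m / (m.factorial : ℂ)) (Complex.exp y) := by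
    intro y
    rw [Complex.exp_eq_exp_ℂ]
    exact NormedSpace.expSeries_div_hasSum_exp y
  have hmain := hasSum_integral_of_dominated_convergence (μ := volume.restrict (Ioi (0 : ℝ)))
    (F := fun (m : ℕ) (s : ℝ) => ρ * Complex.exp (-(ρ * s)) *
      ((-(θ * ω * (s ^ ν : ℝ))) ^ m / (m.factorial : ℂ)))
    (f := fun s => ρ * Complex.exp (-(ρ * s)) * Complex.exp (-(θ * ω * (s ^ ν : ℝ))))
    (fun m s => Real.exp (-(ρ.re * s)) * ((θ * s ^ ν) ^ m / (m.factorial : ℝ)))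
    (fun m => by
      refine Continuous.aestronglyMeasurable ?_
      have : Continuous fun s : ℝ => s ^ ν := Real.continuous_rpow_const hν0.le
      fun_prop)
    (fun m => (ae_restrict_mem measurableSet_Ioi).mono fun s hs => (hbn m s hs).le)
    (ae_of_all _ fun s => ((hexp _).mul_left _).summable)
    (by
      have : (fun s : ℝ => ∑' m : ℕ, Real.exp (-(ρ.re * s)) *
          ((θ * s ^ ν) ^ m / (m.factorial : ℝ))) =
          fun s => Real.exp (-(ρ.re * s)) * Real.exp (θ * s ^ ν) := by
        ext s
        exact ((hexp _).mul_left _).tsum_eq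
      rw [this]
      exact integrableOn_exp_neg_mul_add_rpow hν0 hν1 hρ0)
    (ae_of_all _ fun s => (hexpc _).mul_left _)
  simp only [hterm] at hmain
  exact hmain

theorem probDensity_eq (hν0 : 0 < ν) (hν1 : ν < 1) {θ : ℝ} (hθ : 0 < θ) :
    probDensity ν θ = -((1 / (ν * Real.pi * θ)) * (wrightIntegral ν θ).im) := by
  have h := Complex.hasSum_im (hasSum_wrightIntegral hν0 hν1 hθ)
  have h1 : ∀ m : ℕ, (((-θ) ^ m / (m.factorial : ℝ) * Real.Gamma (m * ν + 1) : ℝ) •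
      Complex.exp ((m * Real.pi * ν : ℝ) * Complex.I)).im =
      (-θ) ^ m / (m.factorial : ℝ) * Real.Gamma (m * ν + 1) * Real.sin (m * Real.pi * ν) := by
    intro m
    rw [Complex.smul_im, Complex.exp_ofReal_mul_I_im, smul_eq_mul]
  simp only [h1] at h
  have h2 := (hasSum_nat_add_iff' 1).2 h
  simp only [Finset.range_one, Finset.sum_singleton, Nat.cast_zero, zero_mul, Real.sin_zero,
    mul_zero, sub_zero] at h2
  have h3 := h2.mul_left (-(θ ^ (1 + 1 / ν) * (1 / θ)))
  rw [probDensity, stableDensity]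
  have h4 : ∀ n : ℕ, (-1 : ℝ) ^ n * (θ ^ (-(1 / ν))) ^ (-(ν * ((n : ℝ) + 1)) - 1) *
      (Real.Gamma (((n : ℝ) + 1) * ν + 1) / ((n + 1).factorial : ℝ)) *
      Real.sin (((n : ℝ) + 1) * Real.pi * ν) =
      -(θ ^ (1 + 1 / ν) * (1 / θ)) * ((-θ) ^ (n + 1) / ((n + 1).factorial : ℝ) *
        Real.Gamma (((n + 1 : ℕ) : ℝ) * ν + 1) * Real.sin (((n + 1 : ℕ) : ℝ) * Real.pi * ν)) := by
    intro n
    have : (θ ^ (-(1 / ν))) ^ (-(ν * ((n : ℝ) + 1)) - 1) = θ ^ (1 + 1 / ν) * θ ^ n := by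
      rw [← Real.rpow_mul hθ.le, ← Real.rpow_natCast θ n, ← Real.rpow_add hθ]
      congr 1
      field_simp
      ring
    rw [this, neg_pow θ, pow_succ, pow_succ]
    push_cast
    field_simp
  simp only [h4]
  rw [h3.tsum_eq]
  have h5 : θ ^ (-1 - 1 / ν) * θ ^ (1 + 1 / ν) = 1 := by
    rw [← Real.rpow_add hθ]; simp
  calc _ = -((θ ^ (-1 - 1 / ν) * θ ^ (1 + 1 / ν)) * (1 / ν * (1 / Real.pi) * (1 / θ)) *
        (wrightIntegral ν θ).im) := by ring
    _ = _ := by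
      rw [h5]
      field_simp

theorem norm_wrightIntegrand (ν θ s : ℝ) :
    ‖Complex.exp (-(Real.pi / 4 * (1 + ν)) * Complex.I) *
    Complex.exp (-(Complex.exp (-(Real.pi / 4 * (1 + ν)) * Complex.I) * s)) *
    Complex.exp (-(θ * Complex.exp ((Real.pi - Real.pi / 4 * (1 + ν)) * ν * Complex.I) *
      (s ^ ν : ℝ)))‖ = Real.exp (-(Real.cos (Real.pi / 4 * (1 + ν)) * s)) *
      Real.exp (-(θ * Real.cos ((Real.pi - Real.pi / 4 * (1 + ν)) * ν)) * s ^ ν) := by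
  rw [norm_mul, norm_mul, norm_cexp_rotation, Complex.norm_exp, Complex.norm_exp, one_mul]
  congr 2
  · rw [Complex.neg_re, Complex.re_mul_ofReal, re_cexp_rotation]
  · rw [Complex.neg_re, Complex.re_mul_ofReal, Complex.re_ofReal_mul, re_cexp_rotation']
    ring

theorem abs_probDensity_le_rpow (hν0 : 0 < ν) (hν1 : ν < 1) :
    ∃ C : ℝ, 0 ≤ C ∧ ∀ θ : ℝ, 0 < θ → |probDensity ν θ| ≤ C * θ ^ (-1 - 1 / ν) := by
  set b := Real.cos ((Real.pi - Real.pi / 4 * (1 + ν)) * ν) with hb_def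
  have hb : 0 < b := cos_rotation_pos' hν0 hν1
  have hG : 0 < Real.Gamma (1 / ν + 1) := Real.Gamma_pos_of_pos (by positivity)
  refine ⟨1 / (ν * Real.pi) * (b ^ (-1 / ν) * Real.Gamma (1 / ν + 1)), by positivity,
    fun θ hθ => ?_⟩
  have h1 : ‖wrightIntegral ν θ‖ ≤ (θ * b) ^ (-1 / ν) * Real.Gamma (1 / ν + 1) := by
    rw [← integral_exp_neg_mul_rpow hν0 (by positivity)]
    refine norm_integral_le_of_norm_le ?_ ?_
    · have := integrableOn_rpow_mul_exp_neg_mul_rpow (s := 0) (p := ν) (b := θ * b)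
        (by norm_num) hν0 (by positivity)
      simpa [IntegrableOn] using this
    · filter_upwards [ae_restrict_mem measurableSet_Ioi] with s hs
      rw [norm_wrightIntegrand]
      have : Real.exp (-(Real.cos (Real.pi / 4 * (1 + ν)) * s)) ≤ 1 :=
        Real.exp_le_one_iff.2 (by
          have := mul_pos (cos_rotation_pos hν0 hν1) hs
          linarith)
      exact mul_le_of_le_one_left (Real.exp_nonneg _) this
  rw [probDensity_eq hν0 hν1 hθ, abs_neg, abs_mul, abs_of_pos (by positivity)]
  calc _ ≤ 1 / (ν * Real.pi * θ) * ((θ * b) ^ (-1 / ν) * Real.Gamma (1 / ν + 1)) := by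
        gcongr
        exact (Complex.abs_im_le_norm _).trans h1
    _ = _ := by
      rw [Real.mul_rpow hθ.le hb.le, Real.rpow_sub hθ, Real.rpow_neg_one, neg_div,
        Real.rpow_neg hθ.le]
      field_simp

theorem abs_probDensity_le (hν0 : 0 < ν) (hν1 : ν < 1) :
    ∃ C : ℝ, 0 ≤ C ∧ ∀ θ : ℝ, 0 < θ → |probDensity ν θ| ≤ C := by
  set a := Real.cos (Real.pi / 4 * (1 + ν)) with ha_def
  have ha : 0 < a := cos_rotation_pos hν0 hν1
  set I := ∫ s in Ioi (0 : ℝ), s ^ ν * Real.exp (-a * s ^ (1 : ℝ)) with hI_def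
  have hI0 : 0 ≤ I := setIntegral_nonneg measurableSet_Ioi fun s hs => by
    have : 0 ≤ s := le_of_lt hs
    positivity
  have hIint : IntegrableOn (fun s : ℝ => s ^ ν * Real.exp (-a * s ^ (1 : ℝ))) (Ioi 0) :=
    integrableOn_rpow_mul_exp_neg_mul_rpow (by linarith) one_pos ha
  refine ⟨1 / (ν * Real.pi) * I, by positivity, fun θ hθ => ?_⟩
  set ρ : ℂ := Complex.exp (-(Real.pi / 4 * (1 + ν)) * Complex.I) with hρ_def
  set ω : ℂ := Complex.exp ((Real.pi - Real.pi / 4 * (1 + ν)) * ν * Complex.I) with hω_def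
  have hρ0 : ρ.re = a := re_cexp_rotation ν
  have hρ : ρ ≠ 0 := Complex.exp_ne_zero _
  have hone : ∫ s in Ioi (0 : ℝ), ρ * Complex.exp (-(ρ * s)) = 1 := by
    have := integral_rpow_mul_cexp_neg_mul_Ioi (q := 0) (ρ := ρ) (by norm_num) (hρ0 ▸ ha)
    simp only [Real.rpow_zero, one_smul, Complex.ofReal_zero, zero_add, Complex.cpow_one,
      Complex.Gamma_one, mul_one] at this
    rw [integral_const_mul, this]
    field_simp
  have hi1 : IntegrableOn (fun s : ℝ => ρ * Complex.exp (-(ρ * s))) (Ioi 0) := by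
    by_contra h
    rw [integral_undef h] at hone
    exact zero_ne_one hone
  have hcont : Continuous fun s : ℝ => s ^ ν := Real.continuous_rpow_const hν0.le
  have hi2 : IntegrableOn (fun s : ℝ => ρ * Complex.exp (-(ρ * s)) *
      Complex.exp (-(θ * ω * (s ^ ν : ℝ)))) (Ioi 0) := by
    refine hi1.norm.mono' (Continuous.aestronglyMeasurable (by fun_prop)) ?_
    filter_upwards [ae_restrict_mem measurableSet_Ioi] with s hs
    rw [norm_mul]
    refine mul_le_of_le_one_right (norm_nonneg _) ?_
    rw [Complex.norm_exp, Complex.neg_re, Complex.re_mul_ofReal, Complex.re_ofReal_mul,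
      re_cexp_rotation']
    have h1 := cos_rotation_pos' hν0 hν1
    have h2 : 0 < s ^ ν := Real.rpow_pos_of_pos hs _
    exact Real.exp_le_one_iff.2 (by
      have := mul_pos (mul_pos hθ h1) h2
      linarith)
  have h1 : ‖wrightIntegral ν θ - 1‖ ≤ θ * I := by
    rw [← hone, wrightIntegral, ← integral_sub hi2 hi1, hI_def, ← integral_const_mul]
    refine norm_integral_le_of_norm_le (hIint.const_mul θ) ?_
    filter_upwards [ae_restrict_mem measurableSet_Ioi] with s hs
    have h2 : 0 < s ^ ν := Real.rpow_pos_of_pos hs _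
    rw [← mul_sub_one, norm_mul, norm_mul, norm_cexp_rotation, Complex.norm_exp, one_mul,
      Complex.neg_re, Complex.re_mul_ofReal, hρ0]
    have h3 := norm_cexp_neg_sub_one_le (z := θ * ω * (s ^ ν : ℝ)) (by
      rw [Complex.re_mul_ofReal, Complex.re_ofReal_mul, re_cexp_rotation']
      have h1 := cos_rotation_pos' hν0 hν1
      positivity)
    rw [norm_mul (_ * _), norm_mul, norm_cexp_rotation', Complex.norm_real, Complex.norm_real,
      Real.norm_of_nonneg hθ.le, Real.norm_of_nonneg h2.le, mul_one] at h3
    rw [Real.rpow_one, neg_mul]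
    calc _ ≤ Real.exp (-(a * s)) * (θ * s ^ ν) := by gcongr
      _ = _ := by ring
  have h2 : |(wrightIntegral ν θ).im| ≤ θ * I := by
    have h3 : (wrightIntegral ν θ).im = (wrightIntegral ν θ - 1).im := by simp
    rw [h3]
    exact (Complex.abs_im_le_norm _).trans h1
  rw [probDensity_eq hν0 hν1 hθ, abs_neg, abs_mul, abs_of_pos (by positivity)]
  calc _ ≤ 1 / (ν * Real.pi * θ) * (θ * I) := by gcongr
    _ = _ := by field_simp

theorem aestronglyMeasurable_probDensity (hν0 : 0 < ν) (hν1 : ν < 1) :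
    AEStronglyMeasurable (probDensity ν) (volume.restrict (Ioi 0)) := by
  have h : StronglyMeasurable (wrightIntegral ν) := by
    refine StronglyMeasurable.integral_prod_right (ν := volume.restrict (Ioi (0 : ℝ)))
      (f := fun θ s : ℝ => _) ?_
    refine Measurable.stronglyMeasurable ?_
    have : Measurable fun s : ℝ => s ^ ν := by fun_prop
    unfold Function.uncurry
    fun_prop
  have h2 : Measurable fun θ : ℝ => -((1 / (ν * Real.pi * θ)) * (wrightIntegral ν θ).im) := by
    have := h.measurable
    fun_prop
  refine h2.aestronglyMeasurable.congr ?_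
  filter_upwards [ae_restrict_mem measurableSet_Ioi] with θ hθ
  exact (probDensity_eq hν0 hν1 hθ).symm

end StableDensity

section Semigroup

variable {X : Type*} [NormedAddCommGroup X] [NormedSpace ℝ X]

namespace C0Semigroup

variable (S : C0Semigroup X) {M : ℝ}

theorem mem_generatorGraph_iff {x y : X} :
    (x, y) ∈ S.generatorGraph ↔
      Tendsto (fun t : ℝ => t⁻¹ • (S.toFun t x - x)) (𝓝[>] 0) (𝓝 y) := Iff.rfl

theorem mem_generatorGraph_iff_exists {x y : X} :
    (x, y) ∈ S.generatorGraph ↔ ∃ hx : x ∈ S.generator.domain, S.generator ⟨x, hx⟩ = y := by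
  rw [← S.generator_graph, LinearPMap.mem_graph_iff]
  constructor
  · rintro ⟨⟨z, hz⟩, rfl, h2⟩
    exact ⟨hz, h2⟩
  · rintro ⟨hx, h⟩
    exact ⟨⟨x, hx⟩, rfl, h⟩

theorem mem_domain_of_mem_graph {x y : X} (h : (x, y) ∈ S.generatorGraph) :
    x ∈ S.generator.domain := (S.mem_generatorGraph_iff_exists.1 h).1

theorem unboundedApply_of_mem_graph {x y : X} (h : (x, y) ∈ S.generatorGraph) :
    unboundedApply S.generator x = y := by
  obtain ⟨hx, h⟩ := S.mem_generatorGraph_iff_exists.1 h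
  rw [unboundedApply, dif_pos hx, h]

theorem mem_graph_unboundedApply {x : X} (h : x ∈ S.generator.domain) :
    (x, unboundedApply S.generator x) ∈ S.generatorGraph := by
  rw [unboundedApply, dif_pos h]
  exact S.mem_generatorGraph_iff_exists.2 ⟨h, rfl⟩

theorem continuousOn_orbit (hM : ∀ t : ℝ, 0 ≤ t → ‖S.toFun t‖ ≤ M) (x : X) :
    ContinuousOn (fun t => S.toFun t x) (Ici 0) := by
  have hM0 : 0 ≤ M := (norm_nonneg _).trans (hM 0 le_rfl)
  have key : ∀ s t : ℝ, 0 ≤ s → s ≤ t →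
      ‖S.toFun t x - S.toFun s x‖ ≤ M * ‖S.toFun (t - s) x - x‖ := by
    intro s t hs hst
    have h : S.toFun t x = S.toFun s (S.toFun (t - s) x) := by
      rw [← ContinuousLinearMap.comp_apply, ← S.add_time s (t - s) hs (by linarith)]
      congr 2
      ring
    rw [h, ← map_sub]
    exact (S.toFun s).le_of_opNorm_le (hM s hs) _
  have hgen : ∀ s t : ℝ, 0 ≤ s → 0 ≤ t →
      ‖S.toFun t x - S.toFun s x‖ ≤ M * ‖S.toFun |t - s| x - x‖ := by
    intro s t hs ht
    rcases le_total s t with h | h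
    · rw [abs_of_nonneg (by linarith)]
      exact key s t hs h
    · rw [abs_of_nonpos (by linarith), norm_sub_rev, neg_sub]
      exact key t s ht h
  have hlim : Tendsto (fun r => S.toFun r x) (𝓝[≥] 0) (𝓝 x) := by
    have h0 : S.toFun 0 x = x := by rw [S.at_zero]; rfl
    have h1 : ContinuousWithinAt (fun r => S.toFun r x) (Ioi 0) 0 := by
      have := S.strongly_continuous x
      unfold ContinuousWithinAt
      simpa only [h0] using this
    have h2 := continuousWithinAt_Ioi_iff_Ici.1 h1
    unfold ContinuousWithinAt at h2
    simpa only [h0] using h2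
  intro s hs
  rw [ContinuousWithinAt, tendsto_iff_norm_sub_tendsto_zero]
  have habs : Tendsto (fun t : ℝ => |t - s|) (𝓝[Ici 0] s) (𝓝[≥] 0) := by
    refine tendsto_nhdsWithin_of_tendsto_nhds_of_eventually_within _ ?_
      (Eventually.of_forall fun t => mem_Ici.2 (abs_nonneg _))
    have : Continuous fun t : ℝ => |t - s| := by fun_prop
    have h := this.tendsto s
    simp only [sub_self, abs_zero] at h
    exact h.mono_left nhdsWithin_le_nhds
  have h3 := (((hlim.comp habs).sub_const x).norm.const_mul M)
  simp only [sub_self, norm_zero, mul_zero] at h3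
  refine squeeze_zero' (Eventually.of_forall fun _ => norm_nonneg _) ?_ h3
  filter_upwards [self_mem_nhdsWithin] with t ht
  exact hgen s t hs ht

theorem graph_apply {x y : X} (h : (x, y) ∈ S.generatorGraph) {t : ℝ} (ht : 0 ≤ t) :
    (S.toFun t x, S.toFun t y) ∈ S.generatorGraph := by
  have h1 := ((S.toFun t).continuous.tendsto y).comp (S.mem_generatorGraph_iff.1 h)
  refine S.mem_generatorGraph_iff.2 (h1.congr' ?_)
  filter_upwards [self_mem_nhdsWithin] with r hr
  have hr' : (0 : ℝ) ≤ r := le_of_lt hr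
  have hc : S.toFun t (S.toFun r x) = S.toFun r (S.toFun t x) := by
    rw [← ContinuousLinearMap.comp_apply, ← ContinuousLinearMap.comp_apply,
      ← S.add_time t r ht hr', ← S.add_time r t hr' ht, add_comm]
  simp only [Function.comp, map_smul, map_sub, hc]

theorem hasDerivWithinAt_orbit {x y : X} {t : ℝ} (ht : 0 ≤ t)
    (h : (S.toFun t x, y) ∈ S.generatorGraph) :
    HasDerivWithinAt (fun s => S.toFun s x) y (Ici t) t := by
  rw [← hasDerivWithinAt_Ioi_iff_Ici, hasDerivWithinAt_iff_tendsto_slope' (by simp)]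
  have h1 : Tendsto (fun s : ℝ => s - t) (𝓝[>] t) (𝓝[>] 0) := by
    refine tendsto_nhdsWithin_of_tendsto_nhds_of_eventually_within _ ?_ ?_
    · have : Continuous fun s : ℝ => s - t := by fun_prop
      have h := this.tendsto t
      simp only [sub_self] at h
      exact h.mono_left nhdsWithin_le_nhds
    · filter_upwards [self_mem_nhdsWithin] with s hs
      simpa using hs
  refine ((S.mem_generatorGraph_iff.1 h).comp h1).congr' ?_
  filter_upwards [self_mem_nhdsWithin] with s hs
  have hs' : t < s := hs
  simp only [Function.comp, slope, vsub_eq_sub]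
  congr 2
  rw [← ContinuousLinearMap.comp_apply, ← S.add_time _ _ (by linarith) ht]
  congr 2
  ring

variable {S}

theorem _root_.isResolventAt_generator_graph {c : ℝ} {R : X →L[ℝ] X}
    (hR : IsResolventAt S.generator c R) {x y : X} :
    (x, y) ∈ S.generatorGraph ↔ x = R (c • x - y) := by
  constructor
  · intro h
    obtain ⟨hx, rfl⟩ := S.mem_generatorGraph_iff_exists.1 h
    exact (hR.2 ⟨x, hx⟩).symm
  · intro h
    obtain ⟨hx, h2⟩ := hR.1 (c • x - y)
    rw [S.mem_generatorGraph_iff_exists]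
    have hx' : x ∈ S.generator.domain := by rw [h]; exact hx
    refine ⟨hx', ?_⟩
    have h3 : S.generator ⟨x, hx'⟩ = S.generator ⟨R (c • x - y), hx⟩ := by
      congr 1
      exact Subtype.ext h
    rw [h3]
    have h4 : c • R (c • x - y) = c • x := by rw [← h]
    rw [h4] at h2
    exact sub_right_injective h2

theorem _root_.IsResolventAt.graph_mem {c : ℝ} {R : X →L[ℝ] X}
    (hR : IsResolventAt S.generator c R) (z : X) : (R z, c • R z - z) ∈ S.generatorGraph := by
  rw [isResolventAt_generator_graph hR]
  simp

theorem _root_.IsResolventAt.norm_le (hM : ∀ t : ℝ, 0 ≤ t → ‖S.toFun t‖ ≤ M) {c : ℝ} (hc : 0 < c)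
    {R : X →L[ℝ] X} (hR : IsResolventAt S.generator c R) : ‖R‖ ≤ M / c := by
  have hM0 : 0 ≤ M := (norm_nonneg _).trans (hM 0 le_rfl)
  refine ContinuousLinearMap.opNorm_le_bound _ (by positivity) fun z => ?_
  have h0 : S.toFun 0 (R z) = R z := by rw [S.at_zero]; rfl
  have key : ∀ t : ℝ, 0 ≤ t → ‖Real.exp (-(c * t)) • S.toFun t (R z) - R z‖ ≤
      M / c * ‖z‖ * (1 - Real.exp (-(c * t))) := by
    intro t ht
    have hexp : ∀ s : ℝ, HasDerivAt (fun s => Real.exp (-(c * s))) (-c * Real.exp (-(c * s))) s := by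
      intro s
      have := ((hasDerivAt_id s).const_mul c).neg.exp
      simpa [mul_comm] using this
    refine image_norm_le_of_norm_deriv_right_le_deriv_boundary (a := 0) (b := t)
      (f := fun s => Real.exp (-(c * s)) • S.toFun s (R z) - R z)
      (f' := fun s => Real.exp (-(c * s)) • S.toFun s (c • R z - z) +
        (-c * Real.exp (-(c * s))) • S.toFun s (R z))
      (B := fun s => M / c * ‖z‖ * (1 - Real.exp (-(c * s))))
      (B' := fun s => M * ‖z‖ * Real.exp (-(c * s))) ?_ ?_ ?_ ?_ ?_ ⟨ht, le_rfl⟩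
    · refine ContinuousOn.sub (ContinuousOn.smul (Continuous.continuousOn (by fun_prop)) ?_)
        continuousOn_const
      exact (S.continuousOn_orbit hM (R z)).mono Icc_subset_Ici_self
    · intro s hs
      have h1 := S.hasDerivWithinAt_orbit hs.1 (S.graph_apply (hR.graph_mem z) hs.1)
      exact ((hexp s).hasDerivWithinAt.smul h1).sub_const _
    · simp [h0]
    · intro s
      refine (((hexp s).const_sub 1).const_mul (M / c * ‖z‖)).congr_deriv ?_
      field_simp
    · intro s hs
      have : Real.exp (-(c * s)) • S.toFun s (c • R z - z) +
        (-c * Real.exp (-(c * s))) • S.toFun s (R z) = -(Real.exp (-(c * s)) • S.toFun s z) := by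
        rw [map_sub, map_smul, smul_sub, smul_smul, neg_mul, neg_smul,
          mul_comm c]
        module
      rw [this, norm_neg, norm_smul, Real.norm_of_nonneg (Real.exp_nonneg _), mul_comm]
      gcongr
      exact (S.toFun s).le_of_opNorm_le (hM s hs.1) _
  have hexp0 : Tendsto (fun t : ℝ => Real.exp (-(c * t))) atTop (𝓝 0) :=
    Real.tendsto_exp_neg_atTop_nhds_zero.comp (tendsto_id.const_mul_atTop hc)
  have hl : Tendsto (fun t : ℝ => ‖Real.exp (-(c * t)) • S.toFun t (R z) - R z‖) atTop
      (𝓝 ‖(0 : X) - R z‖) := by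
    refine (Tendsto.sub_const ?_ _).norm
    refine squeeze_zero_norm' (a := fun t => Real.exp (-(c * t)) * (M * ‖R z‖)) ?_ ?_
    · filter_upwards [eventually_ge_atTop 0] with t ht
      rw [norm_smul, Real.norm_of_nonneg (Real.exp_nonneg _)]
      gcongr
      exact (S.toFun t).le_of_opNorm_le (hM t ht) _
    · simpa using hexp0.mul_const (M * ‖R z‖)
  have hr : Tendsto (fun t : ℝ => M / c * ‖z‖ * (1 - Real.exp (-(c * t)))) atTop
      (𝓝 (M / c * ‖z‖ * (1 - 0))) := (hexp0.const_sub 1).const_mul _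
  have := le_of_tendsto_of_tendsto hl hr
    ((eventually_ge_atTop 0).mono fun t ht => key t ht)
  simpa using this

theorem _root_.IsResolventAt.sub_eq {c d : ℝ} {R Q : X →L[ℝ] X}
    (hR : IsResolventAt S.generator c R) (hQ : IsResolventAt S.generator d Q) (z : X) :
    R z - Q z = (d - c) • R (Q z) := by
  have h := (isResolventAt_generator_graph hR).1 (hQ.graph_mem z)
  have h2 : R (c • Q z - (d • Q z - z)) = (c - d) • R (Q z) + R z := by
    rw [map_sub, map_sub, map_smul, map_smul]
    module
  rw [h2] at h
  nth_rewrite 1 [h]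
  rw [sub_smul, sub_smul]
  abel

theorem _root_.IsResolventAt.norm_le' (hM : ∀ t : ℝ, 0 ≤ t → ‖S.toFun t‖ ≤ M) {c : ℝ} (hc : 0 ≤ c)
    {R Q : X →L[ℝ] X} (hR : IsResolventAt S.generator c R)
    (hQ : IsResolventAt S.generator 0 Q) : ‖R‖ ≤ ‖Q‖ * (1 + M) := by
  have hM0 : 0 ≤ M := (norm_nonneg _).trans (hM 0 le_rfl)
  refine ContinuousLinearMap.opNorm_le_bound _ (by positivity) fun z => ?_
  have h1 := hQ.sub_eq hR z
  rw [sub_zero] at h1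
  have h2 : R z = Q z - c • Q (R z) := by rw [← h1]; abel
  have h3 : ‖c • R z‖ ≤ M * ‖z‖ := by
    rcases hc.eq_or_lt with rfl | hc
    · simp; positivity
    · rw [norm_smul, Real.norm_of_nonneg hc.le]
      have := R.le_of_opNorm_le (hR.norm_le hM hc) z
      calc c * ‖R z‖ ≤ c * (M / c * ‖z‖) := by gcongr
        _ = M * ‖z‖ := by field_simp
  have h4 : R z = Q (z - c • R z) := by rw [map_sub, map_smul]; exact h2
  rw [h4]
  calc ‖Q (z - c • R z)‖ ≤ ‖Q‖ * (‖z‖ + M * ‖z‖) := by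
        refine (Q.le_opNorm _).trans ?_
        gcongr
        exact (norm_sub_le _ _).trans (by gcongr)
    _ = _ := by ring

theorem _root_.IsResolventAt.exists_near [CompleteSpace X] {A : X →ₗ.[ℝ] X} {c d : ℝ}
    {R : X →L[ℝ] X} (hR : IsResolventAt A c R) (h : |d - c| * ‖R‖ < 1) :
    InResolventSet A d := by
  have hu : IsUnit (1 - (c - d) • R) := by
    refine isUnit_one_sub_of_norm_lt_one ?_
    rwa [norm_smul, Real.norm_eq_abs, abs_sub_comm]
  obtain ⟨V, hV⟩ := hu
  have h1 : ∀ x, (V⁻¹ : (X →L[ℝ] X)ˣ).1 x - (c - d) • R ((V⁻¹ : (X →L[ℝ] X)ˣ).1 x) = x := by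
    intro x
    have := congrArg (fun f : X →L[ℝ] X => f x) V.mul_inv
    simpa [hV] using this
  have h2 : ∀ x, (V⁻¹ : (X →L[ℝ] X)ˣ).1 (x - (c - d) • R x) = x := by
    intro x
    have := congrArg (fun f : X →L[ℝ] X => f x) V.inv_mul
    simpa [hV] using this
  refine ⟨R.comp (V⁻¹ : (X →L[ℝ] X)ˣ).1, fun x => ?_, fun x => ?_⟩
  · set y := (V⁻¹ : (X →L[ℝ] X)ˣ).1 x with hy
    obtain ⟨hx, h3⟩ := hR.1 y
    refine ⟨hx, ?_⟩
    change d • R y - A ⟨R y, hx⟩ = x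
    have h4 : x = y - (c - d) • R y := (h1 x).symm
    have h5 : A ⟨R y, hx⟩ = c • R y - y := by
      exact eq_sub_of_add_eq' (sub_eq_iff_eq_add.1 h3).symm
    rw [h5, h4]
    module
  · have h3 := hR.2 x
    have h4 : d • (x : X) - A x = (c • (x : X) - A x) - (c - d) • R (c • (x : X) - A x) := by
      rw [h3, sub_smul]; abel
    rw [ContinuousLinearMap.comp_apply, h4, h2, h3]

theorem _root_.resolventOp_spec {A : X →ₗ.[ℝ] X} {c : ℝ} (h : InResolventSet A c) :
    IsResolventAt A c (resolventOp A c) := by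
  rw [resolventOp, dif_pos h]
  exact h.choose_spec

theorem inResolventSet_of_nonneg [CompleteSpace X] (hM : ∀ t : ℝ, 0 ≤ t → ‖S.toFun t‖ ≤ M)
    (h0 : InResolventSet S.generator 0) {c : ℝ} (hc : 0 ≤ c) : InResolventSet S.generator c := by
  have hM0 : 0 ≤ M := (norm_nonneg _).trans (hM 0 le_rfl)
  obtain ⟨Q, hQ⟩ := h0
  set δ := 1 / (2 * (‖Q‖ * (1 + M) + 1)) with hδ
  have hδ0 : 0 < δ := by positivity
  have key : ∀ n : ℕ, ∀ d : ℝ, 0 ≤ d → d ≤ n * δ → InResolventSet S.generator d := by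
    intro n
    induction n with
    | zero =>
      intro d hd hd'
      have : d = 0 := le_antisymm (by simpa using hd') hd
      exact this ▸ ⟨Q, hQ⟩
    | succ n ih =>
      intro d hd hd'
      have hm : 0 ≤ min d (n * δ) := le_min hd (by positivity)
      obtain ⟨R, hR⟩ := ih (min d (n * δ)) hm (min_le_right _ _)
      refine hR.exists_near ?_
      have h1 : |d - min d (n * δ)| ≤ δ := by
        rw [abs_of_nonneg (sub_nonneg.2 (min_le_left _ _))]
        push_cast at hd'
        rcases le_total d (n * δ) with h | h
        · rw [min_eq_left h]; linarith
        · rw [min_eq_right h]; linarith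
      calc _ ≤ δ * (‖Q‖ * (1 + M)) := by
            gcongr
            exact hR.norm_le' hM hm hQ
        _ < 1 := by
            rw [hδ, one_div_mul_eq_div, div_lt_one (by positivity)]
            have : 0 ≤ ‖Q‖ * (1 + M) := by positivity
            linarith
  obtain ⟨n, hn⟩ := exists_nat_ge (c / δ)
  exact key n c hc ((div_le_iff₀ hδ0).1 hn)

/-- The resolvents of the generator of a bounded semigroup on the half-line. -/
theorem exists_resolvent_bound [CompleteSpace X] (hM : ∀ t : ℝ, 0 ≤ t → ‖S.toFun t‖ ≤ M)
    (h0 : InResolventSet S.generator 0) :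
    ∃ N : ℝ, 0 ≤ N ∧ ∀ c : ℝ, 0 ≤ c → ‖resolventOp S.generator c‖ ≤ N := by
  have hM0 : 0 ≤ M := (norm_nonneg _).trans (hM 0 le_rfl)
  refine ⟨‖resolventOp S.generator 0‖ * (1 + M), by positivity, fun c hc => ?_⟩
  exact (resolventOp_spec (inResolventSet_of_nonneg hM h0 hc)).norm_le' hM hc (resolventOp_spec h0)

theorem continuousOn_resolventOp [CompleteSpace X] (hM : ∀ t : ℝ, 0 ≤ t → ‖S.toFun t‖ ≤ M)
    (h0 : InResolventSet S.generator 0) :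
    ContinuousOn (resolventOp S.generator) (Ici 0) := by
  obtain ⟨N, hN0, hN⟩ := exists_resolvent_bound hM h0
  have : LipschitzOnWith (Real.toNNReal (N * N)) (resolventOp S.generator) (Ici 0) := by
    refine LipschitzOnWith.of_dist_le_mul fun c hc d hd => ?_
    rw [dist_eq_norm, dist_eq_norm, Real.coe_toNNReal _ (by positivity)]
    refine ContinuousLinearMap.opNorm_le_bound _ (by positivity) fun z => ?_
    rw [sub_apply,
      (resolventOp_spec (inResolventSet_of_nonneg hM h0 hc)).sub_eq
        (resolventOp_spec (inResolventSet_of_nonneg hM h0 hd)), norm_smul, norm_sub_rev, mul_comm]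
    have h1 := (resolventOp S.generator c).le_of_opNorm_le (hN c hc) (resolventOp S.generator d z)
    have h2 := (resolventOp S.generator d).le_of_opNorm_le (hN d hd) z
    calc _ ≤ (N * (N * ‖z‖)) * ‖c - d‖ := by
          gcongr
          exact h1.trans (by gcongr)
      _ = _ := by ring
  exact this.continuousOn

end C0Semigroup

end Semigroup

section FractionalPowers

theorem integrableOn_rpow_neg_mul_min {σ a b r : ℝ} (h0 : 0 < σ) (h1 : σ < 1) (ha : 0 ≤ a)
    (hb : 0 ≤ b) (hr : 0 < r) :
    IntegrableOn (fun c : ℝ => c ^ (-σ) * min a (b / c)) (Ioi 0) ∧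
      ∫ c in Ioi (0 : ℝ), c ^ (-σ) * min a (b / c) ≤
        a * (r ^ (1 - σ) / (1 - σ)) + b * (r ^ (-σ) / σ) := by
  have hmeas : Measurable fun c : ℝ => c ^ (-σ) * min a (b / c) := by fun_prop
  have hi1 : IntegrableOn (fun c : ℝ => a * c ^ (-σ)) (Ioc 0 r) := by
    have := (intervalIntegral.intervalIntegrable_rpow' (a := 0) (b := r) (r := -σ)
      (by linarith)).const_mul a
    rwa [intervalIntegrable_iff_integrableOn_Ioc_of_le hr.le] at this
  have hi2 : IntegrableOn (fun c : ℝ => b * c ^ (-σ - 1)) (Ioi r) :=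
    (integrableOn_Ioi_rpow_of_lt (by linarith) hr).const_mul b
  have hnn : ∀ c : ℝ, 0 < c → 0 ≤ c ^ (-σ) * min a (b / c) := fun c hc =>
    mul_nonneg (Real.rpow_nonneg hc.le _) (le_min ha (by positivity))
  have hle1 : ∀ c ∈ Ioc (0 : ℝ) r, c ^ (-σ) * min a (b / c) ≤ a * c ^ (-σ) := by
    intro c hc
    rw [mul_comm]
    gcongr
    · exact Real.rpow_nonneg hc.1.le _
    · exact min_le_left _ _
  have hle2 : ∀ c ∈ Ioi r, c ^ (-σ) * min a (b / c) ≤ b * c ^ (-σ - 1) := by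
    intro c hc
    have hc0 : 0 < c := hr.trans hc
    calc c ^ (-σ) * min a (b / c) ≤ c ^ (-σ) * (b / c) := by
          gcongr
          exact min_le_right _ _
      _ = b * c ^ (-σ - 1) := by
          rw [Real.rpow_sub hc0, Real.rpow_one]
          ring
  have hj1 : IntegrableOn (fun c : ℝ => c ^ (-σ) * min a (b / c)) (Ioc 0 r) := by
    refine hi1.mono' hmeas.aestronglyMeasurable ?_
    filter_upwards [ae_restrict_mem measurableSet_Ioc] with c hc
    rw [Real.norm_of_nonneg (hnn c hc.1)]
    exact hle1 c hc
  have hj2 : IntegrableOn (fun c : ℝ => c ^ (-σ) * min a (b / c)) (Ioi r) := by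
    refine hi2.mono' hmeas.aestronglyMeasurable ?_
    filter_upwards [ae_restrict_mem measurableSet_Ioi] with c hc
    rw [Real.norm_of_nonneg (hnn c (hr.trans hc))]
    exact hle2 c hc
  have hU : Ioi (0 : ℝ) = Ioc 0 r ∪ Ioi r := (Ioc_union_Ioi_eq_Ioi hr.le).symm
  rw [hU]
  refine ⟨hj1.union hj2, ?_⟩
  rw [setIntegral_union (Ioc_disjoint_Ioi le_rfl) measurableSet_Ioi hj1 hj2]
  refine add_le_add ?_ ?_
  · calc _ ≤ ∫ c in Ioc 0 r, a * c ^ (-σ) := setIntegral_mono_on hj1 hi1 measurableSet_Ioc hle1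
      _ = _ := by
        rw [integral_const_mul, ← intervalIntegral.integral_of_le hr.le,
          integral_rpow (Or.inl (by linarith)), Real.zero_rpow (by linarith), sub_zero,
          neg_add_eq_sub]
  · calc _ ≤ ∫ c in Ioi r, b * c ^ (-σ - 1) := setIntegral_mono_on hj2 hi2 measurableSet_Ioi hle2
      _ = _ := by
        rw [integral_const_mul, integral_Ioi_rpow_of_lt (by linarith) hr]
        congr 1
        rw [sub_add_cancel, div_neg, neg_div, neg_neg]

variable {X : Type*} [NormedAddCommGroup X] [NormedSpace ℝ X]
  {S : C0Semigroup X} {M : ℝ}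

namespace C0Semigroup

theorem graph_unique {x y z : X} (h : (x, y) ∈ S.generatorGraph) (h' : (x, z) ∈ S.generatorGraph) :
    y = z :=
  tendsto_nhds_unique (S.mem_generatorGraph_iff.1 h) (S.mem_generatorGraph_iff.1 h')

theorem integral_mem_graph [CompleteSpace X] {α : Type*} [MeasurableSpace α] {μ : Measure α}
    (h0 : InResolventSet S.generator 0) {f g : α → X} (hg : Integrable g μ)
    (h : ∀ᵐ a ∂μ, (f a, g a) ∈ S.generatorGraph) :
    (∫ a, f a ∂μ, ∫ a, g a ∂μ) ∈ S.generatorGraph := by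
  have hR := resolventOp_spec h0
  have h1 : ∀ᵐ a ∂μ, f a = -resolventOp S.generator 0 (g a) := by
    filter_upwards [h] with a ha
    have := (isResolventAt_generator_graph hR).1 ha
    rw [zero_smul, zero_sub, map_neg] at this
    exact this
  rw [isResolventAt_generator_graph hR, zero_smul, zero_sub, map_neg, integral_congr_ae h1,
    integral_neg, ContinuousLinearMap.integral_comp_comm _ hg]

variable [CompleteSpace X] (hM : ∀ t : ℝ, 0 ≤ t → ‖S.toFun t‖ ≤ M)
  (h0 : InResolventSet S.generator 0)

include hM h0

theorem norm_resolventOp_le {c : ℝ} (hc : 0 < c) : ‖resolventOp S.generator c‖ ≤ M / c :=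
  (resolventOp_spec (inResolventSet_of_nonneg hM h0 hc.le)).norm_le hM hc

theorem aestronglyMeasurable_rpow_smul_resolventOp (σ : ℝ) :
    AEStronglyMeasurable (fun c : ℝ => c ^ (-σ) • resolventOp S.generator c)
      (volume.restrict (Ioi 0)) := by
  refine ContinuousOn.aestronglyMeasurable ?_ measurableSet_Ioi
  refine ContinuousOn.smul (f := fun c : ℝ => c ^ (-σ)) (fun c hc => ?_)
    ((continuousOn_resolventOp hM h0).mono Ioi_subset_Ici_self)
  exact (Real.continuousAt_rpow_const c _ (Or.inl (ne_of_gt hc))).continuousWithinAt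

theorem integrableOn_rpow_smul_resolventOp {σ : ℝ} (hσ : 0 < σ) (hσ' : σ < 1) :
    IntegrableOn (fun c : ℝ => c ^ (-σ) • resolventOp S.generator c) (Ioi 0) := by
  have hM0 : 0 ≤ M := (norm_nonneg _).trans (hM 0 le_rfl)
  obtain ⟨N, hN0, hN⟩ := exists_resolvent_bound hM h0
  refine (integrableOn_rpow_neg_mul_min hσ hσ' hN0 hM0 one_pos).1.mono'
    (aestronglyMeasurable_rpow_smul_resolventOp hM h0 σ) ?_
  filter_upwards [ae_restrict_mem measurableSet_Ioi] with c hc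
  have hc0 : 0 < c := hc
  rw [norm_smul, Real.norm_of_nonneg (Real.rpow_nonneg hc0.le _)]
  gcongr
  exact le_min (hN c hc0.le) (norm_resolventOp_le hM h0 hc0)

theorem integrableOn_rpow_smul_resolventOp_apply {σ : ℝ} (hσ : 0 < σ) (hσ' : σ < 1) (w : X) :
    IntegrableOn (fun c : ℝ => c ^ (-σ) • resolventOp S.generator c w) (Ioi 0) :=
  (ContinuousLinearMap.apply ℝ X w).integrable_comp
    (integrableOn_rpow_smul_resolventOp hM h0 hσ hσ')

theorem fracPowNeg_apply {σ : ℝ} (hσ : 0 < σ) (hσ' : σ < 1) (w : X) :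
    fracPowNeg S.generator σ w = (Real.sin (Real.pi * σ) / Real.pi) •
      ∫ c in Ioi (0 : ℝ), c ^ (-σ) • resolventOp S.generator c w := by
  rw [fracPowNeg, smul_apply,
    ContinuousLinearMap.integral_apply (integrableOn_rpow_smul_resolventOp hM h0 hσ hσ')]
  rfl

omit [CompleteSpace X] hM h0 in
/-- A kernel dominating the resolvents gives integrability of the iterated Balakrishnan
integrand. -/
theorem integrable_rpow_smul_resolvent_prod {N : ℝ} (hN0 : 0 ≤ N) (hM0 : 0 ≤ M)
    {R : ℝ → X →L[ℝ] X} (hRc : ContinuousOn R (Ioi 0)) (hN : ∀ c : ℝ, 0 < c → ‖R c‖ ≤ N)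
    (hRM : ∀ c : ℝ, 0 < c → ‖R c‖ ≤ M / c) {σ : ℝ} (hσ : 0 < σ) (hσ' : σ < 1) (w : X) :
    Integrable (fun p : ℝ × ℝ => p.2 ^ (-σ) • R p.1 (R (p.1 * p.2) w))
      ((volume.restrict (Ioi (0 : ℝ))).prod (volume.restrict (Ioi (0 : ℝ)))) := by
  set m : ℝ → ℝ := fun c => min N (M / c) with hm
  have hRm : ∀ c : ℝ, 0 < c → ‖R c‖ ≤ m c := fun c hc => le_min (hN c hc) (hRM c hc)
  have hm0 : ∀ c : ℝ, 0 < c → 0 ≤ m c := fun c hc => (norm_nonneg _).trans (hRm c hc)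
  have hK := integrableOn_rpow_neg_mul_min hσ hσ' hN0 hM0 one_pos
  set K := ∫ c in Ioi (0 : ℝ), c ^ (-σ) * m c with hKdef
  have hscale : ∀ l : ℝ, 0 < l → ∀ s : ℝ, 0 < s →
      s ^ (-σ) * m (l * s) = l ^ σ * ((l * s) ^ (-σ) * m (l * s)) := by
    intro l hl s hs
    rw [Real.mul_rpow hl.le hs.le, Real.rpow_neg hl.le]
    have : l ^ σ ≠ 0 := (Real.rpow_pos_of_pos hl _).ne'
    field_simp
  have hint : ∀ l : ℝ, 0 < l → IntegrableOn (fun s : ℝ => s ^ (-σ) * m (l * s)) (Ioi 0) := by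
    intro l hl
    have h1 : IntegrableOn (fun s : ℝ => (l * s) ^ (-σ) * m (l * s)) (Ioi 0) := by
      have := (integrableOn_Ioi_comp_mul_left_iff (fun c : ℝ => c ^ (-σ) * m c) 0 hl).2
      rw [mul_zero] at this
      exact this hK.1
    refine IntegrableOn.congr_fun (h1.const_mul (l ^ σ)) (fun s hs => ?_) measurableSet_Ioi
    exact (hscale l hl s hs).symm
  have hval : ∀ l : ℝ, 0 < l → ∫ s in Ioi (0 : ℝ), s ^ (-σ) * m (l * s) = l ^ (-(1 - σ)) * K := by
    intro l hl
    rw [setIntegral_congr_fun measurableSet_Ioi (fun s hs => hscale l hl s hs), integral_const_mul,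
      integral_comp_mul_left_Ioi (fun c : ℝ => c ^ (-σ) * m c) 0 hl, mul_zero, smul_eq_mul,
      ← hKdef, ← mul_assoc, neg_sub, Real.rpow_sub hl, Real.rpow_one]
    rfl
  have hbd : ∀ l s : ℝ, 0 < l → 0 < s → ‖s ^ (-σ) • R l (R (l * s) w)‖ ≤
      m l * ‖w‖ * (s ^ (-σ) * m (l * s)) := by
    intro l s hl hs
    have hls : 0 < l * s := mul_pos hl hs
    rw [norm_smul, Real.norm_of_nonneg (Real.rpow_nonneg hs.le _)]
    have h1 := (R l).le_of_opNorm_le (hRm l hl) (R (l * s) w)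
    have h2 := (R (l * s)).le_of_opNorm_le (hRm _ hls) w
    calc _ ≤ s ^ (-σ) * (m l * (m (l * s) * ‖w‖)) := by
          gcongr
          exact h1.trans (by gcongr)
      _ = _ := by ring
  have hmeas : AEStronglyMeasurable (fun p : ℝ × ℝ => p.2 ^ (-σ) • R p.1 (R (p.1 * p.2) w))
      ((volume.restrict (Ioi (0 : ℝ))).prod (volume.restrict (Ioi (0 : ℝ)))) := by
    rw [Measure.prod_restrict]
    refine ContinuousOn.aestronglyMeasurable ?_ (measurableSet_Ioi.prod measurableSet_Ioi)
    refine ContinuousOn.smul (fun p hp => ?_) ?_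
    · exact ((Real.continuousAt_rpow_const p.2 _ (Or.inl (ne_of_gt hp.2))).comp
        continuousAt_snd).continuousWithinAt
    · refine ContinuousOn.clm_apply (hRc.comp continuousOn_fst fun p hp => hp.1)
        (ContinuousOn.clm_apply (hRc.comp (continuousOn_fst.mul continuousOn_snd)
          fun p hp => mem_Ioi.2 (mul_pos (mem_Ioi.1 hp.1) (mem_Ioi.1 hp.2))) continuousOn_const)
  have hin : ∀ l : ℝ, 0 < l →
      Integrable (fun s : ℝ => s ^ (-σ) • R l (R (l * s) w)) (volume.restrict (Ioi 0)) := by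
    intro l hl
    refine ((hint l hl).const_mul (m l * ‖w‖)).mono' ?_ ?_
    · refine ContinuousOn.aestronglyMeasurable ?_ measurableSet_Ioi
      refine ContinuousOn.smul (fun s hs => ?_) ?_
      · exact (Real.continuousAt_rpow_const s _ (Or.inl (ne_of_gt hs))).continuousWithinAt
      · exact ContinuousOn.clm_apply continuousOn_const (ContinuousOn.clm_apply
          (hRc.comp (by fun_prop) fun s hs => mem_Ioi.2 (mul_pos hl (mem_Ioi.1 hs))) continuousOn_const)
    · filter_upwards [ae_restrict_mem measurableSet_Ioi] with s hs
      exact hbd l s hl hs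
  rw [integrable_prod_iff hmeas]
  refine ⟨?_, ?_⟩
  · filter_upwards [ae_restrict_mem measurableSet_Ioi] with l hl
    exact hin l hl
  · have h1 := (integrableOn_rpow_neg_mul_min (σ := 1 - σ) (by linarith) (by linarith) hN0 hM0
      one_pos).1
    refine (h1.const_mul (K * ‖w‖)).mono' hmeas.norm.integral_prod_right' ?_
    filter_upwards [ae_restrict_mem measurableSet_Ioi] with l hl
    rw [Real.norm_of_nonneg (integral_nonneg fun _ => norm_nonneg _)]
    calc _ ≤ ∫ s in Ioi (0 : ℝ), m l * ‖w‖ * (s ^ (-σ) * m (l * s)) :=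
          setIntegral_mono_on (hin l hl).norm ((hint l hl).const_mul _) measurableSet_Ioi
            fun s hs => hbd l s hl hs
      _ = _ := by
        rw [integral_const_mul, hval l hl]
        ring

theorem fracPowNeg_injective {σ : ℝ} (hσ : 0 < σ) (hσ' : σ < 1) :
    Function.Injective (fracPowNeg S.generator σ) := by
  rw [injective_iff_map_eq_zero]
  intro w hw
  have hM0 : 0 ≤ M := (norm_nonneg _).trans (hM 0 le_rfl)
  obtain ⟨N, hN0, hN⟩ := exists_resolvent_bound hM h0
  set R := resolventOp S.generator with hRdef
  have hRspec : ∀ c : ℝ, 0 ≤ c → IsResolventAt S.generator c (R c) := fun c hc =>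
    resolventOp_spec (inResolventSet_of_nonneg hM h0 hc)
  have hRcont := continuousOn_resolventOp hM h0
  have hsin : 0 < Real.sin (Real.pi * σ) := Real.sin_pos_of_pos_of_lt_pi
    (mul_pos Real.pi_pos hσ) (by nlinarith [Real.pi_pos])
  have hI : ∫ c in Ioi (0 : ℝ), c ^ (-σ) • R c w = 0 := by
    rw [fracPowNeg_apply hM h0 hσ hσ', smul_eq_zero] at hw
    exact hw.resolve_left (div_pos hsin Real.pi_pos).ne'
  by_contra hw0
  have hprod := integrable_rpow_smul_resolvent_prod hN0 hM0
    (hRcont.mono Ioi_subset_Ici_self) (fun c hc => hN c (le_of_lt hc))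
    (fun c hc => norm_resolventOp_le hM h0 hc) hσ hσ' w
  have hzero : ∀ l : ℝ, 0 < l → ∫ s in Ioi (0 : ℝ), s ^ (-σ) • R l (R (l * s) w) = 0 := by
    intro l hl
    have h1 : ∀ s ∈ Ioi (0 : ℝ), s ^ (-σ) • R l (R (l * s) w) =
        l ^ σ • (fun c : ℝ => R l (c ^ (-σ) • R c w)) (l * s) := by
      intro s hs
      have hs' : 0 < s := hs
      have : l ^ σ ≠ 0 := (Real.rpow_pos_of_pos hl _).ne'
      simp only [map_smul, smul_smul]
      rw [Real.mul_rpow hl.le hs'.le, Real.rpow_neg hl.le]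
      congr 1
      field_simp
    have h2 := integral_comp_mul_left_Ioi (fun c : ℝ => R l (c ^ (-σ) • R c w)) 0 hl
    rw [mul_zero, ContinuousLinearMap.integral_comp_comm _
      (integrableOn_rpow_smul_resolventOp_apply hM h0 hσ hσ' w), hI, map_zero, smul_zero] at h2
    rw [setIntegral_congr_fun measurableSet_Ioi h1, integral_smul]
    exact (congrArg _ h2).trans (smul_zero _)
  have hx : R 0 w ≠ 0 := by
    intro h
    have h2 := (isResolventAt_generator_graph (hRspec 0 le_rfl) (y := -w) (x := 0)).2
      (by simp [h])
    have h3 := S.generatorGraph.zero_mem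
    have := graph_unique h2 h3
    exact hw0 (by simpa using this)
  have hlim0 : Tendsto (fun c => R c w) (𝓝[>] 0) (𝓝 (R 0 w)) := by
    have h1 : ContinuousWithinAt R (Ici 0) 0 := hRcont 0 (mem_Ici.2 le_rfl)
    exact ((ContinuousLinearMap.apply ℝ X w).continuous.tendsto _).comp
      (h1.mono Ioi_subset_Ici_self)
  have hliminf : Tendsto (fun c => R c w) atTop (𝓝 0) := by
    refine squeeze_zero_norm' (a := fun c => M * ‖w‖ / c) ?_
      (tendsto_const_nhds.div_atTop tendsto_id)
    filter_upwards [eventually_gt_atTop 0] with c hc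
    have := (R c).le_of_opNorm_le (norm_resolventOp_le hM h0 hc) w
    rwa [div_mul_eq_mul_div] at this
  have hloc : LocallyIntegrableOn (fun c => R c w) (Ioi 0) :=
    ContinuousOn.locallyIntegrableOn (ContinuousOn.clm_apply
      (hRcont.mono Ioi_subset_Ici_self) continuousOn_const) measurableSet_Ioi
  have hinner : ∀ᵐ s ∂(volume.restrict (Ioi (0 : ℝ))),
      ∫ l in Ioi (0 : ℝ), s ^ (-σ) • R l (R (l * s) w) =
        (s ^ (-σ) * ((s - 1)⁻¹ * Real.log s)) • R 0 w := by
    have hne : ∀ᵐ s : ℝ ∂(volume.restrict (Ioi (0 : ℝ))), s ≠ 1 :=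
      ae_restrict_of_ae (measure_eq_zero_iff_ae_notMem.1 (measure_singleton (1 : ℝ)))
    filter_upwards [hprod.prod_left_ae, ae_restrict_mem measurableSet_Ioi, hne] with s hs hs0 hs1
    have hs0' : 0 < s := hs0
    have hs1' : s - 1 ≠ 0 := sub_ne_zero.2 hs1
    have h1 : ∀ l ∈ Ioi (0 : ℝ), s ^ (-σ) • R l (R (l * s) w) =
        (s ^ (-σ) * (s - 1)⁻¹) • (l⁻¹ • (R (1 * l) w - R (s * l) w)) := by
      intro l hl
      have hl' : 0 < l := hl
      rw [one_mul, mul_comm s l, (hRspec l hl'.le).sub_eq (hRspec (l * s) (by positivity)) w,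
        smul_smul, smul_smul]
      congr 1
      field_simp
    have h2 : IntegrableOn (fun l : ℝ => l⁻¹ • (R (1 * l) w - R (s * l) w)) (Ioi 0) := by
      have h3 : IntegrableOn (fun l : ℝ => (s ^ (-σ) * (s - 1)⁻¹) •
          (l⁻¹ • (R (1 * l) w - R (s * l) w))) (Ioi 0) :=
        IntegrableOn.congr_fun hs h1 measurableSet_Ioi
      refine (integrable_smul_iff ?_ _).1 h3
      exact mul_ne_zero (Real.rpow_pos_of_pos hs0' _).ne' (inv_ne_zero hs1')
    rw [setIntegral_congr_fun measurableSet_Ioi h1, integral_smul,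
      Frullani.integral_Ioi_eq hloc one_pos hs0' hlim0 hliminf h2, div_one, sub_zero, smul_smul,
      mul_assoc]
  have hswap := integral_integral_swap
    (f := fun (l s : ℝ) => s ^ (-σ) • R l (R (l * s) w)) hprod
  rw [setIntegral_congr_fun measurableSet_Ioi (fun l hl => hzero l hl), integral_zero,
    integral_congr_ae hinner, integral_smul_const, eq_comm, smul_eq_zero] at hswap
  have hκ := hswap.resolve_right hx
  have hκint : IntegrableOn (fun s : ℝ => s ^ (-σ) * ((s - 1)⁻¹ * Real.log s)) (Ioi 0) := by
    have h1 := hprod.integral_prod_right.congr hinner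
    exact (integrable_smul_const hx).1 h1
  have hpos : ∀ s : ℝ, 0 < s → s ≠ 1 → 0 < (s - 1)⁻¹ * Real.log s := by
    intro s hs hs1
    rcases lt_or_gt_of_ne hs1 with h | h
    · exact mul_pos_of_neg_of_neg (inv_lt_zero.2 (by linarith)) (Real.log_neg hs h)
    · exact mul_pos (inv_pos.2 (by linarith)) (Real.log_pos h)
  have hnn : ∀ s : ℝ, 0 < s → 0 ≤ s ^ (-σ) * ((s - 1)⁻¹ * Real.log s) := by
    intro s hs
    by_cases hs1 : s = 1
    · simp [hs1]
    · exact mul_nonneg (Real.rpow_nonneg hs.le _) (hpos s hs hs1).le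
  have hgt : 0 < ∫ s in Ioi (0 : ℝ), s ^ (-σ) * ((s - 1)⁻¹ * Real.log s) := by
    rw [integral_pos_iff_support_of_nonneg_ae
      ((ae_restrict_mem measurableSet_Ioi).mono fun s hs => hnn s hs) hκint]
    have hsub : Ioo (1 : ℝ) 2 ⊆ (Function.support fun s : ℝ =>
        s ^ (-σ) * ((s - 1)⁻¹ * Real.log s)) ∩ Ioi 0 := by
      intro s hs
      have hs0 : 0 < s := by linarith [hs.1]
      exact ⟨(mul_pos (Real.rpow_pos_of_pos hs0 _) (hpos s hs0 (ne_of_gt hs.1))).ne', hs0⟩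
    rw [Measure.restrict_apply' measurableSet_Ioi]
    refine lt_of_lt_of_le ?_ (measure_mono hsub)
    rw [Real.volume_Ioo]
    norm_num
  exact hgt.ne' hκ

/-- Elements of the domain of `(-A)^σ` are recovered from their images. -/
theorem fracPowNeg_unboundedApply_fracPow {σ : ℝ} (hσ : 0 < σ) (hσ' : σ < 1) {x : X}
    (hx : x ∈ (fracPow S.generator σ).domain) :
    fracPowNeg S.generator σ (unboundedApply (fracPow S.generator σ) x) = x := by
  have hF : fracPow S.generator σ =
      (LinearMap.toPMap (fracPowNeg S.generator σ : X →ₗ[ℝ] X) ⊤).inverse := by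
    rw [fracPow, if_neg hσ'.ne]
  have hker : (LinearMap.toPMap (fracPowNeg S.generator σ : X →ₗ[ℝ] X) ⊤).toFun.ker = ⊥ := by
    rw [LinearMap.ker_eq_bot]
    intro a b hab
    exact Subtype.ext (fracPowNeg_injective hM h0 hσ hσ' hab)
  rw [unboundedApply, dif_pos hx]
  generalize hG : fracPow S.generator σ = G at hx
  rw [hF] at hG
  subst hG
  have hx' := hx
  rw [LinearPMap.inverse_domain] at hx'
  obtain ⟨y, hy⟩ := hx'
  rw [LinearPMap.inverse_apply_eq hker (x := y) (y := ⟨x, hx⟩) hy]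
  exact hy

omit [CompleteSpace X] h0 in
theorem SmoothingEstimates.exists_graph_bound {T : ℝ} (hT : 0 < T)
    (hs : S.SmoothingEstimates T) :
    ∃ L : ℝ, 0 ≤ L ∧ ∀ t : ℝ, 0 < t → ∀ x : X, ∃ y : X,
      (S.toFun t x, y) ∈ S.generatorGraph ∧ ‖y‖ ≤ L / min t T * ‖x‖ := by
  have hM0 : 0 ≤ M := (norm_nonneg _).trans (hM 0 le_rfl)
  obtain ⟨L, hL, h⟩ := hs 1 one_pos le_rfl
  have hF : fracPow S.generator 1 = -S.generator := by rw [fracPow, if_pos rfl]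
  rw [hF] at h
  have key : ∀ t : ℝ, 0 < t → t ≤ T → ∀ x : X, ∃ y : X,
      (S.toFun t x, y) ∈ S.generatorGraph ∧ ‖y‖ ≤ L / t * ‖x‖ := by
    intro t ht htT x
    obtain ⟨hx, hx'⟩ := h t ht htT x
    refine ⟨S.generator ⟨S.toFun t x, hx⟩, S.mem_generatorGraph_iff_exists.2 ⟨hx, rfl⟩, ?_⟩
    rw [Real.rpow_one] at hx'
    rwa [LinearPMap.neg_apply, norm_neg] at hx'
  refine ⟨L * (1 + M), by positivity, fun t ht x => ?_⟩
  rcases le_total t T with htT | htT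
  · obtain ⟨y, hy, hyn⟩ := key t ht htT x
    refine ⟨y, hy, hyn.trans ?_⟩
    rw [min_eq_left htT]
    gcongr
    exact le_mul_of_one_le_right hL.le (by linarith)
  · obtain ⟨y, hy, hyn⟩ := key T hT le_rfl x
    have h1 := S.graph_apply hy (t := t - T) (by linarith)
    have h2 : S.toFun (t - T) (S.toFun T x) = S.toFun t x := by
      rw [← ContinuousLinearMap.comp_apply, ← S.add_time _ _ (by linarith) hT.le]
      simp
    rw [h2] at h1
    refine ⟨_, h1, ?_⟩
    rw [min_eq_right htT]
    calc _ ≤ M * (L / T * ‖x‖) := by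
          refine ((S.toFun (t - T)).le_of_opNorm_le (hM _ (by linarith)) y).trans ?_
          gcongr
      _ = M * L / T * ‖x‖ := by ring
      _ ≤ L * (1 + M) / T * ‖x‖ := by
          refine mul_le_mul_of_nonneg_right (div_le_div_of_nonneg_right ?_ hT.le) (norm_nonneg _)
          nlinarith

theorem exists_graph_fracPowNeg_bound {T : ℝ} (hT : 0 < T) (hs : S.SmoothingEstimates T) {σ : ℝ}
    (hσ : 0 < σ) (hσ' : σ < 1) :
    ∃ C : ℝ, 0 ≤ C ∧ ∀ t : ℝ, 0 < t → ∀ w : X, ∃ y : X,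
      (S.toFun t (fracPowNeg S.generator σ w), y) ∈ S.generatorGraph ∧
        ‖y‖ ≤ C * (min t T) ^ (-(1 - σ)) * ‖w‖ := by
  have hM0 : 0 ≤ M := (norm_nonneg _).trans (hM 0 le_rfl)
  obtain ⟨L, hL0, hL⟩ := SmoothingEstimates.exists_graph_bound hM hT hs
  set R := resolventOp S.generator with hRdef
  have hRspec : ∀ c : ℝ, 0 ≤ c → IsResolventAt S.generator c (R c) := fun c hc =>
    resolventOp_spec (inResolventSet_of_nonneg hM h0 hc)
  have hσ1 : 0 < 1 - σ := by linarith
  set k := |Real.sin (Real.pi * σ) / Real.pi| with hk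
  refine ⟨k * (M * (M + 1) / (1 - σ) + L * M / σ), by positivity, fun t ht w => ?_⟩
  set r := min t T with hr
  have hr0 : 0 < r := lt_min ht hT
  set g : ℝ → X := fun c => c ^ (-σ) • S.toFun t (c • R c w - w) with hg
  have hbd : ∀ c : ℝ, 0 < c → ‖S.toFun t (c • R c w - w)‖ ≤
      ‖w‖ * min (M * (M + 1)) (L / r * M / c) := by
    intro c hc
    have hRn : ‖R c w‖ ≤ M / c * ‖w‖ :=
      (R c).le_of_opNorm_le (norm_resolventOp_le hM h0 hc) w
    rw [mul_min_of_nonneg _ _ (norm_nonneg w)]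
    refine le_min ?_ ?_
    · refine ((S.toFun t).le_of_opNorm_le (hM t ht.le) _).trans ?_
      have : ‖c • R c w - w‖ ≤ M * ‖w‖ + ‖w‖ := by
        refine (norm_sub_le _ _).trans ?_
        gcongr
        rw [norm_smul, Real.norm_of_nonneg hc.le]
        calc c * ‖R c w‖ ≤ c * (M / c * ‖w‖) := by gcongr
          _ = M * ‖w‖ := by field_simp
      calc _ ≤ M * (M * ‖w‖ + ‖w‖) := by gcongr
        _ = _ := by ring
    · obtain ⟨y, hy, hyn⟩ := hL t ht (R c w)
      have h1 := S.graph_apply ((hRspec c hc.le).graph_mem w) ht.le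
      rw [graph_unique h1 hy]
      calc ‖y‖ ≤ L / r * (M / c * ‖w‖) := hyn.trans (by gcongr)
        _ = _ := by ring
  have hmin := integrableOn_rpow_neg_mul_min hσ hσ' (a := M * (M + 1)) (b := L / r * M)
    (by positivity) (by positivity) (inv_pos.2 hr0)
  have hRcont := (continuousOn_resolventOp hM h0).mono (Ioi_subset_Ici_self (a := (0 : ℝ)))
  have hgbd : ∀ᵐ c ∂(volume.restrict (Ioi (0 : ℝ))),
      ‖g c‖ ≤ ‖w‖ * (c ^ (-σ) * min (M * (M + 1)) (L / r * M / c)) := by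
    filter_upwards [ae_restrict_mem measurableSet_Ioi] with c hc
    have hc0 : 0 < c := hc
    rw [hg, norm_smul, Real.norm_of_nonneg (Real.rpow_nonneg hc0.le _)]
    calc _ ≤ c ^ (-σ) * (‖w‖ * min (M * (M + 1)) (L / r * M / c)) := by
          gcongr
          exact hbd c hc0
      _ = _ := by ring
  have hgint : IntegrableOn g (Ioi 0) := by
    refine (hmin.1.const_mul ‖w‖).mono' ?_ hgbd
    refine ContinuousOn.aestronglyMeasurable ?_ measurableSet_Ioi
    refine ContinuousOn.smul (fun c hc => ?_) ?_
    · exact (Real.continuousAt_rpow_const c _ (Or.inl (ne_of_gt hc))).continuousWithinAt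
    · refine (S.toFun t).continuous.comp_continuousOn ?_
      exact (continuousOn_id.smul (hRcont.clm_apply continuousOn_const)).sub continuousOn_const
  have hmem := integral_mem_graph (μ := volume.restrict (Ioi (0 : ℝ))) h0
    (f := fun c => S.toFun t (c ^ (-σ) • R c w)) hgint (by
      filter_upwards [ae_restrict_mem measurableSet_Ioi] with c hc
      have h1 := S.graph_apply ((hRspec c (le_of_lt hc)).graph_mem w) ht.le
      have h2 := S.generatorGraph.smul_mem (c ^ (-σ)) h1
      rw [map_smul]
      exact h2)
  rw [ContinuousLinearMap.integral_comp_comm _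
    (integrableOn_rpow_smul_resolventOp_apply hM h0 hσ hσ' w)] at hmem
  refine ⟨(Real.sin (Real.pi * σ) / Real.pi) • ∫ c in Ioi (0 : ℝ), g c, ?_, ?_⟩
  · rw [fracPowNeg_apply hM h0 hσ hσ', map_smul]
    exact S.generatorGraph.smul_mem _ hmem
  · rw [norm_smul, Real.norm_eq_abs, ← hk]
    have h1 : ‖∫ c in Ioi (0 : ℝ), g c‖ ≤ ‖w‖ *
        (M * (M + 1) * (r⁻¹ ^ (1 - σ) / (1 - σ)) + L / r * M * (r⁻¹ ^ (-σ) / σ)) := by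
      refine (norm_integral_le_of_norm_le (hmin.1.const_mul ‖w‖) hgbd).trans ?_
      rw [integral_const_mul]
      gcongr
      exact hmin.2
    have h2 : r⁻¹ ^ (1 - σ) = r ^ (-(1 - σ)) := by
      rw [Real.inv_rpow hr0.le, Real.rpow_neg hr0.le]
    have h3 : r⁻¹ ^ (-σ) / r = r ^ (-(1 - σ)) := by
      rw [Real.inv_rpow hr0.le, ← Real.rpow_neg hr0.le, neg_neg, neg_sub, Real.rpow_sub hr0,
        Real.rpow_one]
    calc _ ≤ k * (‖w‖ * (M * (M + 1) * (r⁻¹ ^ (1 - σ) / (1 - σ)) +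
          L / r * M * (r⁻¹ ^ (-σ) / σ))) := by gcongr
      _ = k * (‖w‖ * (M * (M + 1) * (r⁻¹ ^ (1 - σ) / (1 - σ)) +
          L * M * ((r⁻¹ ^ (-σ) / r) / σ))) := by ring
      _ = _ := by
        rw [h2, h3]
        ring

end C0Semigroup

end FractionalPowers

section SolutionOperators

theorem integrableOn_mul_probDensity_mul_rpow {ν p : ℝ} (hν0 : 0 < ν) (hν1 : ν < 1) (hp0 : 0 ≤ p)
    (hp1 : p < 1) :
    IntegrableOn (fun θ : ℝ => θ * probDensity ν θ * θ ^ (-p)) (Ioi 0) := by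
  obtain ⟨C₁, hC₁0, hC₁⟩ := abs_probDensity_le hν0 hν1
  obtain ⟨C₂, hC₂0, hC₂⟩ := abs_probDensity_le_rpow hν0 hν1
  have hmeas : AEStronglyMeasurable (fun θ : ℝ => θ * probDensity ν θ * θ ^ (-p))
      (volume.restrict (Ioi 0)) := by
    refine (AEStronglyMeasurable.mul ?_ (aestronglyMeasurable_probDensity hν0 hν1)).mul ?_
    · exact measurable_id.aestronglyMeasurable
    · exact Measurable.aestronglyMeasurable (by fun_prop)
  have hν : 1 < 1 / ν := by rw [lt_div_iff₀ hν0]; linarith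
  rw [← Ioc_union_Ioi_eq_Ioi zero_le_one]
  refine IntegrableOn.union ?_ ?_
  · refine Integrable.mono' (g := fun _ => C₁) (integrable_const _)
      (hmeas.mono_set Ioc_subset_Ioi_self) ?_
    filter_upwards [ae_restrict_mem measurableSet_Ioc] with θ hθ
    have hθ0 : 0 < θ := hθ.1
    have h1 : θ * θ ^ (-p) = θ ^ (1 - p) := by
      rw [sub_eq_add_neg, Real.rpow_add hθ.1, Real.rpow_one]
    have h2 : θ ^ (1 - p) ≤ 1 := Real.rpow_le_one hθ.1.le hθ.2 (by linarith)
    calc ‖θ * probDensity ν θ * θ ^ (-p)‖ = |probDensity ν θ| * θ ^ (1 - p) := by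
          rw [mul_right_comm, h1, norm_mul, mul_comm, Real.norm_eq_abs,
            Real.norm_of_nonneg (Real.rpow_nonneg hθ.1.le _)]
      _ ≤ C₁ * 1 := by
          gcongr
          exact hC₁ θ hθ.1
      _ = C₁ := mul_one _
  · have hi : IntegrableOn (fun θ : ℝ => C₂ * θ ^ (-(1 / ν))) (Ioi 1) :=
      (integrableOn_Ioi_rpow_of_lt (by linarith) one_pos).const_mul C₂
    refine hi.mono' (hmeas.mono_set (Ioi_subset_Ioi zero_le_one)) ?_
    filter_upwards [ae_restrict_mem measurableSet_Ioi] with θ hθ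
    have hθ1 : (1 : ℝ) < θ := hθ
    have hθ0 : 0 < θ := by linarith
    have h2 : θ ^ (-p) ≤ 1 := Real.rpow_le_one_of_one_le_of_nonpos hθ1.le (by linarith)
    have h3 : θ * θ ^ (-1 - 1 / ν) = θ ^ (-(1 / ν)) := by
      nth_rewrite 1 [← Real.rpow_one θ]
      rw [← Real.rpow_add hθ0]
      congr 1
      ring
    calc ‖θ * probDensity ν θ * θ ^ (-p)‖ = θ * |probDensity ν θ| * θ ^ (-p) := by
          rw [norm_mul, norm_mul, Real.norm_of_nonneg hθ0.le, Real.norm_eq_abs,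
            Real.norm_of_nonneg (Real.rpow_nonneg hθ0.le _)]
      _ ≤ θ * (C₂ * θ ^ (-1 - 1 / ν)) * 1 := by
          gcongr
          exact hC₂ θ hθ0
      _ = C₂ * θ ^ (-(1 / ν)) := by rw [← h3]; ring

theorem integrableOn_mul_probDensity {ν : ℝ} (hν0 : 0 < ν) (hν1 : ν < 1) :
    IntegrableOn (fun θ : ℝ => θ * probDensity ν θ) (Ioi 0) := by
  simpa using integrableOn_mul_probDensity_mul_rpow hν0 hν1 le_rfl one_pos

variable {X : Type*} [NormedAddCommGroup X] [NormedSpace ℝ X]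
  {S : C0Semigroup X} {M : ℝ}

namespace C0Semigroup

theorem continuousOn_toFun (hM : ∀ t : ℝ, 0 ≤ t → ‖S.toFun t‖ ≤ M) {T : ℝ} (hT : 0 < T)
    (hs : S.SmoothingEstimates T) : ContinuousOn S.toFun (Ioi 0) := by
  obtain ⟨L, hL0, hL⟩ := SmoothingEstimates.exists_graph_bound hM hT hs
  have key : ∀ a : ℝ, 0 < a → ∀ s t : ℝ, a ≤ s → s ≤ t →
      ‖S.toFun t - S.toFun s‖ ≤ L / min a T * (t - s) := by
    intro a ha s t has hst
    have hm : 0 < min a T := lt_min ha hT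
    refine ContinuousLinearMap.opNorm_le_bound _
      (mul_nonneg (by positivity) (by linarith)) fun x => ?_
    have hex : ∀ r : ℝ, ∃ y : X, a ≤ r → (S.toFun r x, y) ∈ S.generatorGraph ∧
        ‖y‖ ≤ L / min a T * ‖x‖ := by
      intro r
      by_cases hr : a ≤ r
      · obtain ⟨y, hy, hyn⟩ := hL r (ha.trans_le hr) x
        refine ⟨y, fun _ => ⟨hy, hyn.trans ?_⟩⟩
        gcongr
      · exact ⟨0, fun h => absurd h hr⟩
    choose y hy using hex
    have := norm_image_sub_le_of_norm_deriv_right_le_segment (f := fun r => S.toFun r x) (f' := y)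
      (a := s) (b := t) (C := L / min a T * ‖x‖)
      ((S.continuousOn_orbit hM x).mono fun r hr => (ha.le.trans has).trans hr.1)
      (fun r hr => S.hasDerivWithinAt_orbit ((ha.le.trans has).trans hr.1)
        (hy r (has.trans hr.1)).1)
      (fun r hr => (hy r (has.trans hr.1)).2) t ⟨hst, le_rfl⟩
    rw [sub_apply]
    calc _ ≤ L / min a T * ‖x‖ * (t - s) := this
      _ = _ := by ring
  intro t ht
  have ht0 : 0 < t := ht
  have hlip : LipschitzOnWith (Real.toNNReal (L / min (t / 2) T)) S.toFun (Ici (t / 2)) := by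
    have hm : 0 < min (t / 2) T := lt_min (by positivity) hT
    refine LipschitzOnWith.of_dist_le_mul fun r hr s hs' => ?_
    rw [dist_eq_norm, dist_eq_norm, Real.coe_toNNReal _ (by positivity), Real.norm_eq_abs]
    rcases le_total s r with h | h
    · rw [abs_of_nonneg (by linarith)]
      exact key _ (by positivity) s r hs' h
    · rw [abs_of_nonpos (by linarith), norm_sub_rev, neg_sub]
      exact key _ (by positivity) r s hr h
  exact (hlip.continuousOn.continuousAt (Ici_mem_nhds (by linarith))).continuousWithinAt

/-- The operator `ν ∫ θ φ_ν(θ) S(τ^ν θ) dθ`. -/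
noncomputable def subordinated (S : C0Semigroup X) (ν τ : ℝ) : X →L[ℝ] X :=
  ν • ∫ θ in Ioi (0 : ℝ), (θ * probDensity ν θ) • S.toFun (τ ^ ν * θ)

variable {ν : ℝ} (hν0 : 0 < ν) (hν1 : ν < 1) {T : ℝ} (hT : 0 < T)
  (hM : ∀ t : ℝ, 0 ≤ t → ‖S.toFun t‖ ≤ M) (hs : S.SmoothingEstimates T)

include hν0 hν1 hT hM hs

theorem aestronglyMeasurable_subordinated_integrand {τ : ℝ} (hτ : 0 < τ) :
    AEStronglyMeasurable (fun θ : ℝ => (θ * probDensity ν θ) • S.toFun (τ ^ ν * θ))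
      (volume.restrict (Ioi 0)) := by
  refine (integrableOn_mul_probDensity hν0 hν1).aestronglyMeasurable.smul ?_
  refine ContinuousOn.aestronglyMeasurable ?_ measurableSet_Ioi
  refine (continuousOn_toFun hM hT hs).comp (by fun_prop) fun θ hθ => ?_
  exact mem_Ioi.2 (mul_pos (Real.rpow_pos_of_pos hτ _) (mem_Ioi.1 hθ))

omit hν0 hν1 hT hs in
theorem norm_subordinated_integrand_le {τ θ : ℝ} (hτ : 0 ≤ τ) (hθ : 0 < θ) :
    ‖(θ * probDensity ν θ) • S.toFun (τ ^ ν * θ)‖ ≤ ‖θ * probDensity ν θ‖ * M := by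
  rw [norm_smul]
  gcongr
  exact hM _ (mul_nonneg (Real.rpow_nonneg hτ _) hθ.le)

theorem integrableOn_subordinated_integrand {τ : ℝ} (hτ : 0 < τ) :
    IntegrableOn (fun θ : ℝ => (θ * probDensity ν θ) • S.toFun (τ ^ ν * θ)) (Ioi 0) := by
  refine ((integrableOn_mul_probDensity hν0 hν1).norm.mul_const M).mono'
    (aestronglyMeasurable_subordinated_integrand hν0 hν1 hT hM hs hτ) ?_
  filter_upwards [ae_restrict_mem measurableSet_Ioi] with θ hθ
  exact norm_subordinated_integrand_le hM hτ.le hθ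

omit hν1 hT hs in
theorem norm_subordinated_le (hν1 : ν < 1) {τ : ℝ} (hτ : 0 ≤ τ) : ‖S.subordinated ν τ‖ ≤
    ν * ((∫ θ in Ioi (0 : ℝ), ‖θ * probDensity ν θ‖) * M) := by
  rw [subordinated, norm_smul, Real.norm_of_nonneg hν0.le]
  gcongr
  rw [← integral_mul_const]
  refine norm_integral_le_of_norm_le
    ((integrableOn_mul_probDensity hν0 hν1).norm.mul_const M) ?_
  filter_upwards [ae_restrict_mem measurableSet_Ioi] with θ hθ
  exact norm_subordinated_integrand_le hM hτ hθ

theorem subordinated_apply {τ : ℝ} (hτ : 0 < τ) (y : X) : S.subordinated ν τ y =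
    ν • ∫ θ in Ioi (0 : ℝ), (θ * probDensity ν θ) • S.toFun (τ ^ ν * θ) y := by
  rw [subordinated, smul_apply, ContinuousLinearMap.integral_apply
    (integrableOn_subordinated_integrand hν0 hν1 hT hM hs hτ)]
  rfl

theorem continuousOn_subordinated : ContinuousOn (S.subordinated ν) (Ioi 0) := by
  have h : ContinuousOn (fun τ : ℝ => ∫ θ in Ioi (0 : ℝ),
      (θ * probDensity ν θ) • S.toFun (τ ^ ν * θ)) (Ioi 0) := by
    refine continuousOn_of_dominated
      (bound := fun θ => ‖θ * probDensity ν θ‖ * M)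
      (fun τ hτ => aestronglyMeasurable_subordinated_integrand hν0 hν1 hT hM hs hτ)
      (fun τ hτ => ?_) ((integrableOn_mul_probDensity hν0 hν1).norm.mul_const M) ?_
    · filter_upwards [ae_restrict_mem measurableSet_Ioi] with θ hθ
      exact norm_subordinated_integrand_le hM (le_of_lt hτ) hθ
    · filter_upwards [ae_restrict_mem measurableSet_Ioi] with θ hθ
      have h1 : ContinuousOn (fun τ : ℝ => S.toFun (τ ^ ν * θ)) (Ioi 0) := by
        refine (continuousOn_toFun hM hT hs).comp ?_ fun τ hτ =>
          mem_Ioi.2 (mul_pos (Real.rpow_pos_of_pos hτ _) (mem_Ioi.1 hθ))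
        exact ((Real.continuous_rpow_const hν0.le).mul continuous_const).continuousOn
      exact h1.const_smul (θ * probDensity ν θ)
  exact h.const_smul ν

theorem isCompactOperator_subordinated [CompleteSpace X] (hc : S.IsCompactSemigroup) {τ : ℝ}
    (hτ : 0 < τ) : IsCompactOperator (S.subordinated ν τ) := by
  classical
  set f : ℝ → X →L[ℝ] X := fun θ => (θ * probDensity ν θ) • S.toFun (τ ^ ν * θ) with hf
  have hfc : ∀ θ : ℝ, 0 < θ → IsCompactOperator (f θ) := fun θ hθ =>
    (hc _ (mul_pos (Real.rpow_pos_of_pos hτ _) hθ)).smul _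
  have hfi := integrableOn_subordinated_integrand hν0 hν1 hT hM hs hτ
  let f' : ℝ → CompactOp X X := fun θ => if h : 0 < θ then ⟨f θ, hfc θ h⟩ else 0
  have hff' : ∀ᵐ θ ∂(volume.restrict (Ioi (0 : ℝ))), compactOpIncl X X (f' θ) = f θ := by
    filter_upwards [ae_restrict_mem measurableSet_Ioi] with θ hθ
    have : f' θ = ⟨f θ, hfc θ hθ⟩ := dif_pos (mem_Ioi.1 hθ)
    rw [this]
    rfl
  have hf'i : Integrable f' (volume.restrict (Ioi (0 : ℝ))) := by
    have h1 : Integrable (fun θ => compactOpIncl X X (f' θ)) (volume.restrict (Ioi (0 : ℝ))) :=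
      hfi.congr (hff'.mono fun θ h => h.symm)
    refine ⟨?_, ?_⟩
    · exact (Topology.IsEmbedding.subtypeVal.aestronglyMeasurable_comp_iff).1 h1.1
    · exact h1.2
  have h2 : S.subordinated ν τ = ν • compactOpIncl X X (∫ θ in Ioi (0 : ℝ), f' θ) := by
    rw [subordinated, ← ContinuousLinearMap.integral_comp_comm _ hf'i, integral_congr_ae hff']
  rw [h2]
  exact (∫ θ in Ioi (0 : ℝ), f' θ).2.smul ν

omit hν0 hν1 hT hs in
theorem continuousOn_generator_orbit {x : X}
    (hx : ∀ t : ℝ, 0 < t → S.toFun t x ∈ S.generator.domain) :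
    ContinuousOn (fun t => unboundedApply S.generator (S.toFun t x)) (Ioi 0) := by
  intro t ht
  have ht0 : 0 < t := ht
  set y := unboundedApply S.generator (S.toFun (t / 2) x) with hy
  have hg : (S.toFun (t / 2) x, y) ∈ S.generatorGraph :=
    S.mem_graph_unboundedApply (hx _ (by positivity))
  have heq : ∀ r : ℝ, t / 2 ≤ r →
      unboundedApply S.generator (S.toFun r x) = S.toFun (r - t / 2) y := by
    intro r hr
    refine S.unboundedApply_of_mem_graph ?_
    have h1 := S.graph_apply hg (t := r - t / 2) (by linarith)
    have h2 : S.toFun (r - t / 2) (S.toFun (t / 2) x) = S.toFun r x := by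
      rw [← ContinuousLinearMap.comp_apply, ← S.add_time _ _ (by linarith) (by linarith)]
      simp
    rwa [h2] at h1
  have hc : ContinuousAt (fun r => S.toFun (r - t / 2) y) t := by
    have h3 : ContinuousAt (fun r => S.toFun r y) (t - t / 2) :=
      (S.continuousOn_orbit hM y).continuousAt (Ici_mem_nhds (by linarith))
    exact h3.comp (f := fun r : ℝ => r - t / 2) (by fun_prop)
  refine (hc.congr ?_).continuousWithinAt
  filter_upwards [Ici_mem_nhds (by linarith : t / 2 < t)] with r hr
  exact (heq r hr).symm

theorem exists_graph_subordinated_fracPowNeg_bound [CompleteSpace X]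
    (h0 : InResolventSet S.generator 0) {σ : ℝ} (hσ : 0 < σ) (hσ' : σ < 1) :
    ∃ C : ℝ, 0 ≤ C ∧ ∀ τ : ℝ, 0 < τ → τ ≤ T → ∀ w : X, ∃ y : X,
      (S.subordinated ν τ (fracPowNeg S.generator σ w), y) ∈ S.generatorGraph ∧
        ‖y‖ ≤ C * τ ^ (-(ν * (1 - σ))) * ‖w‖ := by
  obtain ⟨C, hC0, hC⟩ := exists_graph_fracPowNeg_bound hM h0 hT hs hσ hσ'
  set p := 1 - σ with hp
  have hp0 : 0 < p := by rw [hp]; linarith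
  have hp1 : p < 1 := by rw [hp]; linarith
  set G₀ := ∫ θ in Ioi (0 : ℝ), ‖θ * probDensity ν θ‖ with hG₀
  set G₁ := ∫ θ in Ioi (0 : ℝ), ‖θ * probDensity ν θ * θ ^ (-p)‖ with hG₁
  have hG₀0 : 0 ≤ G₀ := integral_nonneg fun _ => norm_nonneg _
  have hG₁0 : 0 ≤ G₁ := integral_nonneg fun _ => norm_nonneg _
  have hi0 := (integrableOn_mul_probDensity hν0 hν1).norm
  have hi1 := (integrableOn_mul_probDensity_mul_rpow hν0 hν1 hp0.le hp1).norm
  refine ⟨ν * (C * (G₁ + T ^ (-p) * T ^ (ν * p) * G₀)), by positivity, fun τ hτ hτT w => ?_⟩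
  set J := fracPowNeg S.generator σ with hJ
  set a := τ ^ ν with ha_def
  have ha : 0 < a := Real.rpow_pos_of_pos hτ _
  have hdom : ∀ t : ℝ, 0 < t → S.toFun t (J w) ∈ S.generator.domain := fun t ht => by
    obtain ⟨y, hy, -⟩ := hC t ht w
    exact S.mem_domain_of_mem_graph hy
  set D : ℝ → X := fun t => unboundedApply S.generator (S.toFun t (J w)) with hD
  have hDg : ∀ t : ℝ, 0 < t → (S.toFun t (J w), D t) ∈ S.generatorGraph := fun t ht =>
    S.mem_graph_unboundedApply (hdom t ht)
  have hDb : ∀ t : ℝ, 0 < t → ‖D t‖ ≤ C * (t ^ (-p) + T ^ (-p)) * ‖w‖ := by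
    intro t ht
    obtain ⟨y, hy, hyn⟩ := hC t ht w
    rw [graph_unique (hDg t ht) hy]
    refine hyn.trans ?_
    gcongr
    rcases le_total t T with h | h
    · rw [min_eq_left h]
      have := Real.rpow_nonneg hT.le (-p)
      linarith
    · rw [min_eq_right h]
      have := Real.rpow_nonneg ht.le (-p)
      linarith
  have hbd : ∀ᵐ θ ∂(volume.restrict (Ioi (0 : ℝ))), ‖(θ * probDensity ν θ) • D (a * θ)‖ ≤
      C * ‖w‖ * (a ^ (-p) * ‖θ * probDensity ν θ * θ ^ (-p)‖ +
        T ^ (-p) * ‖θ * probDensity ν θ‖) := by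
    filter_upwards [ae_restrict_mem measurableSet_Ioi] with θ hθ
    have hθ0 : 0 < θ := hθ
    have h1 := hDb (a * θ) (by positivity)
    rw [Real.mul_rpow ha.le hθ0.le] at h1
    rw [norm_smul, norm_mul (θ * _), Real.norm_of_nonneg (Real.rpow_nonneg hθ0.le (-p))]
    calc _ ≤ ‖θ * probDensity ν θ‖ * (C * (a ^ (-p) * θ ^ (-p) + T ^ (-p)) * ‖w‖) := by gcongr
      _ = _ := by ring
  have hbi : IntegrableOn (fun θ : ℝ => C * ‖w‖ * (a ^ (-p) * ‖θ * probDensity ν θ * θ ^ (-p)‖ +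
        T ^ (-p) * ‖θ * probDensity ν θ‖)) (Ioi 0) :=
    ((hi1.const_mul _).add (hi0.const_mul _)).const_mul _
  have hDi : IntegrableOn (fun θ : ℝ => (θ * probDensity ν θ) • D (a * θ)) (Ioi 0) := by
    refine hbi.mono' ?_ hbd
    refine (integrableOn_mul_probDensity hν0 hν1).aestronglyMeasurable.smul ?_
    refine ContinuousOn.aestronglyMeasurable ?_ measurableSet_Ioi
    exact (continuousOn_generator_orbit hM hdom).comp (by fun_prop)
      fun θ hθ => mem_Ioi.2 (mul_pos ha (mem_Ioi.1 hθ))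
  have hmem := integral_mem_graph (μ := volume.restrict (Ioi (0 : ℝ))) h0
    (f := fun θ => (θ * probDensity ν θ) • S.toFun (a * θ) (J w)) hDi (by
      filter_upwards [ae_restrict_mem measurableSet_Ioi] with θ hθ
      exact S.generatorGraph.smul_mem _ (hDg _ (mul_pos ha hθ)))
  refine ⟨ν • ∫ θ in Ioi (0 : ℝ), (θ * probDensity ν θ) • D (a * θ), ?_, ?_⟩
  · rw [subordinated_apply hν0 hν1 hT hM hs hτ]
    exact S.generatorGraph.smul_mem ν hmem
  · rw [norm_smul, Real.norm_of_nonneg hν0.le]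
    have h1 : ‖∫ θ in Ioi (0 : ℝ), (θ * probDensity ν θ) • D (a * θ)‖ ≤
        C * ‖w‖ * (a ^ (-p) * G₁ + T ^ (-p) * G₀) := by
      refine (norm_integral_le_of_norm_le hbi hbd).trans_eq ?_
      rw [integral_const_mul, integral_add (hi1.const_mul _) (hi0.const_mul _),
        integral_const_mul, integral_const_mul]
    have h2 : a ^ (-p) = τ ^ (-(ν * p)) := by
      rw [ha_def, ← Real.rpow_mul hτ.le]
      congr 1
      ring
    have h3 : 1 ≤ T ^ (ν * p) * τ ^ (-(ν * p)) := by
      rw [Real.rpow_neg hτ.le, ← div_eq_mul_inv, one_le_div (Real.rpow_pos_of_pos hτ _)]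
      exact Real.rpow_le_rpow hτ.le hτT (by positivity)
    have h4 : T ^ (-p) * G₀ ≤ T ^ (-p) * G₀ * (T ^ (ν * p) * τ ^ (-(ν * p))) :=
      le_mul_of_one_le_right (by positivity) h3
    rw [h2] at h1
    calc _ ≤ ν * (C * ‖w‖ * (τ ^ (-(ν * p)) * G₁ +
          T ^ (-p) * G₀ * (T ^ (ν * p) * τ ^ (-(ν * p))))) := by
          gcongr
          exact h1.trans (by gcongr)
      _ = _ := by ring

end C0Semigroup

end SolutionOperators

section Comparison

/-- The exponentially weighted singular kernel `τ^(a-1) e^(-l τ)` on the half-line. -/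
noncomputable def singularKernel (a l τ : ℝ) : ℝ≥0∞ :=
  (Ioi (0 : ℝ)).indicator (fun τ => ENNReal.ofReal (τ ^ (a - 1) * Real.exp (-(l * τ)))) τ

theorem measurable_singularKernel (a l : ℝ) : Measurable (singularKernel a l) :=
  Measurable.indicator (by fun_prop) measurableSet_Ioi

theorem lintegral_singularKernel {a l : ℝ} (ha : 0 < a) (hl : 0 < l) :
    ∫⁻ τ, singularKernel a l τ = ENNReal.ofReal ((1 / l) ^ a * Real.Gamma a) := by
  unfold singularKernel
  rw [lintegral_indicator measurableSet_Ioi, ← Real.integral_rpow_mul_exp_neg_mul_Ioi ha hl,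
    ofReal_integral_eq_lintegral_ofReal]
  · have := integrableOn_rpow_mul_exp_neg_mul_rpow (s := a - 1) (p := 1) (b := l) (by linarith)
      one_pos hl
    simpa [IntegrableOn] using this
  · filter_upwards [ae_restrict_mem measurableSet_Ioi] with τ hτ
    exact mul_nonneg (Real.rpow_nonneg (le_of_lt hτ) _) (Real.exp_nonneg _)

theorem lintegral_comp_sub_left_le (k : ℝ → ℝ≥0∞) (t : ℝ) (s : Set ℝ) :
    ∫⁻ r in s, k (t - r) ≤ ∫⁻ τ, k τ := by
  rw [← lintegral_sub_left_eq_self k t]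
  exact setLIntegral_le_lintegral _ _

theorem singularKernel_mul_exp (a l t s : ℝ) :
    singularKernel a 0 (t - s) * ENNReal.ofReal (Real.exp (l * s)) =
      ENNReal.ofReal (Real.exp (l * t)) * singularKernel a l (t - s) := by
  unfold singularKernel
  by_cases h : t - s ∈ Ioi (0 : ℝ)
  · rw [indicator_of_mem h, indicator_of_mem h, ← ENNReal.ofReal_mul' (Real.exp_nonneg _),
      ← ENNReal.ofReal_mul (Real.exp_nonneg _)]
    congr 1
    have : Real.exp (l * s) = Real.exp (l * t) * Real.exp (-(l * (t - s))) := by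
      rw [← Real.exp_add]
      congr 1
      ring
    rw [this]
    simp only [zero_mul, neg_zero, Real.exp_zero, mul_one]
    ring
  · rw [indicator_of_notMem h, indicator_of_notMem h, zero_mul, mul_zero]

theorem exists_weight_le {a : ℝ} (ha : 0 < a) {η : ℝ} (hη : 0 < η) :
    ∃ l : ℝ, 0 < l ∧ (1 / l) ^ a * Real.Gamma a ≤ η := by
  have h1 : Tendsto (fun l : ℝ => (1 / l) ^ a * Real.Gamma a) atTop (𝓝 0) := by
    have := (tendsto_rpow_neg_atTop ha).mul_const (Real.Gamma a)
    rw [zero_mul] at this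
    refine this.congr' ?_
    filter_upwards [eventually_gt_atTop 0] with l hl
    rw [one_div, Real.inv_rpow hl.le, Real.rpow_neg hl.le]
  obtain ⟨l, h2, h3⟩ := ((h1.eventually_le_const hη).and (eventually_gt_atTop 0)).exists
  exact ⟨l, h3, h2⟩

/-- Tonelli's theorem for convolutions. -/
theorem lintegral_lintegral_conv_le {k f : ℝ → ℝ≥0∞} (hk : Measurable k) {s : Set ℝ}
    (hf : AEMeasurable f (volume.restrict s)) :
    ∫⁻ t in s, ∫⁻ r in s, k (t - r) * f r ≤ (∫⁻ τ, k τ) * ∫⁻ r in s, f r := by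
  have hm : AEMeasurable (Function.uncurry fun t r => k (t - r) * f r)
      ((volume.restrict s).prod (volume.restrict s)) := by
    refine AEMeasurable.mul ?_ (hf.comp_quasiMeasurePreserving Measure.quasiMeasurePreserving_snd)
    exact (hk.comp (measurable_fst.sub measurable_snd)).aemeasurable
  rw [lintegral_lintegral_swap hm]
  calc ∫⁻ r in s, ∫⁻ t in s, k (t - r) * f r ≤ ∫⁻ r in s, (∫⁻ τ, k τ) * f r := by
        refine lintegral_mono fun r => ?_
        rw [lintegral_mul_const _ (by fun_prop)]
        refine mul_le_mul' ?_ le_rfl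
        rw [← lintegral_sub_right_eq_self k r]
        exact setLIntegral_le_lintegral _ _
    _ = _ := by rw [lintegral_const_mul'' _ hf]

namespace NeutralSystem

variable {X U : Type*} [NormedAddCommGroup X] [NormedSpace ℝ X]
  [NormedAddCommGroup U] [NormedSpace ℝ U] (P : NeutralSystem X U)

/-- The contribution of a control to the mild solution at time `t`. -/
noncomputable def controlTerm (w : P.Control) (t : ℝ) : X :=
  ∫ s in Ioc 0 t, (t - s) ^ (P.ν - 1) • P.semigroup.subordinated P.ν (t - s) (P.B (w s))

/-- The image of the neutral term under `(-A)^ς`, along a path. -/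
noncomputable def neutralLift (ς : ℝ) (x : P.Path) (s : ℝ) : X :=
  unboundedApply (fracPow P.A ς) (P.h s (P.history x s))

variable {P}
variable [CompleteSpace X]
    (hbdd : P.semigroup.UniformlyBounded) (hres : InResolventSet P.A 0)
    (hsmooth : P.semigroup.SmoothingEstimates P.T)
    {ς H H₁ : ℝ} (hς : ς ∈ Set.Ioo (0 : ℝ) 1)
    (hh : P.NeutralTermCondition ς H H₁)

include hbdd hsmooth

omit [CompleteSpace X] in
theorem solK_eq_subordinated {τ : ℝ} (hτ : 0 < τ) (y : X) :
    P.solK τ y = P.semigroup.subordinated P.ν τ y := by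
  obtain ⟨M, hM⟩ := hbdd
  rw [solK, C0Semigroup.subordinated_apply P.ν_pos P.ν_lt_one P.T_pos hM hsmooth hτ]

include hres hς hh

/-- Comparison of two mild solutions: the neutral terms enter through a majorant `δ` of their
difference. -/
theorem exists_enorm_sub_le :
    ∃ C : ℝ, 0 ≤ C ∧ ∀ (u v : P.Control) (x y : P.Path),
      P.IsMildSolution u x → P.IsMildSolution v y → ∀ δ : ℝ → ℝ≥0∞,
      (∀ s ∈ Icc (0 : ℝ) P.T,
        ‖P.neutralLift ς x s - P.neutralLift ς y s‖ₑ ≤ ENNReal.ofReal H * δ s) →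
      ∀ t ∈ Icc (0 : ℝ) P.T, ‖P.eval x t - P.eval y t‖ₑ ≤
        ENNReal.ofReal (‖fracPowNeg P.A ς‖ * H) * δ t +
        ENNReal.ofReal C * (∫⁻ s in Ioc 0 P.T, singularKernel (P.ν * ς) 0 (t - s) * δ s) +
        ‖P.controlTerm (u - v) t‖ₑ := by
  obtain ⟨M, hM⟩ := id hbdd
  obtain ⟨C, hC0, hC⟩ := C0Semigroup.exists_graph_subordinated_fracPowNeg_bound P.ν_pos P.ν_lt_one
    P.T_pos hM hsmooth hres hς.1 hς.2
  refine ⟨C * max H 0, by positivity, fun u v x y hx hy δ hδ t ht => ?_⟩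
  set J := fracPowNeg P.A ς with hJ
  set Kop := P.semigroup.subordinated P.ν with hKop
  have hlift : ∀ (z : P.Path) (s : ℝ), s ∈ Icc (0 : ℝ) P.T →
      P.h s (P.history z s) = J (P.neutralLift ς z s) := fun z s hs =>
    (C0Semigroup.fracPowNeg_unboundedApply_fracPow hM hres hς.1 hς.2 (hh.mem_domain s hs _)).symm
  have hne : ∀ᵐ s ∂(volume.restrict (Ioc 0 t)), s ∈ Ioo 0 t := by
    rw [restrict_Ioo_eq_restrict_Ioc.symm]
    exact ae_restrict_mem measurableSet_Ioo
  have hneutral : ∀ s ∈ Ioo 0 t, ‖P.neutralIntegrand x t s - P.neutralIntegrand y t s‖ₑ ≤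
      ENNReal.ofReal (C * max H 0) * (singularKernel (P.ν * ς) 0 (t - s) * δ s) := by
    intro s hs
    have hts : 0 < t - s := sub_pos.2 hs.2
    have hsT : s ∈ Icc (0 : ℝ) P.T := ⟨hs.1.le, hs.2.le.trans ht.2⟩
    have htsT : t - s ≤ P.T := by linarith [hs.1, ht.2]
    obtain ⟨a, ha, -⟩ := hC (t - s) hts htsT (P.neutralLift ς x s)
    obtain ⟨b, hb, -⟩ := hC (t - s) hts htsT (P.neutralLift ς y s)
    obtain ⟨c, hc, hcn⟩ := hC (t - s) hts htsT (P.neutralLift ς x s - P.neutralLift ς y s)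
    have hab : a - b = c := by
      refine C0Semigroup.graph_unique (S := P.semigroup) ?_ hc
      rw [map_sub, map_sub]
      exact P.semigroup.generatorGraph.sub_mem ha hb
    rw [neutralIntegrand, neutralIntegrand, hlift x s hsT, hlift y s hsT,
      solK_eq_subordinated hbdd hsmooth hts, solK_eq_subordinated hbdd hsmooth hts,
      P.semigroup.unboundedApply_of_mem_graph ha, P.semigroup.unboundedApply_of_mem_graph hb,
      ← smul_sub, hab, enorm_smul]
    have h1 : ‖c‖ₑ ≤ ENNReal.ofReal (C * (t - s) ^ (-(P.ν * (1 - ς)))) *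
        (ENNReal.ofReal H * δ s) := by
      calc ‖c‖ₑ = ENNReal.ofReal ‖c‖ := (ofReal_norm c).symm
        _ ≤ ENNReal.ofReal (C * (t - s) ^ (-(P.ν * (1 - ς))) *
            ‖P.neutralLift ς x s - P.neutralLift ς y s‖) := ENNReal.ofReal_le_ofReal hcn
        _ = ENNReal.ofReal (C * (t - s) ^ (-(P.ν * (1 - ς)))) *
            ‖P.neutralLift ς x s - P.neutralLift ς y s‖ₑ := by
          rw [ENNReal.ofReal_mul (mul_nonneg hC0 (Real.rpow_nonneg hts.le _)), ofReal_norm]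
        _ ≤ _ := by gcongr; exact hδ s hsT
    have h2 : ‖(t - s) ^ (P.ν - 1)‖ₑ = ENNReal.ofReal ((t - s) ^ (P.ν - 1)) :=
      Real.enorm_eq_ofReal (Real.rpow_nonneg hts.le _)
    have h3 : singularKernel (P.ν * ς) 0 (t - s) =
        ENNReal.ofReal ((t - s) ^ (P.ν - 1)) *
          ENNReal.ofReal ((t - s) ^ (-(P.ν * (1 - ς)))) := by
      rw [← ENNReal.ofReal_mul (Real.rpow_nonneg hts.le _), ← Real.rpow_add hts, singularKernel,
        indicator_of_mem (mem_Ioi.2 hts)]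
      simp only [zero_mul, neg_zero, Real.exp_zero, mul_one]
      congr 2
      ring
    have h4 : ENNReal.ofReal (C * max H 0) = ENNReal.ofReal C * ENNReal.ofReal H := by
      rw [ENNReal.ofReal_mul hC0]
      congr 1
      rcases le_total H 0 with h | h
      · rw [max_eq_right h, ENNReal.ofReal_of_nonpos h, ENNReal.ofReal_zero]
      · rw [max_eq_left h]
    rw [h2, h3, h4]
    calc _ ≤ ENNReal.ofReal ((t - s) ^ (P.ν - 1)) *
          (ENNReal.ofReal (C * (t - s) ^ (-(P.ν * (1 - ς)))) * (ENNReal.ofReal H * δ s)) := by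
          gcongr
      _ = _ := by
        rw [ENNReal.ofReal_mul hC0]
        ring
  have hcontrol : (∫ s in Ioc 0 t, P.controlIntegrand u t s) -
      ∫ s in Ioc 0 t, P.controlIntegrand v t s = P.controlTerm (u - v) t := by
    rw [← integral_sub (hx.control_integrable t ht) (hy.control_integrable t ht), controlTerm]
    refine integral_congr_ae ?_
    have hsub : ∀ᵐ s ∂(volume.restrict (Ioc 0 t)), (u - v : P.Control) s = u s - v s :=
      ae_mono (Measure.restrict_mono (Ioc_subset_Ioc_right ht.2) le_rfl) (Lp.coeFn_sub u v)
    filter_upwards [hne, hsub] with s hs hs'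
    have hts : 0 < t - s := sub_pos.2 hs.2
    rw [controlIntegrand, controlIntegrand, solK_eq_subordinated hbdd hsmooth hts,
      solK_eq_subordinated hbdd hsmooth hts, hs', map_sub, map_sub, smul_sub]
  have heq : P.eval x t - P.eval y t = J (P.neutralLift ς x t - P.neutralLift ς y t) +
      (∫ s in Ioc 0 t, (P.neutralIntegrand x t s - P.neutralIntegrand y t s)) +
      P.controlTerm (u - v) t := by
    rw [hx.equation t ht, hy.equation t ht, ← hcontrol,
      integral_sub (hx.neutral_integrable t ht) (hy.neutral_integrable t ht),
      intervalIntegral.integral_of_le ht.1, intervalIntegral.integral_of_le ht.1,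
      intervalIntegral.integral_of_le ht.1, intervalIntegral.integral_of_le ht.1,
      hlift x t ht, hlift y t ht, map_sub]
    abel
  rw [heq]
  refine (enorm_add_le _ _).trans (add_le_add ((enorm_add_le _ _).trans (add_le_add ?_ ?_)) le_rfl)
  · calc _ ≤ ‖J‖ₑ * ‖P.neutralLift ς x t - P.neutralLift ς y t‖ₑ := J.le_opENorm _
      _ ≤ ‖J‖ₑ * (ENNReal.ofReal H * δ t) := by gcongr; exact hδ t ht
      _ = _ := by rw [ENNReal.ofReal_mul (norm_nonneg _), ofReal_norm, mul_assoc]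
  · refine (enorm_integral_le_lintegral_enorm _).trans ?_
    rw [← lintegral_const_mul' _ _ ENNReal.ofReal_ne_top]
    calc _ ≤ ∫⁻ s in Ioc 0 t, ENNReal.ofReal (C * max H 0) *
          (singularKernel (P.ν * ς) 0 (t - s) * δ s) :=
          lintegral_mono_ae (hne.mono fun s hs => hneutral s hs)
      _ ≤ _ := lintegral_mono_set (Ioc_subset_Ioc_right ht.2)

/-- Uniform stability of mild solutions with respect to the control term. -/
theorem exists_norm_sub_le (hH : 0 < H) (hsmall : 0 < 1 - H * ‖fracPowNeg P.A ς‖) :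
    ∃ C : ℝ, 0 ≤ C ∧ ∀ (u v : P.Control) (x y : P.Path),
      P.IsMildSolution u x → P.IsMildSolution v y → ∀ e : ℝ, 0 ≤ e →
      (∀ t ∈ Icc (0 : ℝ) P.T, ‖P.controlTerm (u - v) t‖ ≤ e) →
      ∀ t ∈ Icc (0 : ℝ) P.T, ‖P.eval x t - P.eval y t‖ ≤ C * e := by
  obtain ⟨C, hC0, hC⟩ := exists_enorm_sub_le hbdd hres hsmooth hς hh
  set q := H * ‖fracPowNeg P.A ς‖ with hq
  have hq0 : 0 ≤ q := by positivity
  have ha : 0 < P.ν * ς := mul_pos P.ν_pos hς.1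
  obtain ⟨l, hl, hlκ⟩ := exists_weight_le ha (η := (1 - q) / (2 * (C + 1))) (by positivity)
  set κ := (1 / l) ^ (P.ν * ς) * Real.Gamma (P.ν * ς) with hκ
  have hκ0 : 0 ≤ κ := mul_nonneg (Real.rpow_nonneg (by positivity) _) (Real.Gamma_pos_of_pos ha).le
  have hCκ : C * κ ≤ (1 - q) / 2 := by
    calc C * κ ≤ (C + 1) * ((1 - q) / (2 * (C + 1))) := by
          gcongr
          linarith
      _ = (1 - q) / 2 := by field_simp
  refine ⟨Real.exp (l * P.T) * (2 / (1 - q)), by positivity, fun u v x y hx hy e he hce => ?_⟩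
  have hcont : Continuous fun t : ℝ => Real.exp (-(l * t)) * ‖P.eval x t - P.eval y t‖ := by
    unfold eval
    fun_prop
  obtain ⟨t₀, ht₀, hmax⟩ := isCompact_Icc.exists_isMaxOn (nonempty_Icc.2 P.T_pos.le)
    hcont.continuousOn
  set m := Real.exp (-(l * t₀)) * ‖P.eval x t₀ - P.eval y t₀‖ with hm
  have hm0 : 0 ≤ m := by positivity
  have hz : ∀ r ∈ Icc (0 : ℝ) P.T, ‖P.eval x r - P.eval y r‖ ≤ Real.exp (l * r) * m := by
    intro r hr
    have h1 : Real.exp (-(l * r)) * ‖P.eval x r - P.eval y r‖ ≤ m := hmax hr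
    rw [Real.exp_neg, inv_mul_le_iff₀ (Real.exp_pos _)] at h1
    exact h1
  have hhist : ∀ s ∈ Icc (0 : ℝ) P.T, ‖P.history x s - P.history y s‖ ≤ Real.exp (l * s) * m := by
    intro s hs
    rw [ContinuousMap.norm_le _ (by positivity)]
    intro r
    have hr : min (r : ℝ) s ∈ Icc (0 : ℝ) P.T := ⟨le_min r.2.1 hs.1, (min_le_right _ _).trans hs.2⟩
    refine (hz _ hr).trans ?_
    gcongr
    exact min_le_right _ _
  have key := hC u v x y hx hy (fun s => ENNReal.ofReal (Real.exp (l * s) * m))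
    (fun s hs => by
      rw [← ofReal_norm, ← ENNReal.ofReal_mul hH.le]
      refine ENNReal.ofReal_le_ofReal ((hh.lipschitz s hs _ _).trans ?_)
      gcongr
      exact hhist s hs) t₀ ht₀
  have hint : ∫⁻ s in Ioc 0 P.T, singularKernel (P.ν * ς) 0 (t₀ - s) *
      ENNReal.ofReal (Real.exp (l * s) * m) ≤ ENNReal.ofReal (Real.exp (l * t₀) * m * κ) := by
    calc _ = ∫⁻ s in Ioc 0 P.T, ENNReal.ofReal (Real.exp (l * t₀) * m) *
          singularKernel (P.ν * ς) l (t₀ - s) := by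
          refine lintegral_congr fun s => ?_
          rw [ENNReal.ofReal_mul (Real.exp_nonneg (l * s)),
            ENNReal.ofReal_mul (Real.exp_nonneg (l * t₀)), ← mul_assoc, singularKernel_mul_exp,
            mul_right_comm]
      _ ≤ ENNReal.ofReal (Real.exp (l * t₀) * m) * ENNReal.ofReal κ := by
          rw [lintegral_const_mul' _ _ ENNReal.ofReal_ne_top, hκ, ← lintegral_singularKernel ha hl]
          exact mul_le_mul' le_rfl (lintegral_comp_sub_left_le _ _ _)
      _ = _ := (ENNReal.ofReal_mul (by positivity)).symm
  have h2 : ‖P.eval x t₀ - P.eval y t₀‖ ≤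
      q * (Real.exp (l * t₀) * m) + C * (Real.exp (l * t₀) * m * κ) + e := by
    rw [← ENNReal.ofReal_le_ofReal_iff (by positivity), ofReal_norm,
      ENNReal.ofReal_add (by positivity) he, ENNReal.ofReal_add (by positivity) (by positivity)]
    refine key.trans (add_le_add (add_le_add ?_ ?_) ?_)
    · rw [← ENNReal.ofReal_mul (by positivity), mul_comm ‖fracPowNeg P.A ς‖ H]
    · rw [ENNReal.ofReal_mul hC0]
      gcongr
    · rw [← ofReal_norm]
      exact ENNReal.ofReal_le_ofReal (hce t₀ ht₀)
  have h3 : m ≤ q * m + C * κ * m + e := by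
    have hE : Real.exp (-(l * t₀)) * Real.exp (l * t₀) = 1 := by rw [← Real.exp_add]; simp
    have hE1 : Real.exp (-(l * t₀)) ≤ 1 := Real.exp_le_one_iff.2 (by
      have := mul_nonneg hl.le ht₀.1
      linarith)
    calc m ≤ Real.exp (-(l * t₀)) *
          (q * (Real.exp (l * t₀) * m) + C * (Real.exp (l * t₀) * m * κ) + e) := by
          rw [hm]
          gcongr
      _ = (Real.exp (-(l * t₀)) * Real.exp (l * t₀)) * (q * m + C * κ * m) +
          Real.exp (-(l * t₀)) * e := by ring
      _ ≤ 1 * (q * m + C * κ * m) + 1 * e := by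
          rw [hE]
          gcongr
      _ = _ := by ring
  have h4 : C * κ * m ≤ (1 - q) / 2 * m := by gcongr
  have h5 : m ≤ 2 / (1 - q) * e := by
    rw [div_mul_eq_mul_div, le_div_iff₀ hsmall]
    nlinarith
  intro t ht
  calc _ ≤ Real.exp (l * t) * m := hz t ht
    _ ≤ Real.exp (l * P.T) * (2 / (1 - q) * e) := by
        gcongr
        exact ht.2
    _ = _ := by ring

theorem eq_of_isMildSolution (hH : 0 < H) (hsmall : 0 < 1 - H * ‖fracPowNeg P.A ς‖)
    {u : P.Control} {x y : P.Path} (hx : P.IsMildSolution u x) (hy : P.IsMildSolution u y) :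
    x = y := by
  obtain ⟨C, -, hC⟩ := exists_norm_sub_le hbdd hres hsmooth hς hh hH hsmall
  have hzero : ∀ t ∈ Icc (0 : ℝ) P.T, ‖P.controlTerm (u - u) t‖ ≤ 0 := by
    intro t ht
    rw [norm_le_zero_iff, sub_self, controlTerm]
    refine integral_eq_zero_of_ae ?_
    have h0 : ∀ᵐ s ∂(volume.restrict (Ioc 0 t)), (0 : P.Control) s = 0 :=
      ae_mono (Measure.restrict_mono (Ioc_subset_Ioc_right ht.2) le_rfl) (Lp.coeFn_zero U 2 _)
    filter_upwards [h0] with s hs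
    rw [hs, map_zero, map_zero, smul_zero]
    rfl
  ext t
  have h := hC u u x y hx hy 0 le_rfl hzero t t.2
  rw [mul_zero, norm_le_zero_iff, sub_eq_zero] at h
  simpa [eval] using h

/-- Stability in mean of mild solutions of systems without memory. -/
theorem exists_lintegral_enorm_sub_le (hH : 0 < H)
    (hsmall : 0 < 1 - H * ‖fracPowNeg P.A ς‖) (hmem : P.Memoryless) :
    ∃ C : ℝ, 0 ≤ C ∧ ∀ (u v : P.Control) (x y : P.Path),
      P.IsMildSolution u x → P.IsMildSolution v y →
      ∫⁻ t in Ioc 0 P.T, ‖P.eval x t - P.eval y t‖ₑ ≤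
        ENNReal.ofReal C * ∫⁻ t in Ioc 0 P.T, ‖P.controlTerm (u - v) t‖ₑ := by
  obtain ⟨C, hC0, hC⟩ := exists_enorm_sub_le hbdd hres hsmooth hς hh
  set q := H * ‖fracPowNeg P.A ς‖ with hq
  have hq0 : 0 ≤ q := by positivity
  have ha : 0 < P.ν * ς := mul_pos P.ν_pos hς.1
  obtain ⟨l, hl, hlκ⟩ := exists_weight_le ha (η := (1 - q) / (2 * (C + 1))) (by positivity)
  set κ := (1 / l) ^ (P.ν * ς) * Real.Gamma (P.ν * ς) with hκ
  have hκ0 : 0 ≤ κ := mul_nonneg (Real.rpow_nonneg (by positivity) _) (Real.Gamma_pos_of_pos ha).le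
  have hCκ : C * κ ≤ (1 - q) / 2 := by
    calc C * κ ≤ (C + 1) * ((1 - q) / (2 * (C + 1))) := by
          gcongr
          linarith
      _ = (1 - q) / 2 := by field_simp
  refine ⟨Real.exp (l * P.T) * (2 / (1 - q)), by positivity, fun u v x y hx hy => ?_⟩
  set I := ∫⁻ t in Ioc 0 P.T, ‖P.controlTerm (u - v) t‖ₑ with hI
  by_cases hItop : I = ∞
  · rw [hItop, ENNReal.mul_top]
    · exact le_top
    · rw [ne_eq, ENNReal.ofReal_eq_zero, not_le]
      positivity
  have hzc : Continuous fun t : ℝ => P.eval x t - P.eval y t := by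
    unfold eval
    fun_prop
  set E : ℝ → ℝ≥0∞ := fun t => ENNReal.ofReal (Real.exp (-(l * t))) with hE
  have hEm : Measurable E := by fun_prop
  set f : ℝ → ℝ≥0∞ := fun t => E t * ‖P.eval x t - P.eval y t‖ₑ with hf
  have hfm : Measurable f := hEm.mul hzc.enorm.measurable
  set F := ∫⁻ t in Ioc 0 P.T, f t with hF
  have hE1 : ∀ t : ℝ, 0 ≤ t → E t ≤ 1 := by
    intro t ht
    rw [hE, ENNReal.ofReal_le_one, Real.exp_le_one_iff]
    have := mul_nonneg hl.le ht
    linarith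
  have hFtop : F ≠ ∞ := by
    obtain ⟨B, hB⟩ := (isCompact_Icc (a := (0 : ℝ)) (b := P.T)).exists_bound_of_continuousOn
      hzc.continuousOn
    refine ne_top_of_le_ne_top (b := ∫⁻ t in Ioc 0 P.T, ENNReal.ofReal B) ?_ ?_
    · rw [lintegral_const]
      exact ENNReal.mul_ne_top ENNReal.ofReal_ne_top (by simp)
    · refine setLIntegral_mono measurable_const fun t ht => ?_
      calc f t ≤ 1 * ENNReal.ofReal B := by
            refine mul_le_mul' (hE1 t ht.1.le) ?_
            rw [← ofReal_norm]
            exact ENNReal.ofReal_le_ofReal (hB t ⟨ht.1.le, ht.2⟩)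
        _ = _ := one_mul _
  have hlip : ∀ s ∈ Icc (0 : ℝ) P.T, ‖P.neutralLift ς x s - P.neutralLift ς y s‖ₑ ≤
      ENNReal.ofReal H * ‖P.eval x s - P.eval y s‖ₑ := by
    intro s hs
    have hconst : ∀ z : P.Path, P.h s (P.history z s) =
        P.h s (ContinuousMap.const _ (P.eval z s)) := by
      intro z
      refine hmem s hs _ _ ?_
      have hps : (projIcc 0 P.T P.T_pos.le s : ℝ) = s := by
        rw [projIcc_of_mem P.T_pos.le hs]
      change P.eval z (min (projIcc 0 P.T P.T_pos.le s : ℝ) s) = P.eval z s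
      rw [hps, min_self]
    rw [neutralLift, neutralLift, hconst x, hconst y, ← ofReal_norm, ← ofReal_norm,
      ← ENNReal.ofReal_mul hH.le]
    refine ENNReal.ofReal_le_ofReal ((hh.lipschitz s hs _ _).trans ?_)
    gcongr
    rw [ContinuousMap.norm_le _ (norm_nonneg _)]
    exact fun r => le_rfl
  have hpt : ∀ t ∈ Ioc (0 : ℝ) P.T, f t ≤ ENNReal.ofReal q * f t +
      ENNReal.ofReal C * (∫⁻ s in Ioc 0 P.T, singularKernel (P.ν * ς) l (t - s) * f s) +
      ‖P.controlTerm (u - v) t‖ₑ := by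
    intro t ht
    have h1 := hC u v x y hx hy (fun s => ‖P.eval x s - P.eval y s‖ₑ) hlip t ⟨ht.1.le, ht.2⟩
    have h2 : E t * (∫⁻ s in Ioc 0 P.T, singularKernel (P.ν * ς) 0 (t - s) *
        ‖P.eval x s - P.eval y s‖ₑ) =
        ∫⁻ s in Ioc 0 P.T, singularKernel (P.ν * ς) l (t - s) * f s := by
      rw [← lintegral_const_mul' _ _ ENNReal.ofReal_ne_top]
      refine lintegral_congr fun s => ?_
      have h3 := singularKernel_mul_exp (P.ν * ς) l t s
      have h4 : ∀ r : ℝ, E r * ENNReal.ofReal (Real.exp (l * r)) = 1 := by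
        intro r
        rw [hE, ← ENNReal.ofReal_mul (Real.exp_nonneg _), ← Real.exp_add]
        simp
      calc _ = E t * (singularKernel (P.ν * ς) 0 (t - s) *
            (E s * ENNReal.ofReal (Real.exp (l * s)))) * ‖P.eval x s - P.eval y s‖ₑ := by
            rw [h4 s, mul_one, mul_assoc]
        _ = E t * (singularKernel (P.ν * ς) 0 (t - s) * ENNReal.ofReal (Real.exp (l * s))) *
            (E s * ‖P.eval x s - P.eval y s‖ₑ) := by ring
        _ = (E t * ENNReal.ofReal (Real.exp (l * t))) * singularKernel (P.ν * ς) l (t - s) *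
            (E s * ‖P.eval x s - P.eval y s‖ₑ) := by
            rw [h3]
            ring
        _ = _ := by rw [h4 t, one_mul]
    calc f t ≤ E t * (ENNReal.ofReal (‖fracPowNeg P.A ς‖ * H) * ‖P.eval x t - P.eval y t‖ₑ +
          ENNReal.ofReal C * (∫⁻ s in Ioc 0 P.T, singularKernel (P.ν * ς) 0 (t - s) *
            ‖P.eval x s - P.eval y s‖ₑ) + ‖P.controlTerm (u - v) t‖ₑ) := by
          exact mul_le_mul' le_rfl h1
      _ = ENNReal.ofReal q * f t + ENNReal.ofReal C *
          (∫⁻ s in Ioc 0 P.T, singularKernel (P.ν * ς) l (t - s) * f s) +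
          E t * ‖P.controlTerm (u - v) t‖ₑ := by
          rw [← h2, hq, mul_comm H]
          simp only [hf]
          ring
      _ ≤ _ := by
          gcongr
          exact mul_le_of_le_one_left zero_le (hE1 t ht.1.le)
  have hFle : F ≤ ENNReal.ofReal q * F + ENNReal.ofReal C * (ENNReal.ofReal κ * F) + I := by
    have hm1 : Measurable fun t => ∫⁻ s in Ioc 0 P.T,
        singularKernel (P.ν * ς) l (t - s) * f s := by
      refine Measurable.lintegral_prod_right' (f := fun p : ℝ × ℝ =>
        singularKernel (P.ν * ς) l (p.1 - p.2) * f p.2) ?_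
      exact ((measurable_singularKernel _ _).comp (measurable_fst.sub measurable_snd)).mul
        (hfm.comp measurable_snd)
    calc F ≤ ∫⁻ t in Ioc 0 P.T, (ENNReal.ofReal q * f t + ENNReal.ofReal C *
          (∫⁻ s in Ioc 0 P.T, singularKernel (P.ν * ς) l (t - s) * f s) +
          ‖P.controlTerm (u - v) t‖ₑ) :=
          lintegral_mono_ae ((ae_restrict_mem measurableSet_Ioc).mono hpt)
      _ = ENNReal.ofReal q * F + ENNReal.ofReal C * (∫⁻ t in Ioc 0 P.T,
          ∫⁻ s in Ioc 0 P.T, singularKernel (P.ν * ς) l (t - s) * f s) + I := by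
          rw [lintegral_add_left (by fun_prop), lintegral_add_left (by fun_prop),
            lintegral_const_mul _ hfm, lintegral_const_mul _ hm1]
      _ ≤ _ := by
          rw [hκ, ← lintegral_singularKernel ha hl]
          gcongr
          exact lintegral_lintegral_conv_le (measurable_singularKernel _ _) hfm.aemeasurable
  have hFreal : F ≤ ENNReal.ofReal (2 / (1 - q)) * I := by
    rw [← ENNReal.ofReal_toReal hFtop, ← ENNReal.ofReal_toReal hItop,
      ← ENNReal.ofReal_mul hκ0, ← ENNReal.ofReal_mul hC0, ← ENNReal.ofReal_mul hq0,
      ← ENNReal.ofReal_add (by positivity) (by positivity),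
      ← ENNReal.ofReal_add (by positivity) (by positivity),
      ENNReal.ofReal_le_ofReal_iff (by positivity)] at hFle
    rw [← ENNReal.ofReal_toReal hFtop, ← ENNReal.ofReal_toReal hItop,
      ← ENNReal.ofReal_mul (by positivity)]
    refine ENNReal.ofReal_le_ofReal ?_
    have hF0 : 0 ≤ F.toReal := ENNReal.toReal_nonneg
    have h4 : C * κ * F.toReal ≤ (1 - q) / 2 * F.toReal := by gcongr
    rw [div_mul_eq_mul_div, le_div_iff₀ hsmall]
    nlinarith
  calc ∫⁻ t in Ioc 0 P.T, ‖P.eval x t - P.eval y t‖ₑ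
      ≤ ∫⁻ t in Ioc 0 P.T, ENNReal.ofReal (Real.exp (l * P.T)) * f t := by
        refine lintegral_mono_ae ((ae_restrict_mem measurableSet_Ioc).mono fun t ht => ?_)
        rw [hf, ← mul_assoc, hE, ← ENNReal.ofReal_mul (Real.exp_nonneg _), ← Real.exp_add]
        refine le_mul_of_one_le_left zero_le ?_
        rw [ENNReal.one_le_ofReal, Real.one_le_exp_iff]
        have := mul_le_mul_of_nonneg_left ht.2 hl.le
        linarith
    _ = ENNReal.ofReal (Real.exp (l * P.T)) * F := lintegral_const_mul _ hfm
    _ ≤ ENNReal.ofReal (Real.exp (l * P.T)) * (ENNReal.ofReal (2 / (1 - q)) * I) := by gcongr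
    _ = _ := by rw [← mul_assoc, ← ENNReal.ofReal_mul (Real.exp_nonneg _)]

end NeutralSystem

end Comparison

section Minimization

theorem memLp_indicator_rpow {ν δ T : ℝ} (hδ : 0 ≤ δ) (h : 0 < δ ∨ 1 / 2 < ν) (hν : ν < 1)
    (hT : 0 < T) :
    MemLp ((Ioc δ T).indicator fun τ : ℝ => τ ^ (ν - 1)) 2 volume := by
  rw [memLp_indicator_iff_restrict measurableSet_Ioc]
  have hmeas : Measurable fun τ : ℝ => τ ^ (ν - 1) := by fun_prop
  by_cases hδ0 : 0 < δ
  · refine MemLp.of_bound hmeas.aestronglyMeasurable (δ ^ (ν - 1)) ?_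
    filter_upwards [ae_restrict_mem measurableSet_Ioc] with τ hτ
    rw [Real.norm_of_nonneg (Real.rpow_nonneg (hδ.trans hτ.1.le) _)]
    exact Real.rpow_le_rpow_of_nonpos hδ0 hτ.1.le (by linarith)
  · have hν2 := h.resolve_left hδ0
    have hδ' : δ = 0 := le_antisymm (not_lt.1 hδ0) hδ
    subst hδ'
    rw [memLp_two_iff_integrable_sq hmeas.aestronglyMeasurable]
    have h1 := intervalIntegral.intervalIntegrable_rpow' (a := 0) (b := T) (r := 2 * (ν - 1))
      (by linarith)
    rw [intervalIntegrable_iff_integrableOn_Ioc_of_le hT.le] at h1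
    refine IntegrableOn.congr_fun h1 (fun τ hτ => ?_) measurableSet_Ioc
    rw [mul_comm, Real.rpow_mul hτ.1.le]
    exact_mod_cast Real.rpow_natCast (τ ^ (ν - 1)) 2

theorem lintegral_indicator_rpow {ν δ : ℝ} (hν : 0 < ν) (hδ : 0 < δ) {K : ℝ} (hK : 0 ≤ K) :
    ∫⁻ τ, (Ioc 0 δ).indicator (fun τ : ℝ => ENNReal.ofReal (K * τ ^ (ν - 1))) τ =
      ENNReal.ofReal (K * (δ ^ ν / ν)) := by
  rw [lintegral_indicator measurableSet_Ioc, ← ofReal_integral_eq_lintegral_ofReal]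
  · rw [integral_const_mul, ← intervalIntegral.integral_of_le hδ.le,
      integral_rpow (Or.inl (by linarith)), sub_add_cancel, Real.zero_rpow hν.ne', sub_zero]
  · have := (intervalIntegral.intervalIntegrable_rpow' (a := 0) (b := δ) (r := ν - 1)
      (by linarith)).const_mul K
    rwa [intervalIntegrable_iff_integrableOn_Ioc_of_le hδ.le] at this
  · filter_upwards [ae_restrict_mem measurableSet_Ioc] with τ hτ
    exact mul_nonneg hK (Real.rpow_nonneg hτ.1.le _)

theorem mem_of_weak_limit {E : Type*} [NormedAddCommGroup E] [NormedSpace ℝ E] {s : Set E}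
    (hs : Convex ℝ s) (hsc : IsClosed s) {u : ℕ → E} (hu : ∀ n, u n ∈ s) {x : E}
    (h : ∀ ℓ : StrongDual ℝ E, Tendsto (fun n => ℓ (u n)) atTop (𝓝 (ℓ x))) : x ∈ s := by
  by_contra hx
  obtain ⟨f, c, h1, h2⟩ := geometric_hahn_banach_closed_point hs hsc hx
  exact absurd (le_of_tendsto (h f) (Eventually.of_forall fun n => (h1 _ (hu n)).le)) (not_le.2 h2)

theorem lintegral_enorm_Lp_two_le {α E : Type*} [MeasurableSpace α] {μ : Measure α}
    [NormedAddCommGroup E] (w : Lp E 2 μ) :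
    ∫⁻ a, ‖w a‖ₑ ∂μ ≤ ‖w‖ₑ * μ univ ^ (1 / 2 : ℝ) := by
  have h := eLpNorm_le_eLpNorm_mul_rpow_measure_univ (p := 1) (q := 2) (by norm_num)
    (Lp.aestronglyMeasurable w)
  rw [eLpNorm_one_eq_lintegral_enorm] at h
  refine h.trans_eq ?_
  rw [Lp.enorm_def]
  norm_num

theorem integral_norm_sq_Lp {α E : Type*} [MeasurableSpace α] {μ : Measure α}
    [NormedAddCommGroup E] (w : Lp E 2 μ) : ∫ a, ‖w a‖ ^ 2 ∂μ = ‖w‖ ^ 2 := by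
  rw [integral_eq_lintegral_of_nonneg_ae (ae_of_all _ fun a => sq_nonneg _)
    ((Lp.aestronglyMeasurable w).norm.pow 2)]
  have h : ∀ a, ENNReal.ofReal (‖w a‖ ^ 2) = ‖w a‖ₑ ^ 2 := fun a => by
    rw [ENNReal.ofReal_pow (norm_nonneg _), ofReal_norm]
  simp only [h]
  rw [lintegral_enorm_sq_Lp, ENNReal.toReal_pow, toReal_enorm]

namespace NeutralSystem

variable {X U : Type*} [NormedAddCommGroup X] [NormedSpace ℝ X]
  [NormedAddCommGroup U] [NormedSpace ℝ U] (P : NeutralSystem X U)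

/-- The kernel `τ ↦ τ^(ν-1) K_ν(τ) B`, restricted to delays in `(δ, T]`. -/
noncomputable def controlKernel (δ : ℝ) : ℝ → U →L[ℝ] X :=
  (Ioc δ P.T).indicator fun τ =>
    τ ^ (P.ν - 1) • (P.semigroup.subordinated P.ν τ).comp P.B

variable {P}

theorem controlTerm_eq_conv (w : P.Control) {t : ℝ} (ht : t ≤ P.T) :
    P.controlTerm w t = ∫ s in Ioc 0 P.T, P.controlKernel 0 (t - s) (w s) := by
  have h1 : ∀ s ∈ Ioc 0 P.T, P.controlKernel 0 (t - s) (w s) = (Iio t).indicator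
      (fun s => (t - s) ^ (P.ν - 1) • P.semigroup.subordinated P.ν (t - s) (P.B (w s))) s := by
    intro s hs
    rw [controlKernel]
    by_cases hst : s < t
    · rw [indicator_of_mem (show t - s ∈ Ioc 0 P.T from ⟨sub_pos.2 hst, by linarith [hs.1]⟩),
        indicator_of_mem (mem_Iio.2 hst)]
      rfl
    · rw [indicator_of_notMem (fun h => hst (sub_pos.1 h.1)), indicator_of_notMem (show s ∉ Iio t from hst),
        zero_apply]
  rw [setIntegral_congr_fun measurableSet_Ioc h1, setIntegral_indicator measurableSet_Iio]
  have h2 : Ioc 0 P.T ∩ Iio t = Ioo 0 t := by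
    ext s
    simp only [mem_inter_iff, mem_Ioc, mem_Iio, mem_Ioo]
    constructor
    · rintro ⟨⟨h1, -⟩, h2⟩
      exact ⟨h1, h2⟩
    · rintro ⟨h1, h2⟩
      exact ⟨⟨h1, h2.le.trans ht⟩, h2⟩
  rw [h2, ← integral_Ioc_eq_integral_Ioo]
  rfl

variable [CompleteSpace X] [CompleteSpace U]
    (hbdd : P.semigroup.UniformlyBounded) (hcompact : P.semigroup.IsCompactSemigroup)
    (hsmooth : P.semigroup.SmoothingEstimates P.T)

omit [CompleteSpace X] [CompleteSpace U] in
include hbdd in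
theorem exists_norm_controlKernel_le : ∃ K : ℝ, 0 ≤ K ∧ ∀ τ : ℝ, 0 < τ →
    ‖τ ^ (P.ν - 1) • (P.semigroup.subordinated P.ν τ).comp P.B‖ ≤ K * τ ^ (P.ν - 1) := by
  obtain ⟨M, hM⟩ := hbdd
  have hM0 : 0 ≤ M := (norm_nonneg _).trans (hM 0 le_rfl)
  have hI : 0 ≤ ∫ θ in Ioi (0 : ℝ), ‖θ * probDensity P.ν θ‖ := integral_nonneg fun _ => norm_nonneg _
  have hν := P.ν_pos
  refine ⟨P.ν * ((∫ θ in Ioi (0 : ℝ), ‖θ * probDensity P.ν θ‖) * M) * ‖P.B‖, by positivity,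
    fun τ hτ => ?_⟩
  rw [norm_smul, Real.norm_of_nonneg (Real.rpow_nonneg hτ.le _), mul_comm]
  gcongr
  refine (ContinuousLinearMap.opNorm_comp_le _ _).trans ?_
  gcongr
  exact C0Semigroup.norm_subordinated_le P.ν_pos hM P.ν_lt_one hτ.le

omit [CompleteSpace X] [CompleteSpace U] in
include hbdd hsmooth in
theorem memLp_controlKernel {δ : ℝ} (hδ : 0 ≤ δ) (h : 0 < δ ∨ 1 / 2 < P.ν) :
    MemLp (P.controlKernel δ) 2 volume := by
  obtain ⟨K, hK0, hK⟩ := exists_norm_controlKernel_le hbdd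
  obtain ⟨M, hM⟩ := hbdd
  refine ((memLp_indicator_rpow hδ h P.ν_lt_one P.T_pos).const_mul K).mono ?_ (ae_of_all _ fun τ => ?_)
  · rw [controlKernel, aestronglyMeasurable_indicator_iff measurableSet_Ioc]
    refine ContinuousOn.aestronglyMeasurable ?_ measurableSet_Ioc
    have hsub : Ioc δ P.T ⊆ Ioi 0 := fun τ hτ => hδ.trans_lt hτ.1
    have h1 : ContinuousOn (fun τ : ℝ => τ ^ (P.ν - 1)) (Ioc δ P.T) := fun τ hτ =>
      (Real.continuousAt_rpow_const τ _ (Or.inl (ne_of_gt (hsub hτ)))).continuousWithinAt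
    have h2 : ContinuousOn (fun τ : ℝ => (P.semigroup.subordinated P.ν τ).comp P.B)
        (Ioc δ P.T) :=
      ((C0Semigroup.continuousOn_subordinated P.ν_pos P.ν_lt_one P.T_pos hM hsmooth).mono
        hsub).clm_comp continuousOn_const
    exact h1.smul h2
  · rw [controlKernel]
    by_cases hτ : τ ∈ Ioc δ P.T
    · rw [indicator_of_mem hτ, indicator_of_mem hτ]
      exact (hK τ (hδ.trans_lt hτ.1)).trans (le_abs_self _)
    · rw [indicator_of_notMem hτ, indicator_of_notMem hτ]
      simp

omit [CompleteSpace U] in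
include hbdd hcompact hsmooth in
theorem isCompactOperator_controlKernel {δ : ℝ} (hδ : 0 ≤ δ) (τ : ℝ) :
    IsCompactOperator (P.controlKernel δ τ) := by
  rw [controlKernel]
  obtain ⟨M, hM⟩ := hbdd
  by_cases hτ : τ ∈ Ioc δ P.T
  · rw [indicator_of_mem hτ]
    exact ((C0Semigroup.isCompactOperator_subordinated P.ν_pos P.ν_lt_one P.T_pos hM hsmooth
      hcompact (hδ.trans_lt hτ.1)).comp_clm P.B).smul _
  · rw [indicator_of_notMem hτ]
    exact isCompactOperator_zero

omit [CompleteSpace X] [CompleteSpace U] in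
include hbdd hsmooth in
/-- Splitting of the control term into a square-integrable convolution and a small remainder. -/
theorem exists_enorm_controlTerm_le :
    ∃ K : ℝ, 0 ≤ K ∧ ∀ δ : ℝ, 0 < δ → ∀ w : P.Control, ∀ t : ℝ, t ≤ P.T →
      ‖P.controlTerm w t‖ₑ ≤ ‖∫ s in Ioc 0 P.T, P.controlKernel δ (t - s) (w s)‖ₑ +
        ∫⁻ s in Ioc 0 P.T, (Ioc 0 δ).indicator
          (fun τ : ℝ => ENNReal.ofReal (K * τ ^ (P.ν - 1))) (t - s) * ‖w s‖ₑ := by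
  obtain ⟨K, hK0, hK⟩ := exists_norm_controlKernel_le hbdd
  refine ⟨K, hK0, fun δ hδ w t ht => ?_⟩
  rw [controlTerm_eq_conv w ht]
  by_cases hi : Integrable (fun s => P.controlKernel 0 (t - s) (w s)) (volume.restrict (Ioc 0 P.T))
  · have hi' := integrable_conv (memLp_controlKernel hbdd hsmooth hδ.le (Or.inl hδ)) w t
    have h1 : ∫ s in Ioc 0 P.T, P.controlKernel 0 (t - s) (w s) =
        (∫ s in Ioc 0 P.T, P.controlKernel δ (t - s) (w s)) +
          ∫ s in Ioc 0 P.T, (P.controlKernel 0 (t - s) (w s) -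
            P.controlKernel δ (t - s) (w s)) := by
      rw [integral_sub hi hi']
      abel
    rw [h1]
    refine (enorm_add_le _ _).trans (add_le_add le_rfl ?_)
    refine (enorm_integral_le_lintegral_enorm _).trans (lintegral_mono fun s => ?_)
    simp only [controlKernel]
    set τ := t - s with hτ
    rw [← sub_apply]
    by_cases h2 : τ ∈ Ioc δ P.T
    · rw [indicator_of_mem h2, indicator_of_mem (Ioc_subset_Ioc_left hδ.le h2), sub_self]
      simp
    · rw [indicator_of_notMem h2, sub_zero]
      by_cases h3 : τ ∈ Ioc 0 P.T
      · have h4 : τ ∈ Ioc 0 δ := ⟨h3.1, not_lt.1 fun h => h2 ⟨h, h3.2⟩⟩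
        rw [indicator_of_mem h3, indicator_of_mem h4]
        refine (ContinuousLinearMap.le_opENorm _ _).trans ?_
        gcongr
        rw [← ofReal_norm]
        exact ENNReal.ofReal_le_ofReal (hK τ h3.1)
      · rw [indicator_of_notMem h3]
        simp
  · rw [integral_undef hi, enorm_zero]
    exact zero_le

include hbdd hcompact hsmooth in
theorem eventually_norm_controlTerm_le (hν : 1 / 2 < P.ν) {w : ℕ → P.Control} {W : ℝ}
    (hw : ∀ n, ‖w n‖ ≤ W)
    (hw0 : ∀ ℓ : StrongDual ℝ P.Control, Tendsto (fun n => ℓ (w n)) atTop (𝓝 0))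
    {ε : ℝ} (hε : 0 < ε) :
    ∀ᶠ n in atTop, ∀ t ∈ Icc 0 P.T, ‖P.controlTerm (w n) t‖ ≤ ε := by
  filter_upwards [eventually_norm_conv_le (memLp_controlKernel hbdd hsmooth le_rfl (Or.inr hν))
    (isCompactOperator_controlKernel hbdd hcompact hsmooth le_rfl) hw hw0 hε] with n hn t ht
  rw [controlTerm_eq_conv _ ht.2]
  exact hn t ht

include hbdd hcompact hsmooth in
theorem tendsto_lintegral_controlTerm {w : ℕ → P.Control} {W : ℝ} (hw : ∀ n, ‖w n‖ ≤ W)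
    (hw0 : ∀ ℓ : StrongDual ℝ P.Control, Tendsto (fun n => ℓ (w n)) atTop (𝓝 0)) :
    Tendsto (fun n => ∫⁻ t in Ioc 0 P.T, ‖P.controlTerm (w n) t‖ₑ) atTop (𝓝 0) := by
  obtain ⟨K, hK0, hK⟩ := exists_enorm_controlTerm_le hbdd hsmooth
  have hW : 0 ≤ W := (norm_nonneg _).trans (hw 0)
  have hT := P.T_pos
  have hν := P.ν_pos
  have hbound : ∀ δ : ℝ, 0 < δ → ∀ η : ℝ, 0 < η → ∀ᶠ n in atTop,
      ∫⁻ t in Ioc 0 P.T, ‖P.controlTerm (w n) t‖ₑ ≤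
        ENNReal.ofReal (η * P.T + K * (δ ^ P.ν / P.ν) * (W * P.T ^ (1 / 2 : ℝ))) := by
    intro δ hδ η hη
    filter_upwards [eventually_norm_conv_le (memLp_controlKernel hbdd hsmooth hδ.le (Or.inl hδ))
      (isCompactOperator_controlKernel hbdd hcompact hsmooth hδ.le) hw hw0 hη] with n hn
    have hvol : volume.restrict (Ioc 0 P.T) univ = ENNReal.ofReal P.T := by
      simp
    have hwn : ∫⁻ s in Ioc 0 P.T, ‖w n s‖ₑ ≤ ENNReal.ofReal (W * P.T ^ (1 / 2 : ℝ)) := by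
      refine (lintegral_enorm_Lp_two_le (w n)).trans ?_
      rw [hvol, ENNReal.ofReal_mul hW, ← ENNReal.ofReal_rpow_of_nonneg hT.le (by norm_num),
        ← ofReal_norm]
      gcongr
      exact hw n
    set r : ℝ → ℝ≥0∞ := (Ioc 0 δ).indicator
      (fun τ : ℝ => ENNReal.ofReal (K * τ ^ (P.ν - 1))) with hr
    have hrm : Measurable r := Measurable.indicator (by fun_prop) measurableSet_Ioc
    calc _ ≤ ∫⁻ t in Ioc 0 P.T, (ENNReal.ofReal η + ∫⁻ s in Ioc 0 P.T, r (t - s) * ‖w n s‖ₑ) := by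
          refine lintegral_mono_ae ((ae_restrict_mem measurableSet_Ioc).mono fun t ht => ?_)
          refine (hK δ hδ (w n) t ht.2).trans (add_le_add ?_ le_rfl)
          rw [← ofReal_norm]
          exact ENNReal.ofReal_le_ofReal (hn t ⟨ht.1.le, ht.2⟩)
      _ ≤ ENNReal.ofReal η * ENNReal.ofReal P.T +
          ENNReal.ofReal (K * (δ ^ P.ν / P.ν)) * ENNReal.ofReal (W * P.T ^ (1 / 2 : ℝ)) := by
          rw [lintegral_add_left measurable_const, lintegral_const, hvol]
          refine add_le_add le_rfl ((lintegral_lintegral_conv_le hrm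
            (Lp.aestronglyMeasurable (w n)).enorm).trans ?_)
          rw [hr, lintegral_indicator_rpow hν hδ hK0]
          exact mul_le_mul' le_rfl hwn
      _ = _ := by
          rw [← ENNReal.ofReal_mul hη.le, ← ENNReal.ofReal_mul (by positivity),
            ← ENNReal.ofReal_add (by positivity) (by positivity)]
  rw [ENNReal.tendsto_nhds_zero]
  intro ε hε
  obtain ⟨ε', hε'0, hε'⟩ : ∃ ε' : ℝ, 0 < ε' ∧ ENNReal.ofReal ε' ≤ ε := by
    by_cases h : ε = ∞
    · exact ⟨1, one_pos, h ▸ le_top⟩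
    · exact ⟨ε.toReal, ENNReal.toReal_pos hε.ne' h, ENNReal.ofReal_toReal_le⟩
  have hlim : Tendsto (fun δ : ℝ => δ * P.T + K * (δ ^ P.ν / P.ν) * (W * P.T ^ (1 / 2 : ℝ)))
      (𝓝[>] 0) (𝓝 0) := by
    have hc : Continuous fun δ : ℝ =>
        δ * P.T + K * (δ ^ P.ν / P.ν) * (W * P.T ^ (1 / 2 : ℝ)) := by
      have : Continuous fun δ : ℝ => δ ^ P.ν := Real.continuous_rpow_const hν.le
      fun_prop
    have := hc.tendsto 0
    simp only [zero_mul, Real.zero_rpow hν.ne', zero_div, mul_zero, add_zero] at this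
    exact this.mono_left nhdsWithin_le_nhds
  obtain ⟨δ, h1, h2⟩ := ((hlim.eventually_le_const hε'0).and self_mem_nhdsWithin).exists
  filter_upwards [hbound δ h2 δ h2] with n hn
  exact (hn.trans (ENNReal.ofReal_le_ofReal h1)).trans hε'

variable (hres : InResolventSet P.A 0) {ς H H₁ : ℝ} (hς : ς ∈ Set.Ioo (0 : ℝ) 1)
    (hh : P.NeutralTermCondition ς H H₁)

include hbdd hcompact hsmooth hres hς hh in
/-- Weakly convergent controls have states converging almost everywhere along a subsequence. -/
theorem exists_subseq_state_tendsto (hH : 0 < H) (hsmall : 0 < 1 - H * ‖fracPowNeg P.A ς‖)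
    (hν : 1 / 2 < P.ν ∨ P.Memoryless) {u : ℕ → P.Control} {v : P.Control} {x : ℕ → P.Path}
    {y : P.Path} (hx : ∀ n, P.IsMildSolution (u n) (x n)) (hy : P.IsMildSolution v y) {W : ℝ}
    (hu : ∀ n, ‖u n‖ ≤ W)
    (huv : ∀ ℓ : StrongDual ℝ P.Control, Tendsto (fun n => ℓ (u n)) atTop (𝓝 (ℓ v))) :
    ∃ φ : ℕ → ℕ, StrictMono φ ∧ ∀ᵐ t ∂(volume.restrict (Ioc 0 P.T)),
      Tendsto (fun n => P.eval (x (φ n)) t) atTop (𝓝 (P.eval y t)) := by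
  have hw : ∀ n, ‖u n - v‖ ≤ W + ‖v‖ := fun n => (norm_sub_le _ _).trans (by gcongr; exact hu n)
  have hw0 : ∀ ℓ : StrongDual ℝ P.Control, Tendsto (fun n => ℓ (u n - v)) atTop (𝓝 0) := by
    intro ℓ
    have := (huv ℓ).sub_const (ℓ v)
    simpa only [map_sub, sub_self] using this
  rcases hν with hν | hmem
  · refine ⟨id, strictMono_id, ?_⟩
    obtain ⟨C, hC0, hC⟩ := exists_norm_sub_le hbdd hres hsmooth hς hh hH hsmall
    filter_upwards [ae_restrict_mem measurableSet_Ioc] with t ht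
    rw [tendsto_iff_norm_sub_tendsto_zero, Metric.tendsto_nhds]
    intro ε hε
    filter_upwards [eventually_norm_controlTerm_le hbdd hcompact hsmooth hν hw hw0
      (ε := ε / (2 * (C + 1))) (by positivity)] with n hn
    have h1 := hC _ _ _ _ (hx n) hy _ (by positivity) hn t ⟨ht.1.le, ht.2⟩
    rw [Real.dist_eq, sub_zero, abs_of_nonneg (norm_nonneg _)]
    calc _ ≤ C * (ε / (2 * (C + 1))) := h1
      _ ≤ (C + 1) * (ε / (2 * (C + 1))) := by gcongr; linarith
      _ = ε / 2 := by field_simp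
      _ < ε := by linarith
  · obtain ⟨C, hC0, hC⟩ := exists_lintegral_enorm_sub_le hbdd hres hsmooth hς hh hH hsmall hmem
    have h1 := ENNReal.Tendsto.const_mul (a := ENNReal.ofReal C)
      (tendsto_lintegral_controlTerm hbdd hcompact hsmooth hw hw0) (Or.inr ENNReal.ofReal_ne_top)
    rw [mul_zero] at h1
    have hcont : ∀ z : P.Path, Continuous fun t => P.eval z t := by
      intro z
      unfold eval
      fun_prop
    have h2 : Tendsto (fun n => eLpNorm ((fun t => P.eval (x n) t) - fun t => P.eval y t) 1
        (volume.restrict (Ioc 0 P.T))) atTop (𝓝 0) := by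
      refine tendsto_of_tendsto_of_tendsto_of_le_of_le tendsto_const_nhds h1
        (fun n => zero_le) fun n => ?_
      rw [eLpNorm_one_eq_lintegral_enorm]
      exact hC _ _ _ _ (hx n) hy
    exact (tendstoInMeasure_of_tendsto_eLpNorm one_ne_zero
      (fun n => (hcont _).aestronglyMeasurable) (hcont y).aestronglyMeasurable
      h2).exists_seq_tendsto_ae

omit [CompleteSpace X] [CompleteSpace U] in
theorem isMildSolution_state {u : P.Control} (h : ∃ x, P.IsMildSolution u x) :
    P.IsMildSolution u (P.state u) := by
  rw [state, dif_pos h]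
  exact h.choose_spec

omit [CompleteSpace X] [CompleteSpace U] in
theorem cost_eq (xd : X) (θ ε : ℝ) (u : P.Control) : P.cost xd θ ε u =
    (∫ t in Ioc 0 P.T, θ / 2 * ‖P.eval (P.state u) t - xd‖ ^ 2) + ε / 2 * ‖u‖ ^ 2 := by
  rw [cost, intervalIntegral.integral_of_le P.T_pos.le, intervalIntegral.integral_of_le P.T_pos.le,
    integral_norm_sq_Lp, integral_const_mul]

end NeutralSystem

end Minimization

theorem theorem4p1 {X U : Type*} [NormedAddCommGroup X] [NormedSpace ℝ X] [CompleteSpace X]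
    [NormedAddCommGroup U] [NormedSpace ℝ U] [CompleteSpace U]
    (hU : IsReflexiveSpace U)
    (S : NeutralSystem X U)
    (hbdd : S.semigroup.UniformlyBounded)
    (hcompact : S.semigroup.IsCompactSemigroup)
    (hres : InResolventSet S.A 0)
    (hsmooth : S.semigroup.SmoothingEstimates S.T)
    (hν : 1 / 2 < S.ν ∨ S.Memoryless)
    (ς H H₁ : ℝ) (hς : ς ∈ Set.Ioo (0 : ℝ) 1) (hH : 0 < H) (hH₁ : 0 < H₁)
    (hh : S.NeutralTermCondition ς H H₁)
    (hsmall : 0 < 1 - H * ‖fracPowNeg S.A ς‖)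
    (xd : X) (θ ε : ℝ) (hθ : 0 ≤ θ) (hε : 0 < ε)
    (hne : (S.admissible xd).Nonempty)
    (hclosed : IsClosed (S.admissible xd))
    (hconvex : Convex ℝ (S.admissible xd)) :
    (∀ (u : S.Control) (x y : S.Path),
        S.IsMildSolution u x → S.IsMildSolution u y → x = y) ∧
      ∃ u ∈ S.admissible xd, ∀ v ∈ S.admissible xd, S.cost xd θ ε u ≤ S.cost xd θ ε v := by
  refine ⟨fun u x y hx hy =>
    NeutralSystem.eq_of_isMildSolution hbdd hres hsmooth hς hh hH hsmall hx hy, ?_⟩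
  have hmild : ∀ u ∈ S.admissible xd, S.IsMildSolution u (S.state u) := fun u ⟨x, hx, _⟩ =>
    NeutralSystem.isMildSolution_state ⟨x, hx⟩
  set f : S.Control → ℝ → ℝ := fun u t => θ / 2 * ‖S.eval (S.state u) t - xd‖ ^ 2 with hf
  have hf0 : ∀ u t, 0 ≤ f u t := fun u t => by positivity
  have hfc : ∀ u, Continuous (f u) := by
    intro u
    simp only [hf, NeutralSystem.eval]
    fun_prop
  have hfi : ∀ u, Integrable (f u) (volume.restrict (Ioc 0 S.T)) := fun u =>
    ((hfc u).continuousOn.integrableOn_Icc).mono_set Ioc_subset_Icc_self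
  set a : S.Control → ℝ := fun u => ∫ t in Ioc 0 S.T, f u t with ha
  have ha0 : ∀ u, 0 ≤ a u := fun u => integral_nonneg (hf0 u)
  have hcost : ∀ u, S.cost xd θ ε u = a u + ε / 2 * ‖u‖ ^ 2 := NeutralSystem.cost_eq xd θ ε
  have hbelow : BddBelow (S.cost xd θ ε '' S.admissible xd) := by
    refine ⟨0, ?_⟩
    rintro _ ⟨u, -, rfl⟩
    rw [hcost]
    have := ha0 u
    positivity
  set m := sInf (S.cost xd θ ε '' S.admissible xd) with hm
  obtain ⟨c, -, hctend, hcmem⟩ := exists_seq_tendsto_sInf (hne.image (S.cost xd θ ε)) hbelow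
  choose u hu huc using hcmem
  obtain ⟨b, hb⟩ := hctend.bddAbove_range
  have hnorm : ∀ n, ‖u n‖ ≤ 1 + 2 * b / ε := by
    intro n
    have h1 : a (u n) + ε / 2 * ‖u n‖ ^ 2 ≤ b := by
      rw [← hcost, huc]
      exact hb ⟨n, rfl⟩
    have h2 : ‖u n‖ ^ 2 ≤ 2 * b / ε := by
      rw [le_div_iff₀ hε]
      linarith [ha0 (u n)]
    nlinarith [sq_nonneg (‖u n‖ - 1)]
  obtain ⟨v, φ, hφ, hv⟩ := hU.exists_weakly_convergent_subseq_L2 u _ hnorm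
  have hvadm : v ∈ S.admissible xd :=
    mem_of_weak_limit hconvex hclosed (fun n => hu (φ n)) hv
  obtain ⟨χ, hχ, hae⟩ := NeutralSystem.exists_subseq_state_tendsto hbdd hcompact hsmooth hres hς hh
    hH hsmall hν (fun n => hmild _ (hu (φ n))) (hmild v hvadm) (fun n => hnorm (φ n)) hv
  set w : ℕ → S.Control := fun n => u (φ (χ n)) with hw
  have hcw : Tendsto (fun n => S.cost xd θ ε (w n)) atTop (𝓝 m) := by
    have := hctend.comp (hφ.comp hχ).tendsto_atTop
    refine this.congr fun n => ?_
    exact (huc _).symm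
  obtain ⟨ℓ, hℓ, hℓv⟩ := exists_dual_vector'' ℝ v
  have hℓw : Tendsto (fun n => ε / 2 * ℓ (w n) ^ 2) atTop (𝓝 (ε / 2 * ‖v‖ ^ 2)) := by
    have h1 := ((hv ℓ).comp hχ.tendsto_atTop).pow 2
    rw [hℓv] at h1
    exact h1.const_mul (ε / 2)
  have hle : ∀ n, a (w n) ≤ S.cost xd θ ε (w n) - ε / 2 * ℓ (w n) ^ 2 := by
    intro n
    rw [hcost]
    have h1 : ‖ℓ (w n)‖ ≤ ‖w n‖ := (ℓ.le_of_opNorm_le hℓ _).trans_eq (one_mul _)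
    have h2 : ℓ (w n) ^ 2 ≤ ‖w n‖ ^ 2 := by
      rw [← sq_abs (ℓ (w n))]
      exact pow_le_pow_left₀ (abs_nonneg _) h1 2
    have h3 := mul_le_mul_of_nonneg_left h2 (half_pos hε).le
    linarith
  have hlim := hcw.sub hℓw
  have hpos : 0 ≤ m - ε / 2 * ‖v‖ ^ 2 :=
    ge_of_tendsto' hlim fun n => (ha0 (w n)).trans (hle n)
  have hlint : ∀ z, ENNReal.ofReal (a z) = ∫⁻ t in Ioc 0 S.T, ENNReal.ofReal (f z t) := fun z =>
    ofReal_integral_eq_lintegral_ofReal (hfi z) (ae_of_all _ (hf0 z))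
  have hfatou : a v ≤ m - ε / 2 * ‖v‖ ^ 2 := by
    rw [← ENNReal.ofReal_le_ofReal_iff hpos, hlint]
    calc ∫⁻ t in Ioc 0 S.T, ENNReal.ofReal (f v t)
        = ∫⁻ t in Ioc 0 S.T, liminf (fun n => ENNReal.ofReal (f (w n) t)) atTop := by
          refine lintegral_congr_ae ?_
          filter_upwards [hae] with t ht
          have h1 : Tendsto (fun n => f (w n) t) atTop (𝓝 (f v t)) :=
            ((ht.sub_const xd).norm.pow 2).const_mul (θ / 2)
          exact (ENNReal.tendsto_ofReal h1).liminf_eq.symm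
      _ ≤ liminf (fun n => ∫⁻ t in Ioc 0 S.T, ENNReal.ofReal (f (w n) t)) atTop :=
          lintegral_liminf_le fun n => (hfc (w n)).measurable.ennreal_ofReal
      _ = liminf (fun n => ENNReal.ofReal (a (w n))) atTop := by simp only [hlint]
      _ ≤ liminf (fun n => ENNReal.ofReal (S.cost xd θ ε (w n) - ε / 2 * ℓ (w n) ^ 2)) atTop :=
          liminf_le_liminf (Eventually.of_forall fun n => ENNReal.ofReal_le_ofReal (hle n))
      _ = ENNReal.ofReal (m - ε / 2 * ‖v‖ ^ 2) := (ENNReal.tendsto_ofReal hlim).liminf_eq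
  refine ⟨v, hvadm, fun z hz => ?_⟩
  have h1 : m ≤ S.cost xd θ ε z := csInf_le hbelow ⟨z, hz, rfl⟩
  rw [hcost v]
  linarith
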